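/- Let $n \ge 2$ and let $(M,g)$ be a compact, simply connected Lorentzian manifold of dimension $n$, that is, $M$ is a compact, simply connected (in particular connected and non-empty) smooth Hausdorff manifold without boundary, and $g$ is a smooth field of symmetric bilinear forms of signature $(1,n-1)$ (one negative direction) on its tangent spaces. Then $(M,g)$ is not conformally flat: it is not the case that every point of $M$ has an open neighbourhood $U$ with a smooth diffeomorphism $\varphi$ from $U$ onto an open subset of $\mathbb{R}^n$ and a smooth function $c : U \to (0,\infty)$ such that $\varphi^*(-dx_0^2+dx_1^2+\cdots+dx_{n-1}^2) = c\,g$ on $U$. -/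

import Mathlib

open scoped Manifold ContDiff

/-- The sign of the `i`-th direction in signature `(1, n - 1)`:
one negative direction (the first one), all the others positive. -/
def lorentzSign {n : ℕ} (i : Fin n) : ℝ := if (i : ℕ) = 0 then -1 else 1

/-- The flat Minkowski form `-x₀ y₀ + x₁ y₁ + ⋯ + xₙ₋₁ yₙ₋₁` on `ℝⁿ`; read on every tangent space
of `ℝⁿ`, it is the metric of the flat Minkowski space of dimension `n`. -/
def minkowskiForm {n : ℕ} (x y : EuclideanSpace ℝ (Fin n)) : ℝ :=
  ∑ i, lorentzSign i * (x i * y i)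

/-- A smooth Lorentzian metric on a smooth `n`-manifold `M` without boundary (with `n ≥ 1`; for
`n = 0` there is no such thing): a smooth field of symmetric bilinear forms of signature
`(1, n - 1)` on the tangent spaces. -/
structure LorentzianMetric (n : ℕ) (M : Type*) [TopologicalSpace M]
    [ChartedSpace (EuclideanSpace ℝ (Fin n)) M] [IsManifold (𝓡 n) ∞ M] where
  /-- The bilinear form on each tangent space. -/
  val (x : M) : TangentSpace (𝓡 n) x →L[ℝ] TangentSpace (𝓡 n) x →L[ℝ] ℝ
  symm (x : M) (v w : TangentSpace (𝓡 n) x) : val x v w = val x w v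
  /-- Each tangent space has an orthonormal basis with exactly one timelike vector. -/
  signature (x : M) : ∃ b : Module.Basis (Fin n) ℝ (TangentSpace (𝓡 n) x),
    ∀ i j, val x (b i) (b j) = if i = j then lorentzSign i else 0
  /-- The metric is a smooth section of the bundle of bilinear forms on the tangent bundle. -/
  contMDiff : ContMDiff (𝓡 n)
    ((𝓡 n).prod 𝓘(ℝ, EuclideanSpace ℝ (Fin n) →L[ℝ] EuclideanSpace ℝ (Fin n) →L[ℝ] ℝ)) ∞
    (fun x ↦ Bundle.TotalSpace.mk' (EuclideanSpace ℝ (Fin n) →L[ℝ] EuclideanSpace ℝ (Fin n) →L[ℝ] ℝ)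
      (E := fun x ↦ TangentSpace (𝓡 n) x →L[ℝ] TangentSpace (𝓡 n) x →L[ℝ] ℝ) x (val x))

/-- `(M, g)` is conformally flat if it is locally conformally equivalent to the flat Minkowski
space: around every point there is a smooth diffeomorphism `φ` from an open subset of `M` onto an
open subset of Minkowski space that pulls the Minkowski metric back to `c • g`, for a smooth
positive function `c`. -/
def LorentzianMetric.IsConformallyFlat {n : ℕ} {M : Type*} [TopologicalSpace M]
    [ChartedSpace (EuclideanSpace ℝ (Fin n)) M] [IsManifold (𝓡 n) ∞ M]
    (g : LorentzianMetric n M) : Prop :=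
  -- `ℝⁿ` carries its standard manifold structure (this line only fixes its syntactic form).
  letI : ChartedSpace (EuclideanSpace ℝ (Fin n)) (EuclideanSpace ℝ (Fin n)) := chartedSpaceSelf _
  ∀ p : M, ∃ (φ : OpenPartialHomeomorph M (EuclideanSpace ℝ (Fin n))) (c : M → ℝ),
    p ∈ φ.source ∧
    ContMDiffOn (𝓡 n) (𝓡 n) ∞ φ φ.source ∧
    ContMDiffOn (𝓡 n) (𝓡 n) ∞ φ.symm φ.target ∧
    ContMDiffOn (𝓡 n) 𝓘(ℝ, ℝ) ∞ c φ.source ∧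
    ∀ x ∈ φ.source, 0 < c x ∧ ∀ v w : TangentSpace (𝓡 n) x,
      minkowskiForm (mfderiv (𝓡 n) (𝓡 n) φ x v) (mfderiv (𝓡 n) (𝓡 n) φ x w) = c x * g.val x v w

/-! Simple connectedness removes monodromy: local data that are unique up to a locally constant
element of a group can be made to agree globally (`exists_primitive_of_germRel`), because a bundle
with discrete fibre is a covering and has a section. What is glued depends on the dimension.

For n = 2, a conformal map between domains of the Minkowski plane preserves or exchanges the two
null directions, so after gluing `M` carries two transverse oriented foliations by null curves
(`nonempty_bifoliation`). A compact simply connected surface has no such pair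
(`Bifoliation.false_of_simplyConnected`), by an argument in the manner of Poincaré and Bendixson. A
non-empty closed set that is invariant forward along the leaves contains a compact leaf
(`exists_leaf`). A compact leaf separates `M`, and the leaves of the other foliation, suitably
oriented, enter a given side without leaving it; so that side contains a compact leaf of the other
foliation, which bounds a strictly smaller region (`Side.exists_smaller`). This contradicts the
existence of a minimal region, given by Zorn's lemma.

For n ≥ 3, a conformal chart φ with factor c lifts to the map c^(-1/2) (1, φ, ⟨φ,φ⟩/2) into the null
cone of a form of signature (2, n), and this lift is isometric. By Liouville's theorem two lifts
differ locally by a linear isometry (`exists_isometry_of_conformal`), so they glue to a map D from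
`M` to the null cone minus the origin. The projection of D to a negative definite plane never
vanishes, and its argument has a continuous real determination, which attains a maximum by
compactness. There some vector w with ⟨w,w⟩ = -1 has ⟨w,D⟩ = 0 as a local minimum. Then w is
orthogonal to D and to its derivatives, hence is a multiple of the null vector D, which is absurd.
-/

section LorentzConformal

open Topology Filter Set

/-! ### Gluing over a simply connected space -/

/-- On a simply connected space every locally constant cocycle of an open cover is a coboundary. -/
theorem exists_primitive_of_locallyConstant_cocycle {M : Type*} [TopologicalSpace M]
    [SimplyConnectedSpace M] [LocallyPathConnectedSpace M] {G : Type*} [Group G]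
    (U : M → Set M) (hU : ∀ i, IsOpen (U i)) (hmem : ∀ i, i ∈ U i) (g : M → M → M → G)
    (hg : ∀ i j, ∀ y ∈ U i ∩ U j, ∀ᶠ w in 𝓝 y, g i j w = g i j y)
    (hc : ∀ i j k y, y ∈ U i → y ∈ U j → y ∈ U k → g i j y * g j k y = g i k y) :
    ∃ h : M → M → G, (∀ i, ∀ y ∈ U i, ∀ᶠ w in 𝓝 y, h i w = h i y) ∧
      ∀ i j y, y ∈ U i → y ∈ U j → h i y = g i j y * h j y := by
  -- With `G` discrete, the bundle with transition functions `g` is a covering of `M`. The identity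
  -- of `M` lifts to it, and `h i` is the coordinate of this section in the trivialization over `U
  -- i`.
  let _ : TopologicalSpace G := ⊥
  have : DiscreteTopology G := ⟨rfl⟩
  let Z : FiberBundleCore M M G :=
    { baseSet := U
      isOpen_baseSet := hU
      indexAt := id
      mem_baseSet_at := hmem
      coordChange := fun i j x v ↦ g j i x * v
      coordChange_self := fun i x hx v ↦ by
        have := hc i i i x hx hx hx
        rw [mul_eq_left.1 this, one_mul]
      continuousOn_coordChange := fun i j ↦ by
        rintro ⟨x, v⟩ ⟨hx, -⟩
        have h2 : ∀ᶠ p : M × G in 𝓝 (x, v), g j i p.1 * p.2 = g j i x * v := by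
          have h1 : ∀ᶠ p : M × G in 𝓝 (x, v), g j i p.1 = g j i x :=
            continuousAt_fst.eventually (p := fun y ↦ g j i y = g j i x) (hg j i x ⟨hx.2, hx.1⟩)
          have h3 : ∀ᶠ p : M × G in 𝓝 (x, v), p.2 = v :=
            continuousAt_snd.eventually (p := fun y ↦ y = v)
              ((isOpen_discrete {v}).mem_nhds (mem_singleton v))
          filter_upwards [h1, h3] with p hp hp'
          rw [hp, hp']
        exact (continuousAt_const.congr (h2.mono fun _ h ↦ h.symm)).continuousWithinAt
      coordChange_comp := fun i j k x hx v ↦ by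
        rw [← mul_assoc, hc k j i x hx.2 hx.1.2 hx.1.1] }
  have hcov : IsCoveringMap (Bundle.TotalSpace.proj : Bundle.TotalSpace G Z.Fiber → M) :=
    FiberBundle.isCoveringMap
  obtain ⟨x₀⟩ : Nonempty M := inferInstance
  obtain ⟨s, ⟨-, hs⟩, -⟩ := hcov.existsUnique_continuousMap_lifts (ContinuousMap.id M) x₀
    (⟨x₀, (1 : G)⟩ : Bundle.TotalSpace G Z.Fiber) rfl
  have hs' : ∀ y, (s y).1 = y := fun y ↦ congrFun hs y
  refine ⟨fun i y ↦ (Z.localTriv i (s y)).2, fun i y hy ↦ ?_, fun i j y hi hj ↦ ?_⟩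
  · have hcont : ContinuousAt (fun w ↦ (Z.localTriv i (s w)).2) y := by
      refine continuousAt_snd.comp (ContinuousAt.comp ?_ s.continuous.continuousAt)
      refine (Z.localTriv i).continuousAt ?_
      rw [(Z.localTriv i).mem_source]
      change (s y).1 ∈ U i
      rwa [hs']
    exact hcont.eventually ((isOpen_discrete {_}).mem_nhds (mem_singleton _))
  · have key : ∀ (x : M) (v : G), x = y →
        g i x x * v = g i j y * (g j x x * v) := by
      rintro x v rfl
      rw [← mul_assoc, hc i j _ _ hi hj (hmem _)]
    exact (key _ (s y).2 (hs' y))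

/-- On a simply connected space, local data that are unique up to a locally constant element of a
group can be corrected so as to agree globally. -/
theorem exists_primitive_of_germRel {M : Type*} [TopologicalSpace M]
    [SimplyConnectedSpace M] [LocallyPathConnectedSpace M] {G : Type*} [Group G]
    (U : M → Set M) (hU : ∀ i, IsOpen (U i)) (hmem : ∀ i, i ∈ U i) (R : M → M → M → G → Prop)
    (hopen : ∀ i j y g, R i j y g → ∀ᶠ w in 𝓝 y, R i j w g)
    (hcomp : ∀ i j k y g g', R i j y g → R j k y g' → R i k y (g * g'))
    (huniq : ∀ i j y g g', y ∈ U i → y ∈ U j → R i j y g → R i j y g' → g = g')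
    (hex : ∀ i j y, y ∈ U i → y ∈ U j → ∃ g, R i j y g) :
    ∃ h : M → M → G, (∀ i, ∀ y ∈ U i, ∀ᶠ w in 𝓝 y, h i w = h i y) ∧
      ∀ i j y, y ∈ U i → y ∈ U j → R i j y (h i y * (h j y)⁻¹) := by
  classical
  have hex' : ∀ i j y, ∃ g, y ∈ U i → y ∈ U j → R i j y g := fun i j y ↦ by
    by_cases h : y ∈ U i ∧ y ∈ U j
    · obtain ⟨g, hg⟩ := hex i j y h.1 h.2
      exact ⟨g, fun _ _ ↦ hg⟩
    · exact ⟨1, fun h1 h2 ↦ (h ⟨h1, h2⟩).elim⟩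
  choose g hg using hex'
  obtain ⟨h, h1, h2⟩ := exists_primitive_of_locallyConstant_cocycle U hU hmem g
    (fun i j y hy ↦ by
      filter_upwards [hopen i j y _ (hg i j y hy.1 hy.2), (hU i).mem_nhds hy.1,
        (hU j).mem_nhds hy.2] with w hw hi hj
      exact huniq i j w _ _ hi hj (hg i j w hi hj) hw)
    (fun i j k y hi hj hk ↦ huniq i k y _ _ hi hk
      (hcomp i j k y _ _ (hg i j y hi hj) (hg j k y hj hk)) (hg i k y hi hk))
  refine ⟨h, h1, fun i j y hi hj ↦ ?_⟩
  rw [h2 i j y hi hj, mul_inv_cancel_right]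
  exact hg i j y hi hj

/-- On a simply connected space, local integer functions whose differences are locally constant
come from a global function. -/
theorem exists_int_function_of_germs {M : Type*} [TopologicalSpace M]
    [SimplyConnectedSpace M] [LocallyPathConnectedSpace M] (f : M → M → ℤ)
    (hf : ∀ z, ∀ᶠ y in 𝓝 z, ∃ n : ℤ, ∀ᶠ w in 𝓝 y, f z w = n + f y w) :
    ∃ F : M → ℤ, ∀ z, ∃ n : ℤ, ∀ᶠ w in 𝓝 z, F w = f z w + n := by
  have hU : ∀ z, ∃ U : Set M, IsOpen U ∧ z ∈ U ∧ ∀ y ∈ U, ∃ n : ℤ, ∀ᶠ w in 𝓝 y, f z w = n + f y w :=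
    fun z ↦ by
      obtain ⟨U, h1, h2, h3⟩ := eventually_nhds_iff.1 (hf z)
      exact ⟨U, h2, h3, h1⟩
  choose U hUo hUm hU using hU
  obtain ⟨h, h1, h2⟩ := exists_primitive_of_germRel U hUo hUm
    (fun i j y (n : Multiplicative ℤ) ↦ ∀ᶠ w in 𝓝 y, f i w = n.toAdd + f j w)
    (fun i j y g hg ↦ hg.eventually_nhds)
    (fun i j k y g g' h h' ↦ by
      filter_upwards [h, h'] with w hw hw'
      rw [hw, hw', toAdd_mul, add_assoc])
    (fun i j y g g' _ _ h h' ↦ by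
      have := h.self_of_nhds.symm.trans h'.self_of_nhds
      exact Multiplicative.toAdd.injective (add_right_cancel this))
    (fun i j y hi hj ↦ by
      obtain ⟨n, hn⟩ := hU i y hi
      obtain ⟨m, hm⟩ := hU j y hj
      refine ⟨Multiplicative.ofAdd (n - m), ?_⟩
      filter_upwards [hn, hm] with w h h'
      rw [h, h', toAdd_ofAdd]
      ring)
  -- On overlaps `f i - f j = h i - h j`, so `f i - h i` does not depend on `i`.
  refine ⟨fun w ↦ f w w - (h w w).toAdd, fun z ↦ ⟨-(h z z).toAdd, ?_⟩⟩
  filter_upwards [h1 z z (hUm z), (hUo z).mem_nhds (hUm z)] with w hw hwU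
  have := (h2 z w w hwU (hUm w)).self_of_nhds
  rw [toAdd_mul, toAdd_inv, hw] at this
  rw [this]
  ring

/-! ### Bifoliations, boxes and forward paths along leaves -/

/-- A pair of transverse oriented one-dimensional topological foliations of a surface: around each
point `x` the functions `u x` and `v x` are the coordinates of a chart, and near each point the
coordinates of different charts are ordered in the same way. -/
structure Bifoliation (M : Type*) [TopologicalSpace M] where
  u : M → M → ℝ
  v : M → M → ℝ
  exists_chart : ∀ x, ∃ e : OpenPartialHomeomorph M (ℝ × ℝ), x ∈ e.source ∧
    ∀ y ∈ e.source, e y = (u x y, v x y)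
  compat : ∀ x, ∀ᶠ y in 𝓝 x, ∀ᶠ w in 𝓝 y,
    ((u x y < u x w ↔ u y y < u y w) ∧ (u x w < u x y ↔ u y w < u y y)) ∧
    ((v x y < v x w ↔ v y y < v y w) ∧ (v x w < v x y ↔ v y w < v y y))

namespace Bifoliation

variable {M : Type*} [TopologicalSpace M] (B : Bifoliation M)

/-- Exchange the two foliations. -/
def swap : Bifoliation M where
  u := B.v
  v := B.u
  exists_chart x := by
    obtain ⟨e, hx, he⟩ := B.exists_chart x
    refine ⟨e.trans (Homeomorph.prodComm ℝ ℝ).toOpenPartialHomeomorph, by simpa using hx, ?_⟩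
    intro y hy
    have hy' : y ∈ e.source := by simpa using hy
    simp [he y hy']
  compat x := (B.compat x).mono fun y hy ↦ hy.mono fun w hw ↦ ⟨hw.2, hw.1⟩

/-- Reverse the orientation of the second foliation. -/
def flip : Bifoliation M where
  u := B.u
  v x y := -B.v x y
  exists_chart x := by
    obtain ⟨e, hx, he⟩ := B.exists_chart x
    refine ⟨e.trans ((Homeomorph.refl ℝ).prodCongr (Homeomorph.neg ℝ)).toOpenPartialHomeomorph,
      by simpa using hx, ?_⟩
    intro y hy
    have hy' : y ∈ e.source := by simpa using hy
    simp [he y hy']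
  compat x := (B.compat x).mono fun y hy ↦ hy.mono fun w hw ↦ by
    simpa only [neg_lt_neg_iff] using ⟨hw.1, hw.2.2, hw.2.1⟩

/-- The open square of radius `r` around the point with coordinates `(a, b)`. -/
def square (a b r : ℝ) : Set (ℝ × ℝ) := Ioo (a - r) (a + r) ×ˢ Ioo (b - r) (b + r)

/-- A square coordinate neighbourhood of `x`, parametrized by `σ`, on which `P` holds. -/
structure Box (x : M) (P : M → Prop) where
  r : ℝ
  σ : ℝ × ℝ → M
  r_pos : 0 < r
  cont : ContinuousOn σ (square (B.u x x) (B.v x x) r)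
  u_σ : ∀ q ∈ square (B.u x x) (B.v x x) r, B.u x (σ q) = q.1
  v_σ : ∀ q ∈ square (B.u x x) (B.v x x) r, B.v x (σ q) = q.2
  base : σ (B.u x x, B.v x x) = x
  mem_nhds : ∀ q ∈ square (B.u x x) (B.v x x) r, σ '' square (B.u x x) (B.v x x) r ∈ 𝓝 (σ q)
  cont_u : ∀ q ∈ square (B.u x x) (B.v x x) r, ContinuousAt (B.u x) (σ q)
  cont_v : ∀ q ∈ square (B.u x x) (B.v x x) r, ContinuousAt (B.v x) (σ q)
  prop : ∀ q ∈ square (B.u x x) (B.v x x) r, P (σ q)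

theorem isOpen_square (a b r : ℝ) : IsOpen (square a b r) := isOpen_Ioo.prod isOpen_Ioo

theorem mem_square_self {a b r : ℝ} (hr : 0 < r) : (a, b) ∈ square a b r := by
  simp [square, hr]

theorem square_mem_nhds {a b r : ℝ} {q : ℝ × ℝ} (hq : q ∈ square a b r) : square a b r ∈ 𝓝 q :=
  (isOpen_square a b r).mem_nhds hq

theorem exists_square_subset {a b : ℝ} {s : Set (ℝ × ℝ)} (hs : s ∈ 𝓝 (a, b)) :
    ∃ r > 0, square a b r ⊆ s := by
  obtain ⟨r, hr, h⟩ := Metric.mem_nhds_iff.1 hs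
  refine ⟨r, hr, fun q hq ↦ h ?_⟩
  rw [← ball_prod_same, Real.ball_eq_Ioo, Real.ball_eq_Ioo]
  exact hq

theorem exists_box (x : M) {P : M → Prop} (hP : ∀ᶠ y in 𝓝 x, P y) : Nonempty (B.Box x P) := by
  obtain ⟨e, hx, he⟩ := B.exists_chart x
  have hex : e x = (B.u x x, B.v x x) := he x hx
  have htar : (B.u x x, B.v x x) ∈ e.target := hex ▸ e.map_source hx
  have h1 : ∀ᶠ q in 𝓝 (B.u x x, B.v x x), q ∈ e.target ∧ P (e.symm q) := by
    refine Filter.Eventually.and (e.open_target.mem_nhds htar) ?_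
    have hc : ContinuousAt e.symm (B.u x x, B.v x x) := e.continuousAt_symm htar
    refine hc.eventually ?_
    rwa [← hex, e.left_inv hx]
  obtain ⟨r, hr, hsq⟩ := exists_square_subset h1
  have key : ∀ q ∈ square (B.u x x) (B.v x x) r, q = (B.u x (e.symm q), B.v x (e.symm q)) :=
    fun q hq ↦ by rw [← he _ (e.map_target (hsq hq).1), e.right_inv (hsq hq).1]
  have hcont : ∀ q ∈ square (B.u x x) (B.v x x) r,
      ContinuousAt (fun y ↦ (B.u x y, B.v x y)) (e.symm q) := fun q hq ↦ by
    have hs := e.map_target (hsq hq).1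
    refine (e.continuousAt hs).congr ?_
    filter_upwards [e.open_source.mem_nhds hs] with y hy
    exact he y hy
  exact ⟨{ r := r, σ := e.symm, r_pos := hr
           cont := e.continuousOn_symm.mono fun q hq ↦ (hsq hq).1
           u_σ := fun q hq ↦ (congrArg Prod.fst (key q hq)).symm
           v_σ := fun q hq ↦ (congrArg Prod.snd (key q hq)).symm
           base := by rw [← hex, e.left_inv hx]
           mem_nhds := fun q hq ↦ (e.symm.isOpen_image_of_subset_source (isOpen_square _ _ _)
              fun q hq ↦ (hsq hq).1).mem_nhds (mem_image_of_mem _ hq)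
           cont_u := fun q hq ↦ (hcont q hq).fst
           cont_v := fun q hq ↦ (hcont q hq).snd
           prop := fun q hq ↦ (hsq hq).2 }⟩

variable {B}

namespace Box

variable {x : M} {P : M → Prop} (b : B.Box x P)

/-- The square over which a box is parametrized. -/
def sq : Set (ℝ × ℝ) := square (B.u x x) (B.v x x) b.r

theorem mem_sq_iff {q : ℝ × ℝ} : q ∈ b.sq ↔ (B.u x x - b.r < q.1 ∧ q.1 < B.u x x + b.r) ∧
    (B.v x x - b.r < q.2 ∧ q.2 < B.v x x + b.r) := Iff.rfl

theorem base_mem : (B.u x x, B.v x x) ∈ b.sq := mem_square_self b.r_pos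

theorem eventually_mem {q : ℝ × ℝ} (hq : q ∈ b.sq) :
    ∀ᶠ y in 𝓝 (b.σ q), (B.u x y, B.v x y) ∈ b.sq ∧ b.σ (B.u x y, B.v x y) = y := by
  filter_upwards [b.mem_nhds q hq]
  rintro _ ⟨p, hp, rfl⟩
  rw [b.u_σ p hp, b.v_σ p hp]
  exact ⟨hp, rfl⟩

theorem eventually_mem_base :
    ∀ᶠ y in 𝓝 x, (B.u x y, B.v x y) ∈ b.sq ∧ b.σ (B.u x y, B.v x y) = y := by
  have := b.eventually_mem b.base_mem
  rwa [b.base] at this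

theorem continuousAt {q : ℝ × ℝ} (hq : q ∈ b.sq) : ContinuousAt b.σ q :=
  b.cont.continuousAt (square_mem_nhds hq)

end Box

theorem continuousAt_u (x : M) : ContinuousAt (B.u x) x := by
  obtain ⟨b⟩ := B.exists_box x (P := fun _ ↦ True) (by simp)
  have := b.cont_u _ b.base_mem
  rwa [b.base] at this

theorem continuousAt_v (x : M) : ContinuousAt (B.v x) x := B.swap.continuousAt_u x

/-- The comparison of the chart at `x` with the chart at `y`, near `y`. -/
def Compat (B : Bifoliation M) (x y : M) : Prop := ∀ᶠ w in 𝓝 y,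
    ((B.u x y < B.u x w ↔ B.u y y < B.u y w) ∧ (B.u x w < B.u x y ↔ B.u y w < B.u y y)) ∧
    ((B.v x y < B.v x w ↔ B.v y y < B.v y w) ∧ (B.v x w < B.v x y ↔ B.v y w < B.v y y))

/-- A path that runs along the leaves of the first foliation in the positive direction. -/
def HPath (B : Bifoliation M) (α : ℝ → M) (a b : ℝ) : Prop :=
  ContinuousOn α (Icc a b) ∧ ∀ t ∈ Icc a b, ∀ᶠ s in 𝓝[Icc a b] t,
    B.v (α t) (α s) = B.v (α t) (α t) ∧ (s < t → B.u (α t) (α s) < B.u (α t) (α t)) ∧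
      (t < s → B.u (α t) (α t) < B.u (α t) (α s))

theorem HPath.mono {α : ℝ → M} {a b a' b' : ℝ} (h : B.HPath α a b) (ha : a ≤ a') (hb : b' ≤ b) :
    B.HPath α a' b' :=
  ⟨h.1.mono (Icc_subset_Icc ha hb), fun t ht ↦
    (h.2 t (Icc_subset_Icc ha hb ht)).filter_mono (nhdsWithin_mono _ (Icc_subset_Icc ha hb))⟩

theorem HPath.shift {α : ℝ → M} {a b : ℝ} (h : B.HPath α a b) (c : ℝ) :
    B.HPath (fun t ↦ α (t - c)) (a + c) (b + c) := by
  have hm : MapsTo (fun t ↦ t - c) (Icc (a + c) (b + c)) (Icc a b) := fun t ht ↦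
    ⟨by linarith [ht.1], by linarith [ht.2]⟩
  refine ⟨h.1.comp (by fun_prop) hm, fun t ht ↦ ?_⟩
  have hc : Tendsto (fun s ↦ s - c) (𝓝[Icc (a + c) (b + c)] t) (𝓝[Icc a b] (t - c)) :=
    (Continuous.continuousWithinAt (by fun_prop)).tendsto_nhdsWithin hm
  filter_upwards [hc.eventually (h.2 (t - c) (hm ht))] with s hs
  exact ⟨hs.1, fun hst ↦ hs.2.1 (by linarith), fun hst ↦ hs.2.2 (by linarith)⟩

theorem HPath.congr {α β : ℝ → M} {a b : ℝ} (h : B.HPath α a b) (he : EqOn β α (Icc a b)) :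
    B.HPath β a b := by
  refine ⟨h.1.congr he, fun t ht ↦ ?_⟩
  filter_upwards [h.2 t ht, self_mem_nhdsWithin] with s hs hsm
  rwa [he ht, he hsm]

theorem HPath.append {α : ℝ → M} {a b c : ℝ} (h1 : B.HPath α a b) (h2 : B.HPath α b c)
    (hab : a ≤ b) (hbc : b ≤ c) : B.HPath α a c := by
  rw [HPath, ← Icc_union_Icc_eq_Icc hab hbc]
  refine ⟨h1.1.union_of_isClosed h2.1 isClosed_Icc isClosed_Icc, fun t ht ↦ ?_⟩
  rw [nhdsWithin_union, eventually_sup]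
  have key : ∀ {p q : ℝ}, B.HPath α p q → ∀ᶠ s in 𝓝[Icc p q] t,
      B.v (α t) (α s) = B.v (α t) (α t) ∧ (s < t → B.u (α t) (α s) < B.u (α t) (α t)) ∧
      (t < s → B.u (α t) (α t) < B.u (α t) (α s)) := by
    intro p q h
    by_cases htm : t ∈ Icc p q
    · exact h.2 t htm
    · have : 𝓝[Icc p q] t = ⊥ := by
        rw [← notMem_closure_iff_nhdsWithin_eq_bot, isClosed_Icc.closure_eq]
        exact htm
      rw [this]
      exact eventually_bot
  exact ⟨key h1, key h2⟩

/-- `y` lies on the leaf of `x`, at `x` or after it. -/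
def Reach (B : Bifoliation M) (x y : M) : Prop :=
  ∃ (α : ℝ → M) (a b : ℝ), a ≤ b ∧ B.HPath α a b ∧ α a = x ∧ α b = y

/-- The passage through the middle point is recorded because it shows that a path which comes back
to its start is not constant. -/
theorem Reach.exists_path {x y z : M} (h1 : B.Reach x y) (h2 : B.Reach y z) :
    ∃ (α : ℝ → M) (a b c : ℝ), a ≤ b ∧ b ≤ c ∧ B.HPath α a c ∧ α a = x ∧ α b = y ∧ α c = z := by
  obtain ⟨α, a, b, hab, hα, rfl, rfl⟩ := h1
  obtain ⟨β, c, d, hcd, hβ, h, rfl⟩ := h2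
  have hβ' := hβ.shift (b - c)
  set γ : ℝ → M := fun t ↦ if t ≤ b then α t else β (t - (b - c)) with hγ
  have e1 : EqOn γ α (Icc a b) := fun t ht ↦ if_pos ht.2
  have e2 : EqOn γ (fun t ↦ β (t - (b - c))) (Icc (c + (b - c)) (d + (b - c))) := by
    intro t ht
    by_cases htb : t ≤ b
    · have : t = b := le_antisymm htb (by linarith [ht.1])
      subst this
      simp [hγ, h]
    · exact if_neg htb
  have h3 : B.HPath γ b (d + (b - c)) := by
    simpa using hβ'.congr e2
  refine ⟨γ, a, b, d + (b - c), hab, by linarith, (hα.congr e1).append h3 hab (by linarith),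
    e1 ⟨le_rfl, hab⟩, e1 ⟨hab, le_rfl⟩, ?_⟩
  have := e2 (x := d + (b - c)) ⟨by linarith, le_rfl⟩
  simpa using this

theorem Reach.trans {x y z : M} (h1 : B.Reach x y) (h2 : B.Reach y z) : B.Reach x z := by
  obtain ⟨α, a, b, c, hab, hbc, hα, ha, -, hc⟩ := h1.exists_path h2
  exact ⟨α, a, c, hab.trans hbc, hα, ha, hc⟩

theorem Reach.refl (x : M) : B.Reach x x := by
  refine ⟨fun _ ↦ x, 0, 0, le_rfl, ⟨continuousOn_const, fun t ht ↦ ?_⟩, rfl, rfl⟩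
  filter_upwards [self_mem_nhdsWithin] with s hs
  have h1 : t = 0 := by simpa using ht
  have h2 : s = 0 := by simpa using hs
  simp [h1, h2]

theorem Box.hPath {x : M} {P : M → Prop} (b : B.Box x P) (hP : ∀ y, P y → B.Compat x y)
    {p q w : ℝ} (hp : (p, w) ∈ b.sq) (hq : (q, w) ∈ b.sq) :
    B.HPath (fun t ↦ b.σ (t, w)) p q := by
  have hm : ∀ t ∈ Icc p q, (t, w) ∈ b.sq := fun t ht ↦ by
    rw [Box.mem_sq_iff] at *
    exact ⟨⟨hp.1.1.trans_le ht.1, ht.2.trans_lt hq.1.2⟩, hp.2⟩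
  have hc : ContinuousOn (fun t ↦ b.σ (t, w)) (Icc p q) := fun t ht ↦
    (ContinuousAt.comp (f := fun t ↦ (t, w)) (b.continuousAt (hm t ht))
      (by fun_prop)).continuousWithinAt
  refine ⟨hc, fun t ht ↦ ?_⟩
  filter_upwards [(hc t ht).eventually (hP _ (b.prop _ (hm t ht))), self_mem_nhdsWithin]
    with s hs hsm
  rw [b.u_σ _ (hm t ht), b.v_σ _ (hm t ht), b.u_σ _ (hm s hsm), b.v_σ _ (hm s hsm)] at hs
  simp only [lt_self_iff_false, false_iff, not_lt] at hs
  exact ⟨le_antisymm hs.2.1 hs.2.2, fun h ↦ hs.1.2.1 h, fun h ↦ hs.1.1.1 h⟩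

theorem Box.reach {x : M} {P : M → Prop} (b : B.Box x P) (hP : ∀ y, P y → B.Compat x y)
    {p q w : ℝ} (hp : (p, w) ∈ b.sq) (hq : (q, w) ∈ b.sq) (hpq : p ≤ q) :
    B.Reach (b.σ (p, w)) (b.σ (q, w)) :=
  ⟨_, p, q, hpq, b.hPath hP hp hq, rfl, rfl⟩

/-- A set that contains with each point the positive half of its leaf. -/
def RightInv (B : Bifoliation M) (K : Set M) : Prop := ∀ x ∈ K, ∀ y, B.Reach x y → y ∈ K

theorem HPath.forall_mem {α : ℝ → M} {a b : ℝ} (h : B.HPath α a b) {K : Set M} (hK : IsClosed K)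
    (hr : ∀ x ∈ K, ∀ᶠ y in 𝓝 x, B.v x y = B.v x x → B.u x x ≤ B.u x y → y ∈ K) (ha : α a ∈ K) :
    ∀ t ∈ Icc a b, α t ∈ K := by
  refine IsClosed.Icc_subset_of_forall_exists_gt (s := α ⁻¹' K) ?_ ha fun t ht y hy ↦ ?_
  · rw [inter_comm]
    exact h.1.preimage_isClosed_of_isClosed isClosed_Icc hK
  · have htm : t ∈ Icc a b := ⟨ht.2.1, ht.2.2.le⟩
    have h1 : ∀ᶠ s in 𝓝[Icc a b] t, t < s → α s ∈ K := by
      filter_upwards [h.2 t htm, (h.1 t htm).eventually (hr _ ht.1)] with s hs1 hs2 hts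
      exact hs2 hs1.1 (hs1.2.2 hts).le
    have h2 : ∀ᶠ s in 𝓝[>] t, s ∈ Ioc t y ∧ s ∈ Icc a b := by
      filter_upwards [Ioc_mem_nhdsGT hy, Ioc_mem_nhdsGT ht.2.2] with s hs hs'
      exact ⟨hs, ht.2.1.trans hs'.1.le, hs'.2⟩
    have h3 : ∀ᶠ s in 𝓝[>] t, s ∈ Icc a b → t < s → α s ∈ K := by
      rw [eventually_nhdsWithin_iff] at h1
      exact (h1.filter_mono nhdsWithin_le_nhds)
    obtain ⟨s, hs, hs'⟩ := (h2.and h3).exists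
    exact ⟨s, hs' hs.2 hs.1.1, hs.1⟩

theorem rightInv_of_isClosed {K : Set M} (hK : IsClosed K)
    (hr : ∀ x ∈ K, ∀ᶠ y in 𝓝 x, B.v x y = B.v x x → B.u x x ≤ B.u x y → y ∈ K) :
    B.RightInv K := by
  rintro x hx y ⟨α, a, b, hab, hα, rfl, rfl⟩
  exact hα.forall_mem hK hr hx b ⟨hab, le_rfl⟩

/-- If `y` follows a limit point `z` in its plaque, the map `φ` below moves every `w` near `z`
forward along its own leaf and sends `z` to `y`. By continuity, reachable points close to `z` go to
reachable points close to `y`. -/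
theorem rightInv_closure_reach (x : M) : B.RightInv (closure {y | B.Reach x y}) := by
  refine rightInv_of_isClosed isClosed_closure fun z hz ↦ ?_
  obtain ⟨b⟩ := B.exists_box z (B.compat z)
  filter_upwards [b.eventually_mem_base] with y hy hv hu
  set φ : M → M := fun w ↦ b.σ (max (B.u z w) (B.u z y), B.v z w) with hφ
  have hφz : φ z = y := by
    rw [hφ]
    simp only [max_eq_right hu]
    rw [← hv, hy.2]
  have hsq : (max (B.u z z) (B.u z y), B.v z z) ∈ b.sq := by
    rw [max_eq_right hu, ← hv]
    exact hy.1
  have hc : ContinuousAt (fun w ↦ (max (B.u z w) (B.u z y), B.v z w)) z :=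
    ContinuousAt.prodMk ((continuousAt_u z).sup continuousAt_const) (continuousAt_v z)
  have hφc : ContinuousAt φ z :=
    ContinuousAt.comp (f := fun w ↦ (max (B.u z w) (B.u z y), B.v z w)) (b.continuousAt hsq) hc
  have hcs : ∀ᶠ w in 𝓝 z, (max (B.u z w) (B.u z y), B.v z w) ∈ b.sq :=
    hc.eventually (square_mem_nhds hsq)
  rw [mem_closure_iff_frequently] at hz ⊢
  have h1 : ∃ᶠ w in 𝓝 z, φ w ∈ {y | B.Reach x y} := by
    refine (hz.and_eventually (hcs.and b.eventually_mem_base)).mono ?_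
    rintro w ⟨hw, hw1, hw2⟩
    have h3 := b.reach (fun _ h ↦ h) hw2.1 hw1 (le_max_left _ _)
    rw [hw2.2] at h3
    exact Reach.trans hw h3
  rw [← hφz]
  exact hφc.frequently h1

/-- Every non-empty closed right-invariant set contains a minimal one. -/
theorem exists_minimal [CompactSpace M] {K : Set M} (hK : IsClosed K) (hne : K.Nonempty)
    (hr : B.RightInv K) : ∃ K₀ ⊆ K, IsClosed K₀ ∧ K₀.Nonempty ∧ B.RightInv K₀ ∧
      ∀ x ∈ K₀, closure {y | B.Reach x y} = K₀ := by
  obtain ⟨m, hmK, hm⟩ := zorn_superset_nonempty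
    {K : Set M | IsClosed K ∧ K.Nonempty ∧ B.RightInv K} (fun c hc hch hcne ↦ by
      refine ⟨⋂₀ c, ⟨isClosed_sInter fun s hs ↦ (hc hs).1, ?_, ?_⟩, fun s hs ↦ sInter_subset_of_mem hs⟩
      · have : Nonempty c := hcne.to_subtype
        exact IsCompact.nonempty_sInter_of_directed_nonempty_isCompact_isClosed
          (fun s hs t ht ↦ by
            rcases hch.total hs ht with h | h
            exacts [⟨s, hs, subset_rfl, h⟩, ⟨t, ht, h, subset_rfl⟩]) (fun s hs ↦ (hc hs).2.1)
          (fun s hs ↦ (hc hs).1.isCompact) (fun s hs ↦ (hc hs).1)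
      · exact fun x hx y hxy s hs ↦ (hc hs).2.2 x (hx s hs) y hxy) K ⟨hK, hne, hr⟩
  refine ⟨m, hmK, hm.prop.1, hm.prop.2.1, hm.prop.2.2, fun x hx ↦ ?_⟩
  have hsub : closure {y | B.Reach x y} ⊆ m :=
    closure_minimal (fun y hy ↦ hm.prop.2.2 x hx y hy) hm.prop.1
  exact hsub.antisymm (hm.le_of_le ⟨isClosed_closure, ⟨x, subset_closure (Reach.refl x)⟩,
    rightInv_closure_reach x⟩ hsub)

end Bifoliation

/-! ### Integer functions that jump across a closed set -/

/-- Local sides `S z` of a closed set `C`, compatible with each other, define an integer function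
on a simply connected space that jumps by one across `C`. -/
theorem exists_int_function_of_sides {M : Type*} [TopologicalSpace M]
    [SimplyConnectedSpace M] [LocallyPathConnectedSpace M] {C : Set M} (hC : IsClosed C)
    (S : M → Set M)
    (h1 : ∀ z ∈ C, ∀ᶠ y in 𝓝 z, y ∈ C → ∀ᶠ w in 𝓝 y, (w ∈ S z ↔ w ∈ S y))
    (h2 : ∀ z ∈ C, ∀ᶠ y in 𝓝 z, y ∉ C → (∀ᶠ w in 𝓝 y, w ∈ S z) ∨ (∀ᶠ w in 𝓝 y, w ∉ S z)) :
    ∃ F : M → ℤ, (∀ z ∉ C, ∀ᶠ w in 𝓝 z, F w = F z) ∧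
      ∀ z ∈ C, ∃ n : ℤ, ∀ᶠ w in 𝓝 z, (w ∈ S z → F w = n + 1) ∧ (w ∉ S z → F w = n) := by
  classical
  -- The local function is the indicator of `S z` for `z` on `C`, and zero for `z` off `C`. At
  -- nearby points the germs differ by the constant 0 or 1.
  obtain ⟨F, hF⟩ := exists_int_function_of_germs
    (fun z w ↦ if z ∈ C ∧ w ∈ S z then 1 else 0) (fun z ↦ by
      by_cases hz : z ∈ C
      · filter_upwards [h1 z hz, h2 z hz] with y hy1 hy2
        by_cases hy : y ∈ C
        · refine ⟨0, ?_⟩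
          filter_upwards [hy1 hy] with w hw
          simp [hz, hy, hw]
        · rcases hy2 hy with h | h
          · refine ⟨1, ?_⟩
            filter_upwards [h] with w hw
            simp [hz, hy, hw]
          · refine ⟨0, ?_⟩
            filter_upwards [h] with w hw
            simp [hy, hw]
      · filter_upwards [hC.isOpen_compl.mem_nhds hz] with y hy
        have hy' : y ∉ C := hy
        exact ⟨0, Eventually.of_forall fun w ↦ by simp [hz, hy']⟩)
  refine ⟨F, fun z hz ↦ ?_, fun z hz ↦ ?_⟩
  · obtain ⟨n, hn⟩ := hF z
    have := hn.self_of_nhds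
    filter_upwards [hn] with w hw
    rw [hw, this]
    simp [hz]
  · obtain ⟨n, hn⟩ := hF z
    refine ⟨n, hn.mono fun w hw ↦ ⟨fun h ↦ ?_, fun h ↦ ?_⟩⟩
    · rw [hw, if_pos ⟨hz, h⟩, add_comm]
    · rw [hw, if_neg (fun h' ↦ h h'.2), zero_add]

/-- A function on an interval that is monotone at each point is monotone. -/
theorem le_of_locally_le {f : ℝ → ℤ} {a b : ℝ} (hab : a ≤ b)
    (h : ∀ t ∈ Icc a b, ∀ᶠ s in 𝓝[Icc a b] t, (s < t → f s ≤ f t) ∧ (t < s → f t ≤ f s)) :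
    f a ≤ f b := by
  -- The inequality is asked on all of `[a, t]`: a limit of such `t` from the right is then
  -- immediate, and only a limit from the left uses the local hypothesis.
  have key : Icc a b ⊆ {t | ∀ s ∈ Icc a t, f a ≤ f s} := by
    refine IsClosed.Icc_subset_of_forall_exists_gt ?_ ?_ ?_
    · rw [← isSeqClosed_iff_isClosed]
      intro x t hx hxt
      have htm : t ∈ Icc a b := isClosed_Icc.isSeqClosed (fun n ↦ (hx n).2) hxt
      refine ⟨fun s hs ↦ ?_, htm⟩
      rcases hs.2.lt_or_eq with hst | rfl
      · obtain ⟨n, hn⟩ := (hxt.eventually (lt_mem_nhds hst)).exists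
        exact (hx n).1 s ⟨hs.1, hn.le⟩
      · have hx' : Tendsto x atTop (𝓝[Icc a b] s) :=
          tendsto_nhdsWithin_iff.2 ⟨hxt, Eventually.of_forall fun n ↦ (hx n).2⟩
        obtain ⟨n, hn⟩ := (hx'.eventually (h s htm)).exists
        have hxn := (hx n).1 (x n) ⟨(hx n).2.1, le_rfl⟩
        rcases lt_trichotomy (x n) s with h' | h' | h'
        · exact hxn.trans (hn.1 h')
        · rwa [h'] at hxn
        · exact (hx n).1 s ⟨hs.1, h'.le⟩
    · intro s hs
      rw [le_antisymm hs.2 hs.1]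
    · rintro t ⟨ht, hta, htb⟩ y hy
      have h1 := h t ⟨hta, htb.le⟩
      rw [eventually_nhdsWithin_iff] at h1
      obtain ⟨c, hc, hc'⟩ := mem_nhdsGT_iff_exists_Ioc_subset.1
        (h1.filter_mono (nhdsWithin_le_nhds (s := Ioi t)))
      have hmin : t < min c (min y b) := lt_min hc (lt_min hy htb)
      refine ⟨min c (min y b), fun s hs ↦ ?_, hmin, (min_le_right _ _).trans (min_le_left _ _)⟩
      rcases le_or_gt s t with hst | hst
      · exact ht s ⟨hs.1, hst⟩
      · have h2 := hc' (⟨hst, hs.2.trans (min_le_left _ _)⟩ : s ∈ Ioc t c)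
          ⟨hs.1, hs.2.trans ((min_le_right _ _).trans (min_le_right _ _))⟩
        exact (ht t ⟨hta, le_rfl⟩).trans (h2.2 hst)
  exact key ⟨hab, le_rfl⟩ b ⟨hab, le_rfl⟩

/-! ### The shape of a leaf arc near a point -/

namespace Bifoliation

variable {M : Type*} [TopologicalSpace M] {B : Bifoliation M}

theorem eventually_chart (B : Bifoliation M) (z : M) : ∀ᶠ y in 𝓝 z,
    ContinuousAt (B.u z) y ∧ ContinuousAt (B.v z) y ∧ B.Compat z y := by
  obtain ⟨b⟩ := B.exists_box z (B.compat z)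
  filter_upwards [b.eventually_mem_base] with y hy
  rw [← hy.2]
  exact ⟨b.cont_u _ hy.1, b.cont_v _ hy.1, b.prop _ hy.1⟩

theorem exists_left {p : M} {P : M → Prop} (hP : ∀ᶠ y in 𝓝 p, P y) :
    ∃ w, P w ∧ B.v p w = B.v p p ∧ B.u p w < B.u p p := by
  obtain ⟨b⟩ := B.exists_box p hP
  have hr := b.r_pos
  have hq : (B.u p p - b.r / 2, B.v p p) ∈ b.sq := by
    rw [Box.mem_sq_iff]; constructor <;> constructor <;> dsimp <;> linarith
  refine ⟨b.σ _, b.prop _ hq, b.v_σ _ hq, ?_⟩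
  rw [b.u_σ _ hq]
  dsimp
  linarith

/-- A function that does not decrease along leaves at each point does not decrease along leaves. -/
theorem Reach.le {F : M → ℤ} {x y : M} (h : B.Reach x y)
    (hF : ∀ z, ∀ᶠ w in 𝓝 z, B.v z w = B.v z z →
      (B.u z w < B.u z z → F w ≤ F z) ∧ (B.u z z < B.u z w → F z ≤ F w)) : F x ≤ F y := by
  obtain ⟨α, a, b, hab, hα, rfl, rfl⟩ := h
  refine le_of_locally_le (f := F ∘ α) hab fun t ht ↦ ?_
  filter_upwards [hα.2 t ht, (hα.1 t ht).eventually (hF (α t))] with s hs hs'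
  exact ⟨fun h ↦ (hs' hs.1).1 (hs.2.1 h), fun h ↦ (hs' hs.1).2 (hs.2.2 h)⟩

/-- By compactness of `[a, b]`, a time at which the path is close to `z` is close to a time `t₀` at
which it is at `z`, and there the definition of `HPath` applies. The image therefore has no branches
near `z` other than those through `z`. -/
theorem HPath.eventually_param [T2Space M] {α : ℝ → M} {a b : ℝ} (h : B.HPath α a b) (z : M) :
    ∀ᶠ y in 𝓝 z, ∀ t ∈ Icc a b, α t = y → ∃ t₀ ∈ Icc a b, α t₀ = z ∧ B.v z y = B.v z z ∧
      (t < t₀ → B.u z y < B.u z z) ∧ (t₀ < t → B.u z z < B.u z y) := by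
  have key : ∀ᶠ y in 𝓝 z, ∀ t ∈ Icc a b, (t ∈ Icc a b → α t = y → ∃ t₀ ∈ Icc a b, α t₀ = z ∧
      B.v z y = B.v z z ∧ (t < t₀ → B.u z y < B.u z z) ∧ (t₀ < t → B.u z z < B.u z y)) := by
    refine isCompact_Icc.eventually_forall_of_forall_eventually fun t₀ ht₀ ↦ ?_
    by_cases hz : α t₀ = z
    · have h1 := h.2 t₀ ht₀
      rw [eventually_nhdsWithin_iff] at h1
      have h2 := (continuousAt_snd (X := M) (Y := ℝ) (p := (z, t₀))).eventually h1
      filter_upwards [h2] with p hp hp2 hpe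
      have := hp hp2
      rw [hz, hpe] at this
      exact ⟨t₀, ht₀, hz, this⟩
    · obtain ⟨U, V, hU, hV, hzU, hzV, hUV⟩ := t2_separation hz
      have h1 := (h.1 t₀ ht₀).eventually (hU.mem_nhds hzU)
      rw [eventually_nhdsWithin_iff] at h1
      have h2 := (continuousAt_snd (X := M) (Y := ℝ) (p := (z, t₀))).eventually h1
      have h3 : ∀ᶠ p : M × ℝ in 𝓝 (z, t₀), p.1 ∈ V :=
        continuousAt_fst.eventually (hV.mem_nhds hzV)
      filter_upwards [h2, h3] with p hp hp' hp2 hpe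
      exact (disjoint_left.1 hUV (hp hp2) (hpe ▸ hp')).elim
  exact key.mono fun y hy t ht ↦ hy t ht ht

/-- By the intermediate value theorem, a path inside a plaque covers the part of the plaque between
its endpoints. -/
theorem Box.mem_image {z : M} {P : M → Prop} (b : B.Box z P) {α : ℝ → M} {p q : ℝ} (hpq : p ≤ q)
    (hα : ContinuousOn α (Icc p q))
    (hb : ∀ t ∈ Icc p q, ((B.u z (α t), B.v z (α t)) ∈ b.sq ∧
      b.σ (B.u z (α t), B.v z (α t)) = α t) ∧ B.v z (α t) = B.v z z)
    {y : M} (hy : b.σ (B.u z y, B.v z y) = y) (hv : B.v z y = B.v z z)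
    (hu : B.u z y ∈ Icc (B.u z (α p)) (B.u z (α q))) : y ∈ α '' Icc p q := by
  have hc : ContinuousOn (fun t ↦ B.u z (α t)) (Icc p q) := fun t ht ↦ by
    have := b.cont_u _ (hb t ht).1.1
    rw [(hb t ht).1.2] at this
    exact this.comp_continuousWithinAt (hα t ht)
  obtain ⟨t, ht, hte⟩ := intermediate_value_Icc hpq hc hu
  refine ⟨t, ht, ?_⟩
  have hte' : B.u z (α t) = B.u z y := hte
  rw [← (hb t ht).1.2, hte', (hb t ht).2, ← hv, hy]

/-- This is the counterpart of `HPath.eventually_param`: together with the version on the left they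
determine the image of the path exactly near each of its points. -/
theorem HPath.eventually_mem_right {α : ℝ → M} {a b t : ℝ} (h : B.HPath α a b) (ht : t ∈ Ico a b) :
    ∀ᶠ y in 𝓝 (α t), B.v (α t) y = B.v (α t) (α t) → B.u (α t) (α t) ≤ B.u (α t) y →
      y ∈ α '' Icc a b := by
  have htm : t ∈ Icc a b := ⟨ht.1, ht.2.le⟩
  obtain ⟨c⟩ := B.exists_box (α t) (P := fun _ ↦ True) (by simp)
  have h1 := (h.2 t htm).and ((h.1 t htm).eventually c.eventually_mem_base)
  rw [eventually_nhdsWithin_iff] at h1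
  obtain ⟨d, hd, hd'⟩ := mem_nhdsGE_iff_exists_Icc_subset.1
    (h1.filter_mono (nhdsWithin_le_nhds (s := Ici t)))
  have htd : t < min d b := lt_min hd ht.2
  have hsub : ∀ s ∈ Icc t (min d b), s ∈ Icc a b := fun s hs ↦
    ⟨ht.1.trans hs.1, hs.2.trans (min_le_right _ _)⟩
  have h2 : ∀ s ∈ Icc t (min d b), _ := fun s hs ↦
    hd' ⟨hs.1, hs.2.trans (min_le_left _ _)⟩ (hsub s hs)
  have hlt := (h2 (min d b) ⟨htd.le, le_rfl⟩).1.2.2 htd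
  filter_upwards [c.eventually_mem_base, (continuousAt_u (α t)).eventually (gt_mem_nhds hlt)]
    with y hy hyu hv hu
  exact image_mono hsub (c.mem_image htd.le (h.1.mono hsub)
    (fun s hs ↦ ⟨(h2 s hs).2, (h2 s hs).1.1⟩) hy.2 hv ⟨hu, hyu.le⟩)

theorem HPath.eventually_mem_left {α : ℝ → M} {a b t : ℝ} (h : B.HPath α a b) (ht : t ∈ Ioc a b) :
    ∀ᶠ y in 𝓝 (α t), B.v (α t) y = B.v (α t) (α t) → B.u (α t) y ≤ B.u (α t) (α t) →
      y ∈ α '' Icc a b := by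
  have htm : t ∈ Icc a b := ⟨ht.1.le, ht.2⟩
  obtain ⟨c⟩ := B.exists_box (α t) (P := fun _ ↦ True) (by simp)
  have h1 := (h.2 t htm).and ((h.1 t htm).eventually c.eventually_mem_base)
  rw [eventually_nhdsWithin_iff] at h1
  obtain ⟨d, hd, hd'⟩ := mem_nhdsLE_iff_exists_Icc_subset.1
    (h1.filter_mono (nhdsWithin_le_nhds (s := Iic t)))
  have htd : max d a < t := max_lt hd ht.1
  have hsub : ∀ s ∈ Icc (max d a) t, s ∈ Icc a b := fun s hs ↦
    ⟨(le_max_right _ _).trans hs.1, hs.2.trans ht.2⟩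
  have h2 : ∀ s ∈ Icc (max d a) t, _ := fun s hs ↦
    hd' ⟨(le_max_left _ _).trans hs.1, hs.2⟩ (hsub s hs)
  have hlt := (h2 (max d a) ⟨le_rfl, htd.le⟩).1.2.1 htd
  filter_upwards [c.eventually_mem_base, (continuousAt_u (α t)).eventually (lt_mem_nhds hlt)]
    with y hy hyu hv hu
  exact image_mono hsub (c.mem_image htd.le (h.1.mono hsub)
    (fun s hs ↦ ⟨(h2 s hs).2, (h2 s hs).1.1⟩) hy.2 hv ⟨hyu.le, hu⟩)

end Bifoliation

/-! ### The closed curve made of a leaf arc and a transversal -/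

namespace Bifoliation

variable {M : Type*} [TopologicalSpace M] {B : Bifoliation M}

/-- On a simply connected surface, a leaf segment that returns to a transversal segment `J` through
its starting point `p` at a different point `q` cannot come back to `p`. -/
theorem false_of_staircase [T2Space M] [SimplyConnectedSpace M] [LocallyPathConnectedSpace M]
    {p q : M} {α : ℝ → M} {a b : ℝ} (hab : a < b) (hα : B.HPath α a b) (ha : α a = p)
    (hb : α b = q) {N : Set M} (hN : IsOpen N) (hpN : p ∈ N) (hqN : q ∈ N)
    (hch : ∀ y ∈ N, ContinuousAt (B.u p) y ∧ ContinuousAt (B.v p) y ∧ B.Compat p y)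
    (hinj : ∀ y ∈ N, ∀ y' ∈ N, B.u p y = B.u p y' → B.v p y = B.v p y' → y = y')
    (huq : B.u p q = B.u p p) (hvq : B.v p p < B.v p q)
    (hJ : IsClosed {y | y ∈ N ∧ B.u p y = B.u p p ∧ B.v p p ≤ B.v p y ∧ B.v p y ≤ B.v p q})
    (hαJ : ∀ t ∈ Ioo a b,
      α t ∉ {y | y ∈ N ∧ B.u p y = B.u p p ∧ B.v p p ≤ B.v p y ∧ B.v p y ≤ B.v p q})
    (hret : ∀ᶠ y in 𝓝 p, B.v p y = B.v p p → y ∈ closure {y | B.Reach p y}) : False := by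
  classical
  -- `P` is the leaf arc from `p` to `q` and `J` the vertical segment from `p` up to `q`, so `P ∪ J`
  -- is a closed curve with corners at `p` and `q`. Its chosen side lies above `P` and to the right
  -- of `J`: a closed quadrant at `p`, the complement of an open quadrant at `q`.
  set J := {y | y ∈ N ∧ B.u p y = B.u p p ∧ B.v p p ≤ B.v p y ∧ B.v p y ≤ B.v p q} with hJd
  set P := α '' Icc a b with hPd
  have hP : IsClosed P := (isCompact_Icc.image_of_continuousOn hα.1).isClosed
  have hpJ : p ∈ J := ⟨hpN, rfl, le_rfl, hvq.le⟩
  have hqJ : q ∈ J := ⟨hqN, huq, hvq.le, le_rfl⟩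
  have hpq : p ≠ q := fun h ↦ hvq.ne (congrArg (B.v p) h)
  have hPint : ∀ z ∈ P, z ≠ p → z ≠ q → ∃ t ∈ Ioo a b, α t = z := by
    rintro z ⟨t, ht, rfl⟩ hzp hzq
    refine ⟨t, ⟨lt_of_le_of_ne ht.1 ?_, lt_of_le_of_ne ht.2 ?_⟩, rfl⟩
    · rintro rfl; exact hzp ha
    · rintro rfl; exact hzq hb
  have hPJ : ∀ z ∈ P, z ∈ J → z = p ∨ z = q := by
    intro z hzP hzJ
    by_contra! h
    obtain ⟨t, ht, rfl⟩ := hPint z hzP h.1 h.2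
    exact hαJ t ht hzJ
  have hapar : ∀ t ∈ Icc a b, α t = p → t = a := fun t ht h ↦ by
    by_contra hta
    have hta' : a < t := lt_of_le_of_ne ht.1 (Ne.symm hta)
    rcases ht.2.lt_or_eq with h1 | rfl
    · exact hαJ t ⟨hta', h1⟩ (h ▸ hpJ)
    · exact hpq (h.symm.trans hb)
  have hbpar : ∀ t ∈ Icc a b, α t = q → t = b := fun t ht h ↦ by
    by_contra htb
    have htb' : t < b := lt_of_le_of_ne ht.2 htb
    rcases ht.1.lt_or_eq with h1 | rfl
    · exact hαJ t ⟨h1, htb'⟩ (h ▸ hqJ)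
    · exact hpq (ha.symm.trans h)
  -- the shape of the arc near its points
  have hPp : ∀ᶠ y in 𝓝 p, y ∈ P ↔ B.v p y = B.v p p ∧ B.u p p ≤ B.u p y := by
    have h1 := hα.eventually_mem_right (t := a) ⟨le_rfl, hab⟩
    rw [ha] at h1
    filter_upwards [h1, hα.eventually_param p] with y hy1 hy2
    refine ⟨?_, fun h ↦ hy1 h.1 h.2⟩
    rintro ⟨t, ht, rfl⟩
    obtain ⟨t₀, ht₀, h0, hv, -, hu⟩ := hy2 t ht rfl
    have := hapar t₀ ht₀ h0
    subst this
    refine ⟨hv, ?_⟩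
    rcases ht.1.lt_or_eq with h | h
    · exact (hu h).le
    · rw [← h, h0]
  have hPq : ∀ᶠ y in 𝓝 q, y ∈ P ↔ B.v q y = B.v q q ∧ B.u q y ≤ B.u q q := by
    have h1 := hα.eventually_mem_left (t := b) ⟨hab, le_rfl⟩
    rw [hb] at h1
    filter_upwards [h1, hα.eventually_param q] with y hy1 hy2
    refine ⟨?_, fun h ↦ hy1 h.1 h.2⟩
    rintro ⟨t, ht, rfl⟩
    obtain ⟨t₀, ht₀, h0, hv, hu, -⟩ := hy2 t ht rfl
    have := hbpar t₀ ht₀ h0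
    subst this
    refine ⟨hv, ?_⟩
    rcases ht.2.lt_or_eq with h | h
    · exact (hu h).le
    · rw [h, h0]
  have hPz : ∀ z ∈ P, z ∉ J → ∀ᶠ y in 𝓝 z, y ∈ P ↔ B.v z y = B.v z z := by
    intro z hzP hzJ
    obtain ⟨t, ht, rfl⟩ := hPint z hzP (fun h ↦ hzJ (h ▸ hpJ)) (fun h ↦ hzJ (h ▸ hqJ))
    filter_upwards [hα.eventually_param (α t), hα.eventually_mem_left (t := t) ⟨ht.1, ht.2.le⟩,
      hα.eventually_mem_right (t := t) ⟨ht.1.le, ht.2⟩] with y hy1 hy2 hy3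
    refine ⟨?_, fun h ↦ ?_⟩
    · rintro ⟨s, hs, rfl⟩
      obtain ⟨_, _, _, h, _⟩ := hy1 s hs rfl
      exact h
    · rcases le_total (B.u (α t) y) (B.u (α t) (α t)) with h' | h'
      exacts [hy2 h h', hy3 h h']
  -- the region on one side of the closed curve
  set S : M → Set M := fun z ↦ if z = p then {w | B.u p p ≤ B.u p w ∧ B.v p p ≤ B.v p w}
    else if z = q then {w | B.u p p ≤ B.u p w ∨ B.v p q ≤ B.v p w}
    else if z ∈ J then {w | B.u p p ≤ B.u p w} else {w | B.v z z ≤ B.v z w} with hS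
  have hSp : S p = {w | B.u p p ≤ B.u p w ∧ B.v p p ≤ B.v p w} := if_pos rfl
  have hSq : S q = {w | B.u p p ≤ B.u p w ∨ B.v p q ≤ B.v p w} := by
    rw [hS]; simp only [if_neg hpq.symm, if_true]
  have hSJ : ∀ z ∈ J, z ≠ p → z ≠ q → S z = {w | B.u p p ≤ B.u p w} := fun z h1 h2 h3 ↦ by
    rw [hS]; simp only [if_neg h2, if_neg h3, if_pos h1]
  have hSz : ∀ z, z ∉ J → S z = {w | B.v z z ≤ B.v z w} := fun z h1 ↦ by
    rw [hS]
    simp only [if_neg h1, if_neg (fun h ↦ h1 (h ▸ hpJ) : z ≠ p),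
      if_neg (fun h ↦ h1 (h ▸ hqJ) : z ≠ q)]
  have hNp : ∀ᶠ y in 𝓝 p, y ∈ N := hN.mem_nhds hpN
  have hNq : ∀ᶠ y in 𝓝 q, y ∈ N := hN.mem_nhds hqN
  have hCcl : IsClosed (P ∪ J) := hP.union hJ
  have hJN : ∀ z ∈ J, z ≠ p → z ≠ q → B.v p p < B.v p z ∧ B.v p z < B.v p q := by
    intro z hz hzp hzq
    refine ⟨lt_of_le_of_ne hz.2.2.1 fun h ↦ hzp ?_, lt_of_le_of_ne hz.2.2.2 fun h ↦ hzq ?_⟩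
    · exact hinj z hz.1 p hpN hz.2.1 h.symm
    · exact hinj z hz.1 q hqN (hz.2.1.trans huq.symm) h
  have hp_near : ∀ᶠ y in 𝓝 p, (y ∈ N ∧ B.v p y < B.v p q) ∧ (y ∈ P ∪ J ↔
      (B.v p y = B.v p p ∧ B.u p p ≤ B.u p y) ∨ (B.u p y = B.u p p ∧ B.v p p ≤ B.v p y)) := by
    filter_upwards [hPp, hNp, (continuousAt_v p).eventually (gt_mem_nhds hvq)] with y h1 h2 h3
    refine ⟨⟨h2, h3⟩, ?_⟩
    rw [mem_union, h1, hJd]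
    simp only [mem_ofPred_eq, h2, h3.le, true_and, and_true]
  have hq_near : ∀ᶠ y in 𝓝 q, (y ∈ N ∧ B.v p p < B.v p y) ∧ (y ∈ P ∪ J ↔
      (B.v p y = B.v p q ∧ B.u p y ≤ B.u p p) ∨ (B.u p y = B.u p p ∧ B.v p y ≤ B.v p q)) ∧
      (y ∈ P ↔ B.v p y = B.v p q ∧ B.u p y ≤ B.u p p) := by
    filter_upwards [hPq, hNq, (hch q hqN).2.1.eventually (lt_mem_nhds hvq), (hch q hqN).2.2]
      with y h1 h2 h3 h4
    have h5 : y ∈ P ↔ B.v p y = B.v p q ∧ B.u p y ≤ B.u p p := by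
      rw [h1, ← huq]
      constructor
      · rintro ⟨h5, h6⟩
        refine ⟨le_antisymm (not_lt.1 fun h ↦ ?_) (not_lt.1 fun h ↦ ?_), not_lt.1 fun h ↦ ?_⟩
        · exact (h4.2.1.1 h).ne' h5
        · exact (h4.2.2.1 h).ne h5
        · exact (h4.1.1.1 h).not_ge h6
      · rintro ⟨h5, h6⟩
        refine ⟨le_antisymm (not_lt.1 fun h ↦ ?_) (not_lt.1 fun h ↦ ?_), not_lt.1 fun h ↦ ?_⟩
        · exact (h4.2.1.2 h).ne' h5
        · exact (h4.2.2.2 h).ne h5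
        · exact (h4.1.1.2 h).not_ge h6
    refine ⟨⟨h2, h3⟩, ?_, h5⟩
    rw [mem_union, h5, hJd]
    simp only [mem_ofPred_eq, h2, h3.le, true_and]
  have hcompat_v : ∀ x y : M, B.Compat x y →
      ∀ᶠ w in 𝓝 y, (B.v x y ≤ B.v x w ↔ B.v y y ≤ B.v y w) := fun x y h ↦ h.mono fun w hw ↦ by
    rw [← not_lt, ← not_lt, hw.2.2]
  have h1 : ∀ z ∈ P ∪ J, ∀ᶠ y in 𝓝 z, y ∈ P ∪ J → ∀ᶠ w in 𝓝 y, (w ∈ S z ↔ w ∈ S y) := by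
    intro z hz
    by_cases hzp : z = p
    · subst hzp
      filter_upwards [hp_near] with y hy hyC
      by_cases hyz : y = z
      · subst hyz
        exact Eventually.of_forall fun w ↦ Iff.rfl
      have hyq : y ≠ q := fun h ↦ hy.1.2.ne (congrArg _ h)
      obtain ⟨hcu, hcv, hcc⟩ := hch y hy.1.1
      rw [hSp]
      by_cases hyJ : y ∈ J
      · rw [hSJ y hyJ hyz hyq]
        filter_upwards [hcv.eventually (lt_mem_nhds (hJN y hyJ hyz hyq).1)] with w hw
        exact and_iff_left hw.le
      · rw [hSz y hyJ]
        have hy2 : B.v z y = B.v z z ∧ B.u z z < B.u z y := by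
          rcases hy.2.1 hyC with h | h
          · refine ⟨h.1, lt_of_le_of_ne h.2 fun h' ↦ hyz ?_⟩
            exact hinj y hy.1.1 z hpN h'.symm h.1
          · exact (hyJ ⟨hy.1.1, h.1, h.2, hy.1.2.le⟩).elim
        filter_upwards [hcu.eventually (lt_mem_nhds hy2.2), hcompat_v z y hcc] with w hw hw'
        rw [← hw', hy2.1]
        exact and_iff_right hw.le
    by_cases hzq : z = q
    · subst hzq
      filter_upwards [hq_near] with y hy hyC
      by_cases hyz : y = z
      · subst hyz
        exact Eventually.of_forall fun w ↦ Iff.rfl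
      have hyp : y ≠ p := fun h ↦ hy.1.2.ne' (congrArg _ h)
      obtain ⟨hcu, hcv, hcc⟩ := hch y hy.1.1
      rw [hSq]
      by_cases hyJ : y ∈ J
      · rw [hSJ y hyJ hyp hyz]
        filter_upwards [hcv.eventually (gt_mem_nhds (hJN y hyJ hyp hyz).2)] with w hw
        exact or_iff_left hw.not_ge
      · rw [hSz y hyJ]
        have hy2 : B.v p y = B.v p z ∧ B.u p y < B.u p p := by
          rcases hy.2.1.1 hyC with h | h
          · refine ⟨h.1, lt_of_le_of_ne h.2 fun h' ↦ hyz ?_⟩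
            exact hinj y hy.1.1 z hqN (h'.trans huq.symm) h.1
          · exact (hyJ ⟨hy.1.1, h.1, hy.1.2.le, h.2⟩).elim
        filter_upwards [hcu.eventually (gt_mem_nhds hy2.2), hcompat_v p y hcc] with w hw hw'
        rw [← hw', hy2.1]
        exact or_iff_right hw.not_ge
    by_cases hzJ : z ∈ J
    · have hzP : z ∉ P := fun h ↦ (hPJ z h hzJ).elim hzp hzq
      filter_upwards [hP.isOpen_compl.mem_nhds hzP, isOpen_ne.mem_nhds hzp,
        isOpen_ne.mem_nhds hzq] with y hy1 hy2 hy3 hyC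
      rw [hSJ z hzJ hzp hzq, hSJ y (hyC.resolve_left hy1) hy2 hy3]
      exact Eventually.of_forall fun w ↦ Iff.rfl
    · have hzP := hz.resolve_right hzJ
      filter_upwards [hJ.isOpen_compl.mem_nhds hzJ, hPz z hzP hzJ, B.compat z] with y hy1 hy2 hy3 hyC
      have hv := hy2.1 (hyC.resolve_right hy1)
      rw [hSz z hzJ, hSz y hy1]
      filter_upwards [hcompat_v z y hy3] with w hw
      rw [← hw, hv]
  have h2 : ∀ z ∈ P ∪ J, ∀ᶠ y in 𝓝 z, y ∉ P ∪ J →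
      (∀ᶠ w in 𝓝 y, w ∈ S z) ∨ (∀ᶠ w in 𝓝 y, w ∉ S z) := by
    intro z hz
    by_cases hzp : z = p
    · subst hzp
      filter_upwards [hp_near] with y hy hyC
      obtain ⟨hcu, hcv, hcc⟩ := hch y hy.1.1
      rw [hy.2] at hyC
      rw [hSp]
      rcases lt_trichotomy (B.u z y) (B.u z z) with h | h | h
      · exact Or.inr ((hcu.eventually (gt_mem_nhds h)).mono fun w hw hw' ↦ hw.not_ge hw'.1)
      · have h' : B.v z y < B.v z z := not_le.1 fun h' ↦ hyC (Or.inr ⟨h, h'⟩)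
        exact Or.inr ((hcv.eventually (gt_mem_nhds h')).mono fun w hw hw' ↦ hw.not_ge hw'.2)
      · rcases lt_trichotomy (B.v z y) (B.v z z) with h' | h' | h'
        · exact Or.inr ((hcv.eventually (gt_mem_nhds h')).mono fun w hw hw' ↦ hw.not_ge hw'.2)
        · exact (hyC (Or.inl ⟨h', h.le⟩)).elim
        · refine Or.inl ?_
          filter_upwards [hcu.eventually (lt_mem_nhds h), hcv.eventually (lt_mem_nhds h')]
            with w hw hw'
          exact ⟨hw.le, hw'.le⟩
    by_cases hzq : z = q
    · subst hzq
      filter_upwards [hq_near] with y hy hyC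
      obtain ⟨hcu, hcv, hcc⟩ := hch y hy.1.1
      rw [hy.2.1] at hyC
      rw [hSq]
      rcases lt_trichotomy (B.u p y) (B.u p p) with h | h | h
      · rcases lt_trichotomy (B.v p y) (B.v p z) with h' | h' | h'
        · refine Or.inr ?_
          filter_upwards [hcu.eventually (gt_mem_nhds h), hcv.eventually (gt_mem_nhds h')]
            with w hw hw' hw2
          exact hw2.elim hw.not_ge hw'.not_ge
        · exact (hyC (Or.inl ⟨h', h.le⟩)).elim
        · exact Or.inl ((hcv.eventually (lt_mem_nhds h')).mono fun w hw ↦ Or.inr hw.le)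
      · have h' : B.v p z < B.v p y := not_le.1 fun h' ↦ hyC (Or.inr ⟨h, h'⟩)
        exact Or.inl ((hcv.eventually (lt_mem_nhds h')).mono fun w hw ↦ Or.inr hw.le)
      · exact Or.inl ((hcu.eventually (lt_mem_nhds h)).mono fun w hw ↦ Or.inl hw.le)
    by_cases hzJ : z ∈ J
    · have hv := hJN z hzJ hzp hzq
      rw [hSJ z hzJ hzp hzq]
      obtain ⟨hcu, hcv, hcc⟩ := hch z hzJ.1
      filter_upwards [hN.mem_nhds hzJ.1, hcv.eventually (lt_mem_nhds hv.1),
        hcv.eventually (gt_mem_nhds hv.2)] with y hyN hy1 hy2 hyC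
      rcases lt_trichotomy (B.u p y) (B.u p p) with h | h | h
      · exact Or.inr (((hch y hyN).1.eventually (gt_mem_nhds h)).mono fun w hw ↦ hw.not_ge)
      · exact (hyC (Or.inr ⟨hyN, h, hy1.le, hy2.le⟩)).elim
      · exact Or.inl (((hch y hyN).1.eventually (lt_mem_nhds h)).mono fun w hw ↦ hw.le)
    · have hzP := hz.resolve_right hzJ
      rw [hSz z hzJ]
      filter_upwards [hPz z hzP hzJ, B.eventually_chart z] with y hy2 hy3 hyC
      rcases lt_trichotomy (B.v z y) (B.v z z) with h | h | h
      · exact Or.inr ((hy3.2.1.eventually (gt_mem_nhds h)).mono fun w hw ↦ hw.not_ge)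
      · exact (hyC (Or.inl (hy2.2 h))).elim
      · exact Or.inl ((hy3.2.1.eventually (lt_mem_nhds h)).mono fun w hw ↦ hw.le)
  obtain ⟨F, hF1, hF2⟩ := exists_int_function_of_sides hCcl S h1 h2
  have hself : ∀ z ∈ P ∪ J, z ∈ S z := by
    intro z hz
    by_cases hzp : z = p
    · rw [hzp, hSp]; exact ⟨le_rfl, le_rfl⟩
    by_cases hzq : z = q
    · rw [hzq, hSq]; exact Or.inr le_rfl
    by_cases hzJ : z ∈ J
    · rw [hSJ z hzJ hzp hzq]; exact hzJ.2.1.ge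
    · rw [hSz z hzJ]; exact le_refl (B.v z z)
  have hright : ∀ z ∈ P ∪ J, ∀ᶠ w in 𝓝 z, B.v z w = B.v z z → B.u z z < B.u z w → w ∈ S z := by
    intro z hz
    have hJr : z ∈ J → ∀ᶠ w in 𝓝 z, B.u z z < B.u z w → B.u p p ≤ B.u p w := fun hzJ ↦ by
      filter_upwards [(hch z hzJ.1).2.2] with w hw h
      rw [← hzJ.2.1]
      exact (hw.1.1.2 h).le
    by_cases hzp : z = p
    · subst hzp
      rw [hSp]
      exact Eventually.of_forall fun w hv hu ↦ ⟨hu.le, hv.ge⟩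
    by_cases hzq : z = q
    · rw [hzq, hSq, ← hzq]
      exact (hJr (hzq ▸ hqJ)).mono fun w hw _ hu ↦ Or.inl (hw hu)
    by_cases hzJ : z ∈ J
    · rw [hSJ z hzJ hzp hzq]
      exact (hJr hzJ).mono fun w hw _ hu ↦ hw hu
    · rw [hSz z hzJ]
      exact Eventually.of_forall fun w hv _ ↦ hv.ge
  -- A leaf meets `J` only from left to right, that is, entering the side where `F` is larger, and
  -- it cannot cross `P`, which is part of a leaf.
  have hmono : ∀ {x y}, B.Reach x y → F x ≤ F y := fun h ↦ h.le fun z ↦ by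
    by_cases hz : z ∈ P ∪ J
    · obtain ⟨n, hn⟩ := hF2 z hz
      have hFz := hn.self_of_nhds.1 (hself z hz)
      filter_upwards [hn, hright z hz] with w hw hw' hv
      refine ⟨fun _ ↦ ?_, fun hu ↦ ?_⟩
      · by_cases hwS : w ∈ S z
        · rw [hFz, hw.1 hwS]
        · rw [hFz, hw.2 hwS]; omega
      · rw [hFz, hw.1 (hw' hv hu)]
    · filter_upwards [hF1 z hz] with w hw _
      rw [hw]
      simp
  obtain ⟨n, hn⟩ := hF2 p (Or.inr hpJ)
  have hFp := hn.self_of_nhds.1 (hself p (Or.inr hpJ))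
  -- Just before `p` on its leaf, `F` equals `n`, one less than at `p`. By `hret` this point is a
  -- limit of points after `p`, where `F` is at least `n + 1`, and `F` is locally constant there.
  obtain ⟨w, ⟨hw1, hw2, hw3⟩, hwv, hwu⟩ := B.exists_left (hn.and (hret.and hp_near))
  have hwC : w ∉ P ∪ J := by
    rw [hw3.2]
    rintro (h | h)
    · exact hwu.not_ge h.2
    · exact hwu.ne h.1
  have hFw : F w = n := hw1.2 (by rw [hSp]; exact fun h ↦ hwu.not_ge h.1)
  obtain ⟨y, hy1, hy2⟩ := ((mem_closure_iff_frequently.1 (hw2 hwv)).and_eventually (hF1 w hwC)).exists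
  have := hmono hy1
  omega

end Bifoliation

/-! ### Existence of compact leaves -/

namespace Bifoliation

variable {M : Type*} [TopologicalSpace M] {B : Bifoliation M}

/-- A compact leaf of the first foliation. -/
structure Leaf (B : Bifoliation M) (L : Set M) : Prop where
  isCompact : IsCompact L
  nonempty : L.Nonempty
  isPreconnected : IsPreconnected L
  mem_iff : ∀ z ∈ L, ∀ᶠ y in 𝓝 z, y ∈ L ↔ B.v z y = B.v z z

theorem HPath.flip {α : ℝ → M} {a b : ℝ} (h : B.HPath α a b) : B.flip.HPath α a b :=
  ⟨h.1, fun t ht ↦ (h.2 t ht).mono fun _ hs ↦ ⟨congrArg Neg.neg hs.1, hs.2⟩⟩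

theorem Reach.flip {x y : M} : B.Reach x y → B.flip.Reach x y
  | ⟨α, a, b, hab, hα, h⟩ => ⟨α, a, b, hab, hα.flip, h⟩

theorem Compat.flip {x y : M} (h : B.Compat x y) : B.flip.Compat x y := h.mono fun w hw ↦ by
  change _ ∧ ((-B.v x y < -B.v x w ↔ -B.v y y < -B.v y w) ∧
    (-B.v x w < -B.v x y ↔ -B.v y w < -B.v y y))
  simpa only [neg_lt_neg_iff] using ⟨hw.1, hw.2.2, hw.2.1⟩

theorem HPath.exists_first_return [T2Space M] {α : ℝ → M} {a c : ℝ} (h : B.HPath α a c)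
    (hac : a < c) {J : Set M} (hJ : IsClosed J) (hc : α c ∈ J)
    (ha : ∀ᶠ t in 𝓝[>] a, α t ∉ J) :
    ∃ b ∈ Ioc a c, α b ∈ J ∧ ∀ t ∈ Ioo a b, α t ∉ J := by
  obtain ⟨d, hd, hd'⟩ := mem_nhdsGT_iff_exists_Ioc_subset.1 ha
  have hdc : d ≤ c := not_lt.1 fun hcd ↦ hd' ⟨hac, hcd.le⟩ hc
  have hcl : IsClosed (Icc d c ∩ α ⁻¹' J) :=
    (h.1.mono (Icc_subset_Icc hd.le le_rfl)).preimage_isClosed_of_isClosed isClosed_Icc hJ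
  obtain ⟨b, hb, hbl⟩ := (isCompact_Icc.of_isClosed_subset hcl inter_subset_left).exists_isLeast
    ⟨c, ⟨hdc, le_rfl⟩, hc⟩
  refine ⟨b, ⟨(mem_Ioi.1 hd).trans_le hb.1.1, hb.1.2⟩, hb.2, fun t ht htJ ↦ ?_⟩
  rcases le_or_gt t d with h' | h'
  · exact hd' ⟨ht.1, h'⟩ htJ
  · exact ht.2.not_ge (hbl ⟨⟨h'.le, ht.2.le.trans hb.1.2⟩, htJ⟩)

/-- A right-invariant set contains a full neighbourhood of one of its points in a leaf. -/
theorem RightInv.exists_plaque {K : Set M} (hK : B.RightInv K) (hne : K.Nonempty) :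
    ∃ p ∈ K, ∀ᶠ y in 𝓝 p, B.v p y = B.v p p → y ∈ K := by
  obtain ⟨z, hz⟩ := hne
  obtain ⟨b⟩ := B.exists_box z (B.compat z)
  have hr := b.r_pos
  -- Invariance only gives the forward half of the plaque of `z`; a point moved slightly forward has
  -- a full plaque inside this half.
  have hq : (B.u z z + b.r / 2, B.v z z) ∈ b.sq := by
    rw [Box.mem_sq_iff]; constructor <;> constructor <;> dsimp <;> linarith
  have hmem : ∀ y, (B.u z y, B.v z y) ∈ b.sq ∧ b.σ (B.u z y, B.v z y) = y → B.v z y = B.v z z →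
      B.u z z ≤ B.u z y → y ∈ K := fun y hy hv hu ↦ by
    refine hK z hz y ?_
    have := b.reach (fun _ h ↦ h) b.base_mem (hv ▸ hy.1) hu
    rwa [b.base, ← hv, hy.2] at this
  refine ⟨b.σ _, hmem _ ?_ (b.v_σ _ hq) ?_, ?_⟩
  · rw [b.u_σ _ hq, b.v_σ _ hq]
    exact ⟨hq, rfl⟩
  · rw [b.u_σ _ hq]; dsimp; linarith
  · have hlt : B.u z z < B.u z (b.σ (B.u z z + b.r / 2, B.v z z)) := by
      rw [b.u_σ _ hq]; dsimp; linarith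
    filter_upwards [b.eventually_mem hq, b.prop _ hq,
      (b.cont_u _ hq).eventually (lt_mem_nhds hlt)] with y hy hc hu hv
    refine hmem y hy ?_ hu.le
    rw [b.v_σ _ hq] at hc
    exact le_antisymm (not_lt.1 fun h ↦ (hc.2.1.1 h).ne' hv) (not_lt.1 fun h ↦ (hc.2.2.1 h).ne hv)

theorem Box.isClosed_vertical [T2Space M] {p : M} {P : M → Prop} (b : B.Box p P) {c d : ℝ}
    (hc : B.v p p - b.r < c) (hd : d < B.v p p + b.r) :
    IsClosed {y | y ∈ b.σ '' b.sq ∧ B.u p y = B.u p p ∧ c ≤ B.v p y ∧ B.v p y ≤ d} := by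
  have hr := b.r_pos
  have hm : ∀ t ∈ Icc c d, (B.u p p, t) ∈ b.sq := fun t ht ↦ by
    rw [Box.mem_sq_iff]
    exact ⟨⟨by dsimp; linarith, by dsimp; linarith⟩, hc.trans_le ht.1, ht.2.trans_lt hd⟩
  have hcont : ContinuousOn (fun t ↦ b.σ (B.u p p, t)) (Icc c d) := fun t ht ↦
    (ContinuousAt.comp (f := fun t ↦ (B.u p p, t)) (b.continuousAt (hm t ht))
      (by fun_prop)).continuousWithinAt
  convert (isCompact_Icc.image_of_continuousOn hcont).isClosed using 1
  ext y
  constructor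
  · rintro ⟨⟨q, hq, rfl⟩, hu, hv⟩
    rw [b.v_σ q hq] at hv
    rw [b.u_σ q hq] at hu
    exact ⟨q.2, hv, by rw [← hu]⟩
  · rintro ⟨t, ht, rfl⟩
    refine ⟨⟨_, hm t ht, rfl⟩, b.u_σ _ (hm t ht), ?_⟩
    rw [b.v_σ _ (hm t ht)]
    exact ht

/-- On a compact simply connected surface, every non-empty closed right-invariant set contains a
compact leaf. -/
theorem exists_leaf [T2Space M] [CompactSpace M] [SimplyConnectedSpace M]
    [LocallyPathConnectedSpace M] {K : Set M} (hK : IsClosed K) (hne : K.Nonempty)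
    (hr : B.RightInv K) : ∃ L ⊆ K, B.Leaf L := by
  obtain ⟨K₀, hK₀, hcl, hne₀, hr₀, hmin⟩ := exists_minimal hK hne hr
  obtain ⟨p, hpK, hpl⟩ := hr₀.exists_plaque hne₀
  obtain ⟨b⟩ := B.exists_box p (B.eventually_chart p)
  have hbr := b.r_pos
  set N := b.σ '' b.sq with hNd
  have hch : ∀ y ∈ N, ContinuousAt (B.u p) y ∧ ContinuousAt (B.v p) y ∧ B.Compat p y := by
    rintro _ ⟨q, hq, rfl⟩
    exact b.prop q hq
  have hN : IsOpen N := isOpen_iff_mem_nhds.2 (by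
    rintro _ ⟨q, hq, rfl⟩
    exact b.mem_nhds q hq)
  have hNσ : ∀ y ∈ N, (B.u p y, B.v p y) ∈ b.sq ∧ b.σ (B.u p y, B.v p y) = y := by
    rintro _ ⟨q, hq, rfl⟩
    exact (b.eventually_mem hq).self_of_nhds
  have hinj : ∀ y ∈ N, ∀ y' ∈ N, B.u p y = B.u p y' → B.v p y = B.v p y' → y = y' :=
    fun y hy y' hy' h h' ↦ by rw [← (hNσ y hy).2, ← (hNσ y' hy').2, h, h']
  have hpN : p ∈ N := ⟨_, b.base_mem, b.base⟩
  set J := {y | y ∈ N ∧ B.u p y = B.u p p ∧ B.v p p - b.r / 2 ≤ B.v p y ∧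
    B.v p y ≤ B.v p p + b.r / 2} with hJd
  have hJ : IsClosed J := b.isClosed_vertical (by linarith) (by linarith)
  have hpp : (B.u p p + b.r / 2, B.v p p) ∈ b.sq := by
    rw [Box.mem_sq_iff]; constructor <;> constructor <;> dsimp <;> linarith
  -- The return path is made to pass through `p'` so that it is not constant. By minimality the
  -- points after `p'` accumulate at a point just before `p`; from there the box leads forward to
  -- `J`.
  set p' := b.σ (B.u p p + b.r / 2, B.v p p) with hp'
  have hpp' : B.Reach p p' := by
    have := b.reach (fun _ h ↦ h.2.2) b.base_mem hpp (by linarith)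
    rwa [b.base] at this
  have hne' : p ≠ p' := fun h ↦ by
    have := congrArg (B.u p) h
    rw [hp', b.u_σ _ hpp] at this
    dsimp at this
    linarith
  -- a path along the leaf from `p` back to `J`
  obtain ⟨α, a, c, hac, hα, hαa, hαc⟩ : ∃ (α : ℝ → M) (a c : ℝ), a < c ∧ B.HPath α a c ∧
      α a = p ∧ α c ∈ J := by
    obtain ⟨w, ⟨hwK, hwN⟩, hwv, hwu⟩ := B.exists_left (hpl.and (hN.mem_nhds hpN))
    have hwcl : w ∈ closure {y | B.Reach p' y} := by
      rw [hmin p' (hr₀ p hpK p' hpp')]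
      exact hwK hwv
    have h1 : ∀ᶠ y in 𝓝 w, B.u p y < B.u p p ∧ (B.v p p - b.r / 2 < B.v p y ∧
        B.v p y < B.v p p + b.r / 2) ∧ y ∈ N := by
      filter_upwards [(hch w hwN).1.eventually (gt_mem_nhds hwu), (hch w hwN).2.1.eventually
        (lt_mem_nhds (show B.v p p - b.r / 2 < B.v p w by linarith)), (hch w hwN).2.1.eventually
        (gt_mem_nhds (show B.v p w < B.v p p + b.r / 2 by linarith)), hN.mem_nhds hwN] with y h1 h2 h3 h4
      exact ⟨h1, ⟨h2, h3⟩, h4⟩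
    obtain ⟨y, hy, hyu, hyv, hyN⟩ := ((mem_closure_iff_frequently.1 hwcl).and_eventually h1).exists
    have hsq : (B.u p p, B.v p y) ∈ b.sq := by
      rw [Box.mem_sq_iff]; constructor <;> constructor <;> dsimp <;> linarith
    have h2 := b.reach (fun _ h ↦ h.2.2) (hNσ y hyN).1 hsq hyu.le
    rw [(hNσ y hyN).2] at h2
    obtain ⟨α, a, d, c, had, hdc, hα, ha, hd, hc⟩ := hpp'.exists_path (hy.trans h2)
    refine ⟨α, a, c, lt_of_le_of_ne (had.trans hdc) fun hac ↦ hne' ?_, hα, ha, ?_⟩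
    · rw [← ha, ← hd, le_antisymm had (hac ▸ hdc)]
    · rw [hc]
      refine ⟨⟨_, hsq, rfl⟩, b.u_σ _ hsq, ?_⟩
      rw [b.v_σ _ hsq]
      exact ⟨hyv.1.le, hyv.2.le⟩
  obtain ⟨d, hd, hdJ, hfirst⟩ := hα.exists_first_return hac hJ hαc (by
    have h1 := hα.2 a ⟨le_rfl, hac.le⟩
    rw [eventually_nhdsWithin_iff, hαa] at h1
    filter_upwards [h1.filter_mono nhdsWithin_le_nhds, Ioc_mem_nhdsGT hac] with t ht htm htJ
    exact ((ht ⟨htm.1.le, htm.2⟩).2.2 htm.1).ne' htJ.2.1)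
  have hαd : B.HPath α a d := hα.mono le_rfl hd.2
  have hret : ∀ᶠ y in 𝓝 p, B.v p y = B.v p p → y ∈ closure {y | B.Reach p y} := by
    rwa [hmin p hpK]
  obtain ⟨hdN, hdu, hdv⟩ := hdJ
  -- A first return above `p` is excluded by the staircase, and one below `p` by the same argument
  -- for `B.flip`. So the path returns to `p`, and its image is a compact leaf.
  rcases lt_trichotomy (B.v p p) (B.v p (α d)) with h | h | h
  · refine (false_of_staircase hd.1 hαd hαa rfl hN hpN hdN hch hinj hdu h
      (b.isClosed_vertical (by linarith) (by linarith)) (fun t ht htJ ↦ hfirst t ht ?_) hret).elim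
    exact ⟨htJ.1, htJ.2.1, by linarith [htJ.2.2.1], htJ.2.2.2.trans hdv.2⟩
  · have hdp : α d = p := hinj _ hdN _ hpN hdu h.symm
    refine ⟨α '' Icc a d, ?_, isCompact_Icc.image_of_continuousOn hαd.1,
      ⟨p, a, ⟨le_rfl, hd.1.le⟩, hαa⟩, isPreconnected_Icc.image _ hαd.1, ?_⟩
    · rintro _ ⟨t, ht, rfl⟩
      exact hK₀ (hr₀ p hpK _ ⟨α, a, t, ht.1, hαd.mono le_rfl ht.2, hαa, rfl⟩)
    · rintro _ ⟨t, ht, rfl⟩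
      have hl : ∃ s ∈ Ioc a d, α s = α t := by
        rcases ht.1.lt_or_eq with h' | rfl
        · exact ⟨t, ⟨h', ht.2⟩, rfl⟩
        · exact ⟨d, ⟨hd.1, le_rfl⟩, hdp.trans hαa.symm⟩
      have hr : ∃ s ∈ Ico a d, α s = α t := by
        rcases ht.2.lt_or_eq with h' | rfl
        · exact ⟨t, ⟨ht.1, h'⟩, rfl⟩
        · exact ⟨a, ⟨le_rfl, hd.1⟩, hαa.trans hdp.symm⟩
      obtain ⟨s, hs, hst⟩ := hl
      obtain ⟨s', hs', hst'⟩ := hr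
      have h1 := hαd.eventually_mem_left hs
      have h2 := hαd.eventually_mem_right hs'
      rw [hst] at h1
      rw [hst'] at h2
      filter_upwards [h1, h2, hαd.eventually_param (α t)] with y hy1 hy2 hy3
      refine ⟨?_, fun hv ↦ ?_⟩
      · rintro ⟨t', ht', rfl⟩
        obtain ⟨_, _, _, hv, _⟩ := hy3 t' ht' rfl
        exact hv
      · rcases le_total (B.u (α t) y) (B.u (α t) (α t)) with h' | h'
        exacts [hy1 hv h', hy2 hv h']
  · refine (false_of_staircase (B := B.flip) hd.1 hαd.flip hαa rfl hN hpN hdN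
      (fun y hy ↦ ⟨(hch y hy).1, (hch y hy).2.1.neg, (hch y hy).2.2.flip⟩)
      (fun y hy y' hy' h h' ↦ hinj y hy y' hy' h (neg_injective h')) hdu (neg_lt_neg h) ?_
      (fun t ht htJ ↦ hfirst t ht ?_) ?_).elim
    · convert b.isClosed_vertical (c := B.v p (α d)) (d := B.v p p) (by linarith) (by linarith)
        using 1
      ext y
      simp only [mem_ofPred_eq, Bifoliation.flip, neg_le_neg_iff]
      tauto
    · obtain ⟨h1, h2, h3, h4⟩ := htJ
      exact ⟨h1, h2, hdv.1.trans (neg_le_neg_iff.1 h4), (neg_le_neg_iff.1 h3).trans (by linarith)⟩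
    · exact hret.mono fun y hy hv ↦ closure_mono (fun w hw ↦ Reach.flip hw) (hy (neg_injective hv))

end Bifoliation

/-! ### Regions bounded by compact leaves -/

namespace Bifoliation

variable {M : Type*} [TopologicalSpace M] {B : Bifoliation M}

/-- `D` is a region with boundary the leaf `L`, lying above `L`. -/
structure UpSide (B : Bifoliation M) (L D : Set M) : Prop where
  isClosed : IsClosed D
  subset : L ⊆ D
  isOpen_diff : IsOpen (D \ L)
  mem_iff : ∀ z ∈ L, ∀ᶠ y in 𝓝 z, y ∈ D ↔ B.v z z ≤ B.v z y

/-- `D` is a region with boundary the leaf `L`. -/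
def Side (B : Bifoliation M) (L D : Set M) : Prop := B.UpSide L D ∨ B.flip.UpSide L D

theorem Side.isClosed {L D : Set M} (h : B.Side L D) : IsClosed D :=
  h.elim (fun h ↦ h.isClosed) fun h ↦ h.isClosed

theorem Side.subset {L D : Set M} (h : B.Side L D) : L ⊆ D :=
  h.elim (fun h ↦ h.subset) fun h ↦ h.subset

theorem Side.isOpen_diff {L D : Set M} (h : B.Side L D) : IsOpen (D \ L) :=
  h.elim (fun h ↦ h.isOpen_diff) fun h ↦ h.isOpen_diff

/-- The integer function that jumps across `L` is constant on the connected set `L` and locally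
constant elsewhere. The points where it is at least its value on `L` form one side. -/
theorem Leaf.exists_sides [T2Space M] [SimplyConnectedSpace M] [LocallyPathConnectedSpace M]
    {L : Set M} (hL : B.Leaf L) : ∃ D, B.UpSide L D ∧ B.flip.UpSide L (Dᶜ ∪ L) := by
  have hLc := hL.isCompact.isClosed
  obtain ⟨F, hF1, hF2⟩ := exists_int_function_of_sides hLc (fun z ↦ {w | B.v z z ≤ B.v z w})
    (fun z hz ↦ by
      filter_upwards [hL.mem_iff z hz, B.compat z] with y hy hc hyL
      filter_upwards [hc] with w hw
      rw [← hy.1 hyL, ← not_lt, ← not_lt, hw.2.2])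
    (fun z hz ↦ by
      filter_upwards [hL.mem_iff z hz, B.eventually_chart z] with y hy hc hyL
      rcases lt_trichotomy (B.v z y) (B.v z z) with h | h | h
      · exact Or.inr ((hc.2.1.eventually (gt_mem_nhds h)).mono fun w hw ↦ hw.not_ge)
      · exact (hyL (hy.2 h)).elim
      · exact Or.inl ((hc.2.1.eventually (lt_mem_nhds h)).mono fun w hw ↦ hw.le))
  obtain ⟨x, hx⟩ := hL.nonempty
  have hconst : ∀ z ∈ L, F z = F x := fun z hz ↦ by
    refine hL.isPreconnected.constant (f := F) (fun y hy ↦ ?_) hz hx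
    obtain ⟨n, hn⟩ := hF2 y hy
    refine continuousWithinAt_const.congr_of_eventuallyEq (f := fun _ ↦ F y) ?_ rfl
    filter_upwards [(hL.mem_iff y hy).filter_mono nhdsWithin_le_nhds,
      hn.filter_mono nhdsWithin_le_nhds, self_mem_nhdsWithin] with w h1 h2 h3
    rw [h2.1 (h1.1 h3).ge, hn.self_of_nhds.1 (le_refl (B.v y y))]
  have hmem : ∀ z ∈ L, ∀ᶠ y in 𝓝 z, F x ≤ F y ↔ B.v z z ≤ B.v z y := fun z hz ↦ by
    obtain ⟨n, hn⟩ := hF2 z hz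
    have hz' := hn.self_of_nhds.1 (le_refl (B.v z z))
    rw [hconst z hz] at hz'
    filter_upwards [hn] with y hy
    by_cases h : B.v z z ≤ B.v z y
    · have := hy.1 h
      exact ⟨fun _ ↦ h, fun _ ↦ by omega⟩
    · have := hy.2 h
      exact ⟨fun _ ↦ by omega, fun h' ↦ (h h').elim⟩
  have hLD : L ⊆ {y | F x ≤ F y} := fun z hz ↦ (hconst z hz).ge
  have hopen : IsOpen ({y | F x ≤ F y} \ L) := isOpen_iff_mem_nhds.2 fun z hz ↦ by
    filter_upwards [hF1 z hz.2, hLc.isOpen_compl.mem_nhds hz.2] with y hy hyL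
    exact ⟨hz.1.trans hy.ge, hyL⟩
  have hcl : IsOpen {y | F x ≤ F y}ᶜ := isOpen_iff_mem_nhds.2 fun z hz ↦ by
    filter_upwards [hF1 z fun h ↦ hz (hLD h)] with y hy h
    exact hz (h.trans hy.le)
  refine ⟨{y | F x ≤ F y}, ⟨⟨hcl⟩, hLD, hopen, hmem⟩, ⟨⟨?_⟩, subset_union_right, ?_, ?_⟩⟩
  · rwa [compl_union, compl_compl]
  · rwa [union_sdiff_right, sdiff_eq_self_iff_disjoint.2 (disjoint_compl_right.mono_left hLD)]
  · intro z hz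
    filter_upwards [hmem z hz, hL.mem_iff z hz] with y h1 h2
    rw [mem_union, mem_compl_iff, mem_ofPred_eq, h1, h2]
    change _ ↔ -B.v z z ≤ -B.v z y
    rw [neg_le_neg_iff, not_le, le_iff_lt_or_eq]

theorem UpSide.rightInv {L D : Set M} (h : B.UpSide L D) : B.RightInv D := by
  refine rightInv_of_isClosed h.isClosed fun x hx ↦ ?_
  by_cases hxL : x ∈ L
  · exact (h.mem_iff x hxL).mono fun y hy hv _ ↦ hy.2 hv.ge
  · filter_upwards [h.isOpen_diff.mem_nhds ⟨hx, hxL⟩] with y hy _ _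
    exact hy.1

/-- The transverse leaves cross the boundary `L` upwards, hence into `D`. -/
theorem UpSide.rightInv_swap {L D : Set M} (h : B.UpSide L D) : B.swap.RightInv D := by
  refine rightInv_of_isClosed h.isClosed fun x hx ↦ ?_
  by_cases hxL : x ∈ L
  · exact (h.mem_iff x hxL).mono fun y hy _ hv ↦ hy.2 hv
  · filter_upwards [h.isOpen_diff.mem_nhds ⟨hx, hxL⟩] with y hy _ _
    exact hy.1

theorem Side.rightInv {L D : Set M} (h : B.Side L D) : B.RightInv D := by
  rcases h with h | h
  · exact h.rightInv
  · exact fun x hx y hxy ↦ h.rightInv x hx y hxy.flip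

/-- A region is contained in any region that contains its boundary curve and whose own boundary
curve it does not leave. -/
theorem subset_of_boundary_subset [PreconnectedSpace M] {L L' D E : Set M} (hne : L.Nonempty)
    (hE : IsClosed E) (hEL : IsOpen (E \ L)) (hD : IsClosed D) (hDL : IsOpen (D \ L'))
    (hLD : L ⊆ D) (hb : ∀ z ∈ E ∩ L', ∀ᶠ y in 𝓝 z, y ∈ E → y ∈ D) : E ⊆ D := by
  -- `E \ D` is shown to be open and closed. It misses the non-empty set `L`, so it is empty.
  have hopen : IsOpen (E \ D) := by
    have : E \ D = (E \ L) ∩ Dᶜ := by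
      ext y
      exact ⟨fun h ↦ ⟨⟨h.1, fun h' ↦ h.2 (hLD h')⟩, h.2⟩, fun h ↦ ⟨h.1.1, h.2⟩⟩
    rw [this]
    exact hEL.inter hD.isOpen_compl
  have hclosed : IsClosed (E \ D) := by
    refine ⟨isOpen_iff_mem_nhds.2 fun z hz ↦ ?_⟩
    by_cases hzE : z ∈ E
    · have hzD : z ∈ D := not_not.1 fun h ↦ hz ⟨hzE, h⟩
      by_cases hzL : z ∈ L'
      · filter_upwards [hb z ⟨hzE, hzL⟩] with y hy h
        exact h.2 (hy h.1)
      · filter_upwards [hDL.mem_nhds ⟨hzD, hzL⟩] with y hy h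
        exact h.2 hy.1
    · filter_upwards [hE.isOpen_compl.mem_nhds hzE] with y hy h
      exact hy h.1
  rcases isClopen_iff.1 ⟨hclosed, hopen⟩ with h | h
  · exact sdiff_eq_empty.1 h
  · obtain ⟨x, hx⟩ := hne
    exact ((h ▸ mem_univ x : x ∈ E \ D).2 (hLD hx)).elim

/-- One of the two sides of a leaf does not meet a given disjoint connected set. -/
theorem Leaf.exists_side_disjoint [T2Space M] [SimplyConnectedSpace M]
    [LocallyPathConnectedSpace M] {L C : Set M} (hL : B.Leaf L) (hC : IsPreconnected C)
    (hd : Disjoint L C) : ∃ D, B.Side L D ∧ Disjoint D C := by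
  obtain ⟨D, h1, h2⟩ := hL.exists_sides
  have hcov : C ⊆ D \ L ∪ Dᶜ := fun x hx ↦ by
    by_cases hxD : x ∈ D
    · exact Or.inl ⟨hxD, fun h ↦ disjoint_left.1 hd h hx⟩
    · exact Or.inr hxD
  rcases hC.subset_or_subset h1.isOpen_diff h1.isClosed.isOpen_compl
    (disjoint_compl_right.mono_left sdiff_subset) hcov with h | h
  · refine ⟨_, Or.inr h2, disjoint_left.2 fun x hx hxC ↦ ?_⟩
    exact hx.elim (fun hx ↦ hx (h hxC).1) (h hxC).2
  · exact ⟨D, Or.inl h1, disjoint_left.2 fun x hx hxC ↦ h hxC hx⟩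

/-- Transverse leaves enter `D` across `L` and stay, so `D` contains a compact one, `L'`. It cannot
meet `L`, since just before the meeting point it would lie below `L`, outside `D`. The side of `L'`
away from `L` is then contained in `D`. -/
theorem UpSide.exists_smaller [T2Space M] [CompactSpace M] [SimplyConnectedSpace M]
    [LocallyPathConnectedSpace M] {L D : Set M} (hL : B.Leaf L) (h : B.UpSide L D) :
    ∃ L' D', B.swap.Leaf L' ∧ B.swap.Side L' D' ∧ D' ⊆ D ∧ Disjoint D' L := by
  obtain ⟨L', hL'D, hL'⟩ := exists_leaf h.isClosed (hL.nonempty.mono h.subset) h.rightInv_swap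
  have hd : Disjoint L' L := disjoint_left.2 fun z hz hz' ↦ by
    obtain ⟨w, ⟨hw1, hw2⟩, hwu, hwv⟩ :=
      B.swap.exists_left ((hL'.mem_iff z hz).and (h.mem_iff z hz'))
    exact (show B.v z w < B.v z z from hwv).not_ge (hw2.1 (hL'D (hw1.2 hwu)))
  obtain ⟨D', hD', hdis⟩ := hL'.exists_side_disjoint hL.isPreconnected hd
  refine ⟨L', D', hL', hD', ?_, hdis⟩
  exact subset_of_boundary_subset hL'.nonempty hD'.isClosed hD'.isOpen_diff h.isClosed
    h.isOpen_diff hL'D fun z hz ↦ (disjoint_left.1 hdis hz.1 hz.2).elim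

theorem Leaf.flip {L : Set M} (h : B.Leaf L) : B.flip.Leaf L :=
  ⟨h.isCompact, h.nonempty, h.isPreconnected, fun z hz ↦ (h.mem_iff z hz).mono fun y hy ↦ by
    rw [hy]
    exact neg_inj.symm⟩

theorem Side.exists_smaller [T2Space M] [CompactSpace M] [SimplyConnectedSpace M]
    [LocallyPathConnectedSpace M] {L D : Set M} (hL : B.Leaf L) (h : B.Side L D) :
    ∃ L' D', B.swap.Leaf L' ∧ B.swap.Side L' D' ∧ D' ⊆ D ∧ Disjoint D' L := by
  rcases h with h | h
  · exact h.exists_smaller hL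
  · obtain ⟨L', D', h1, h2, h3⟩ := h.exists_smaller hL.flip
    -- `Leaf` and `UpSide` involve only the function `v`, which is the same for `B.flip.swap` and
    -- `B.swap`.
    exact ⟨L', D', ⟨h1.1, h1.2, h1.3, h1.4⟩,
      h2.imp (fun h ↦ ⟨h.1, h.2, h.3, h.4⟩) (fun h ↦ ⟨h.1, h.2, h.3, h.4⟩), h3⟩

theorem Leaf.subset_of_inter_nonempty [T2Space M] {L L' : Set M} (h : B.Leaf L) (h' : B.Leaf L')
    (hne : (L ∩ L').Nonempty) : L ⊆ L' := by
  by_contra hsub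
  obtain ⟨x, hx, hx'⟩ := not_subset.1 hsub
  have hcov : L ⊆ interior {y | y ∈ L → y ∈ L'} ∪ L'ᶜ := fun y hy ↦ by
    by_cases hy' : y ∈ L'
    · refine Or.inl (mem_interior_iff_mem_nhds.2 ?_)
      filter_upwards [h.mem_iff y hy, h'.mem_iff y hy'] with w h1 h2 hw
      exact h2.2 (h1.1 hw)
    · exact Or.inr hy'
  obtain ⟨y, hy, hy'⟩ := hne
  obtain ⟨w, hw, hwU, hwV⟩ := h.isPreconnected _ L'ᶜ isOpen_interior
    h'.isCompact.isClosed.isOpen_compl hcov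
    ⟨y, hy, (hcov hy).resolve_right fun h ↦ h hy'⟩ ⟨x, hx, hx'⟩
  exact hwV (interior_subset hwU hw)

/-- A compact simply connected surface has no bifoliation. -/
theorem false_of_simplyConnected [T2Space M] [CompactSpace M] [SimplyConnectedSpace M]
    [LocallyPathConnectedSpace M] (B : Bifoliation M) : False := by
  obtain ⟨L₀, -, hL₀⟩ := B.exists_leaf isClosed_univ univ_nonempty
    (fun _ _ _ _ ↦ mem_univ _ : B.RightInv univ)
  obtain ⟨D₀, hD₀, -⟩ := hL₀.exists_sides
  -- Lower bounds for Zorn's lemma: the intersection of a chain of regions contains a compact leaf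
  -- `L`, and one of the two sides of `L` lies in all members of the chain.
  have hlb : ∀ c ⊆ {D : Set M | ∃ L, B.Leaf L ∧ B.Side L D}, IsChain (· ⊆ ·) c → c.Nonempty →
      ∃ lb ∈ {D : Set M | ∃ L, B.Leaf L ∧ B.Side L D}, ∀ s ∈ c, lb ⊆ s := by
    intro c hc hch hcne
    have hKne : (⋂₀ c).Nonempty := by
      have : Nonempty c := hcne.to_subtype
      refine IsCompact.nonempty_sInter_of_directed_nonempty_isCompact_isClosed
        (fun s hs t ht ↦ ?_) (fun s hs ↦ ?_) (fun s hs ↦ ?_) (fun s hs ↦ ?_)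
      · rcases hch.total hs ht with h | h
        exacts [⟨s, hs, subset_rfl, h⟩, ⟨t, ht, h, subset_rfl⟩]
      · obtain ⟨L, hL, hLD⟩ := hc hs
        exact hL.nonempty.mono hLD.subset
      · obtain ⟨L, hL, hLD⟩ := hc hs
        exact hLD.isClosed.isCompact
      · obtain ⟨L, hL, hLD⟩ := hc hs
        exact hLD.isClosed
    obtain ⟨L, hLK, hL⟩ := B.exists_leaf (K := ⋂₀ c)
      (isClosed_sInter fun s hs ↦ (hc hs).choose_spec.2.isClosed) hKne
      (fun x hx y hxy s hs ↦ (hc hs).choose_spec.2.rightInv x (hx s hs) y hxy)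
    obtain ⟨D, h1, h2⟩ := hL.exists_sides
    -- The boundary `L'` of `s` equals `L` or is disjoint from it. In the first case `s` contains
    -- the side of `L` on which it lies locally; in the second it contains the side of `L` that does
    -- not contain `L'`.
    have key : ∀ s ∈ c, D ⊆ s ∨ Dᶜ ∪ L ⊆ s := by
      intro s hs
      obtain ⟨L', hL', hs'⟩ := hc hs
      have hLs : L ⊆ s := fun x hx ↦ hLK hx s hs
      have aux : ∀ E, IsClosed E → IsOpen (E \ L) →
          (∀ z ∈ E ∩ L', ∀ᶠ y in 𝓝 z, y ∈ E → y ∈ s) → E ⊆ s := fun E hE hEL hb ↦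
        subset_of_boundary_subset hL.nonempty hE hEL hs'.isClosed hs'.isOpen_diff hLs hb
      by_cases hd : (L ∩ L').Nonempty
      · have hLL : L = L' := (hL.subset_of_inter_nonempty hL' hd).antisymm
          (hL'.subset_of_inter_nonempty hL (by rwa [inter_comm]))
        subst hLL
        rcases hs' with h | h
        · refine Or.inl (aux D h1.isClosed h1.isOpen_diff fun z hz ↦ ?_)
          filter_upwards [h.mem_iff z hz.2, h1.mem_iff z hz.2] with y hy hy' hyD
          exact hy.2 (hy'.1 hyD)
        · refine Or.inr (aux _ h2.isClosed h2.isOpen_diff fun z hz ↦ ?_)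
          filter_upwards [h.mem_iff z hz.2, h2.mem_iff z hz.2] with y hy hy' hyD
          exact hy.2 (hy'.1 hyD)
      · have hd' : ∀ x ∈ L', x ∉ L := fun x hx hxL ↦ hd ⟨x, hxL, hx⟩
        have hcov : L' ⊆ D \ L ∪ Dᶜ := fun x hx ↦ by
          by_cases hxD : x ∈ D
          · exact Or.inl ⟨hxD, hd' x hx⟩
          · exact Or.inr hxD
        rcases hL'.isPreconnected.subset_or_subset h1.isOpen_diff h1.isClosed.isOpen_compl
          (disjoint_compl_right.mono_left sdiff_subset) hcov with h | h
        · refine Or.inr (aux _ h2.isClosed h2.isOpen_diff fun z hz ↦ ?_)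
          exact (hz.1.elim (fun h' ↦ h' (h hz.2).1) (hd' z hz.2)).elim
        · refine Or.inl (aux D h1.isClosed h1.isOpen_diff fun z hz ↦ ?_)
          exact (h hz.2 hz.1).elim
    -- The side can be chosen independently of `s` because the members of the chain are nested.
    by_cases hall : ∀ s ∈ c, D ⊆ s
    · exact ⟨D, ⟨L, hL, Or.inl h1⟩, hall⟩
    · push Not at hall
      obtain ⟨s₀, hs₀, hs₀'⟩ := hall
      refine ⟨Dᶜ ∪ L, ⟨L, hL, Or.inr h2⟩, fun s hs ↦ ?_⟩
      rcases hch.total hs hs₀ with h | h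
      · exact (key s hs).resolve_left fun h' ↦ hs₀' (h'.trans h)
      · exact ((key s₀ hs₀).resolve_left hs₀').trans h
  obtain ⟨D, -, hD⟩ := zorn_superset_nonempty _ hlb D₀ ⟨L₀, hL₀, Or.inl hD₀⟩
  obtain ⟨L, hL, hLD⟩ := hD.prop
  -- Two steps lead back to the first foliation. `D₂` lies in `D₁`, which misses the part `L` of
  -- `D`, so `D` was not minimal.
  obtain ⟨L₁, D₁, h1, h2, h3, h4⟩ := hLD.exists_smaller hL
  obtain ⟨L₂, D₂, h5, h6, h7, h8⟩ := h2.exists_smaller h1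
  have := hD.le_of_le (y := D₂) ⟨L₂, h5, h6⟩ (h7.trans h3)
  obtain ⟨x, hx⟩ := hL.nonempty
  exact disjoint_left.1 h4 (h7 (this (hLD.subset hx))) hx

end Bifoliation

/-! ### Conformal charts and their transition maps -/

section Charts

variable {n : ℕ} {M : Type*} [TopologicalSpace M] [ChartedSpace (EuclideanSpace ℝ (Fin n)) M]
  [IsManifold (𝓡 n) ∞ M]

/-- `φ` is a conformal chart of `(M, g)` with values in Minkowski space and conformal factor `c`. -/
structure LorentzianMetric.IsConformalChart (g : LorentzianMetric n M)
    (φ : OpenPartialHomeomorph M (EuclideanSpace ℝ (Fin n))) (c : M → ℝ) : Prop where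
  contMDiffOn : ContMDiffOn (𝓡 n) (𝓡 n) ∞ φ φ.source
  contMDiffOn_symm : ContMDiffOn (𝓡 n) (𝓡 n) ∞ φ.symm φ.target
  contMDiffOn_factor : ContMDiffOn (𝓡 n) 𝓘(ℝ, ℝ) ∞ c φ.source
  pos : ∀ x ∈ φ.source, 0 < c x
  conformal : ∀ x ∈ φ.source, ∀ v w : TangentSpace (𝓡 n) x,
    minkowskiForm (mfderiv (𝓡 n) (𝓡 n) φ x v) (mfderiv (𝓡 n) (𝓡 n) φ x w) = c x * g.val x v w

theorem LorentzianMetric.IsConformallyFlat.exists_chart {g : LorentzianMetric n M}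
    (h : g.IsConformallyFlat) (p : M) :
    ∃ (φ : OpenPartialHomeomorph M (EuclideanSpace ℝ (Fin n))) (c : M → ℝ),
      p ∈ φ.source ∧ g.IsConformalChart φ c := by
  obtain ⟨φ, c, h1, h2, h3, h4, h5⟩ := h p
  exact ⟨φ, c, h1, h2, h3, h4, fun x hx ↦ (h5 x hx).1, fun x hx ↦ (h5 x hx).2⟩

namespace LorentzianMetric.IsConformalChart

variable {g : LorentzianMetric n M} {φ ψ : OpenPartialHomeomorph M (EuclideanSpace ℝ (Fin n))}
  {c d : M → ℝ}

theorem contDiffOn_transition (hφ : g.IsConformalChart φ c) (hψ : g.IsConformalChart ψ d) :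
    ContDiffOn ℝ ∞ (φ ∘ ψ.symm) (ψ.symm.trans φ).source := by
  rw [← contMDiffOn_iff_contDiffOn]
  refine hφ.contMDiffOn.comp (hψ.contMDiffOn_symm.mono fun a ha ↦ ?_) fun a ha ↦ ?_
  · exact ha.1
  · exact ha.2

theorem conformal_transition (hφ : g.IsConformalChart φ c) (hψ : g.IsConformalChart ψ d)
    {a : EuclideanSpace ℝ (Fin n)} (ha : a ∈ (ψ.symm.trans φ).source)
    (v w : EuclideanSpace ℝ (Fin n)) :
    minkowskiForm (fderiv ℝ (φ ∘ ψ.symm) a v) (fderiv ℝ (φ ∘ ψ.symm) a w) =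
      c (ψ.symm a) / d (ψ.symm a) * minkowskiForm v w := by
  have ha1 : a ∈ ψ.target := ha.1
  have hx1 : ψ.symm a ∈ ψ.source := ψ.map_target ha1
  have hx2 : ψ.symm a ∈ φ.source := ha.2
  have hs : MDifferentiableAt (𝓡 n) (𝓡 n) ψ.symm a :=
    (hψ.contMDiffOn_symm.contMDiffAt (ψ.open_target.mem_nhds ha1)).mdifferentiableAt (by simp)
  have hφd : MDifferentiableAt (𝓡 n) (𝓡 n) φ (ψ.symm a) :=
    (hφ.contMDiffOn.contMDiffAt (φ.open_source.mem_nhds hx2)).mdifferentiableAt (by simp)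
  have hψd : MDifferentiableAt (𝓡 n) (𝓡 n) ψ (ψ.symm a) :=
    (hψ.contMDiffOn.contMDiffAt (ψ.open_source.mem_nhds hx1)).mdifferentiableAt (by simp)
  have h1 : fderiv ℝ (φ ∘ ψ.symm) a =
      (mfderiv (𝓡 n) (𝓡 n) φ (ψ.symm a)).comp (mfderiv (𝓡 n) (𝓡 n) ψ.symm a) := by
    rw [← mfderiv_eq_fderiv]
    exact mfderiv_comp a hφd hs
  have h2 : ∀ v : EuclideanSpace ℝ (Fin n),
      mfderiv (𝓡 n) (𝓡 n) ψ (ψ.symm a) (mfderiv (𝓡 n) (𝓡 n) ψ.symm a v) = v := by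
    have h3 : mfderiv (𝓡 n) (𝓡 n) (ψ ∘ ψ.symm) a =
      (mfderiv (𝓡 n) (𝓡 n) ψ (ψ.symm a)).comp (mfderiv (𝓡 n) (𝓡 n) ψ.symm a) :=
      mfderiv_comp a hψd hs
    have h4 : (ψ ∘ ψ.symm) =ᶠ[𝓝 a] id := by
      filter_upwards [ψ.open_target.mem_nhds ha1] with b hb using ψ.right_inv hb
    rw [h4.mfderiv_eq, mfderiv_id] at h3
    intro v
    exact (congrArg (fun f ↦ f v) h3).symm
  have h3 := hφ.conformal _ hx2 (mfderiv (𝓡 n) (𝓡 n) ψ.symm a v) (mfderiv (𝓡 n) (𝓡 n) ψ.symm a w)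
  have h4 := hψ.conformal _ hx1 (mfderiv (𝓡 n) (𝓡 n) ψ.symm a v) (mfderiv (𝓡 n) (𝓡 n) ψ.symm a w)
  rw [h2, h2] at h4
  have hd := (hψ.pos _ hx1).ne'
  rw [h1]
  change minkowskiForm (mfderiv (𝓡 n) (𝓡 n) φ (ψ.symm a) (mfderiv (𝓡 n) (𝓡 n) ψ.symm a v))
    (mfderiv (𝓡 n) (𝓡 n) φ (ψ.symm a) (mfderiv (𝓡 n) (𝓡 n) ψ.symm a w)) = _
  rw [h3, h4]
  field_simp

end LorentzianMetric.IsConformalChart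

end Charts

/-! ### Dimension two: null coordinates and the null foliations -/

/-- The null coordinates on the Minkowski plane. -/
noncomputable def nullCoord : EuclideanSpace ℝ (Fin 2) ≃L[ℝ] ℝ × ℝ :=
  LinearEquiv.toContinuousLinearEquiv
    { toFun := fun x ↦ (x 1 - x 0, x 1 + x 0)
      invFun := fun q ↦ !₂[(q.2 - q.1) / 2, (q.1 + q.2) / 2]
      map_add' := fun x y ↦ by ext <;> simp <;> ring
      map_smul' := fun r x ↦ by ext <;> simp <;> ring
      left_inv := fun x ↦ by
        ext i
        fin_cases i <;> simp
      right_inv := fun q ↦ by ext <;> simp <;> ring }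

theorem minkowskiForm_eq_nullCoord (x y : EuclideanSpace ℝ (Fin 2)) :
    minkowskiForm x y = ((nullCoord x).1 * (nullCoord y).2 + (nullCoord x).2 * (nullCoord y).1) / 2 := by
  change _ = ((x 1 - x 0) * (y 1 + y 0) + (x 1 + x 0) * (y 1 - y 0)) / 2
  simp [minkowskiForm, lorentzSign, Fin.sum_univ_two]
  ring

/-- The action on the plane of the group generated by `-1` and the exchange of coordinates. -/
def signedSwap (g : ℤˣ × ℤˣ) (q : ℝ × ℝ) : ℝ × ℝ :=
  if g.2 = 1 then ((g.1 : ℤ) * q.1, (g.1 : ℤ) * q.2) else ((g.1 : ℤ) * q.2, (g.1 : ℤ) * q.1)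

theorem signedSwap_mul (g h : ℤˣ × ℤˣ) (q : ℝ × ℝ) :
    signedSwap (g * h) q = signedSwap g (signedSwap h q) := by
  obtain ⟨g1, g2⟩ := g
  obtain ⟨h1, h2⟩ := h
  rcases Int.units_eq_one_or g2 with rfl | rfl <;> rcases Int.units_eq_one_or h2 with rfl | rfl <;>
    simp [signedSwap, mul_assoc]

theorem signedSwap_one (q : ℝ × ℝ) : signedSwap 1 q = q := by simp [signedSwap]

theorem continuous_signedSwap (g : ℤˣ × ℤˣ) : Continuous (signedSwap g) := by
  unfold signedSwap
  split_ifs <;> fun_prop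

/-- `signedSwap` as a homeomorphism. -/
def signedSwapHomeomorph (g : ℤˣ × ℤˣ) : (ℝ × ℝ) ≃ₜ (ℝ × ℝ) where
  toFun := signedSwap g
  invFun := signedSwap g⁻¹
  left_inv q := by rw [← signedSwap_mul, inv_mul_cancel, signedSwap_one]
  right_inv q := by rw [← signedSwap_mul, mul_inv_cancel, signedSwap_one]
  continuous_toFun := continuous_signedSwap g
  continuous_invFun := continuous_signedSwap g⁻¹

/-- Two plane-valued maps order the points near `y` in the same way, in both coordinates. -/
def OrdEq {M : Type*} [TopologicalSpace M] (y : M) (w w' : M → ℝ × ℝ) : Prop :=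
  ∀ᶠ p : M × M in 𝓝 (y, y), ((w p.1).1 < (w p.2).1 ↔ (w' p.1).1 < (w' p.2).1) ∧
    ((w p.1).2 < (w p.2).2 ↔ (w' p.1).2 < (w' p.2).2)

namespace OrdEq

variable {M : Type*} [TopologicalSpace M] {y : M} {w w' w'' : M → ℝ × ℝ}

theorem symm (h : OrdEq y w w') : OrdEq y w' w := h.mono fun _ hp ↦ ⟨hp.1.symm, hp.2.symm⟩

theorem trans (h : OrdEq y w w') (h' : OrdEq y w' w'') : OrdEq y w w'' :=
  (h.and h').mono fun _ hp ↦ ⟨hp.1.1.trans hp.2.1, hp.1.2.trans hp.2.2⟩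

/-- The comparison of pairs near `(y, y)`, rather than of points with `y` alone, is what makes the
relation open in `y`. -/
theorem eventually (h : OrdEq y w w') : ∀ᶠ z in 𝓝 y, OrdEq z w w' :=
  (Continuous.prodMk continuous_id continuous_id).continuousAt.eventually h.eventually_nhds

theorem swap_pairs (h : OrdEq y w w') : ∀ᶠ p : M × M in 𝓝 (y, y),
    ((w p.2).1 < (w p.1).1 ↔ (w' p.2).1 < (w' p.1).1) ∧
    ((w p.2).2 < (w p.1).2 ↔ (w' p.2).2 < (w' p.1).2) :=
  (continuous_swap.tendsto (y, y)).eventually h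

theorem signedSwap (g : ℤˣ × ℤˣ) (h : OrdEq y w w') :
    OrdEq y (signedSwap g ∘ w) (signedSwap g ∘ w') := by
  obtain ⟨g1, g2⟩ := g
  filter_upwards [h, h.swap_pairs] with p h1 h2
  rcases Int.units_eq_one_or g1 with rfl | rfl <;> rcases Int.units_eq_one_or g2 with rfl | rfl <;>
    simp [_root_.signedSwap, h1, h2]

/-- The increment of `w` from `y` to `x` has signs (+, 0), and the four group elements send this to
four different sign patterns. -/
theorem eq_of_signedSwap {g g' : ℤˣ × ℤˣ} (h : OrdEq y (_root_.signedSwap g ∘ w)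
      (_root_.signedSwap g' ∘ w))
    (hw : ∃ᶠ x in 𝓝 y, (w y).1 < (w x).1 ∧ (w y).2 = (w x).2) : g = g' := by
  obtain ⟨g1, g2⟩ := g
  obtain ⟨g1', g2'⟩ := g'
  have hc : Tendsto (fun x ↦ (y, x)) (𝓝 y) (𝓝 (y, y)) :=
    (Continuous.prodMk continuous_const continuous_id).tendsto y
  obtain ⟨x, ⟨hx1, hx2⟩, h1, h2⟩ := (hw.and_eventually
    ((hc.eventually h).and (hc.eventually h.swap_pairs))).exists
  rcases Int.units_eq_one_or g1 with rfl | rfl <;> rcases Int.units_eq_one_or g2 with rfl | rfl <;>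
  rcases Int.units_eq_one_or g1' with rfl | rfl <;>
  rcases Int.units_eq_one_or g2' with rfl | rfl <;>
    simp [_root_.signedSwap, hx1, hx2, hx1.not_gt] at h1 h2 ⊢

end OrdEq

/-- A function whose derivative is a multiple of fixed sign of a linear functional is ordered like
this functional. -/
theorem lt_iff_of_hasFDerivAt {E : Type*} [NormedAddCommGroup E] [NormedSpace ℝ E] {f : E → ℝ}
    {f' : E → E →L[ℝ] ℝ} {s : Set E} (hs : Convex ℝ s) (hf : ∀ x ∈ s, HasFDerivAt f (f' x) x)
    {ℓ : E →ₗ[ℝ] ℝ} {ε : ℤˣ} (h : ∀ x ∈ s, ∃ k : ℝ, 0 < ε * k ∧ ∀ w, f' x w = k * ℓ w) {y z : E}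
    (hy : y ∈ s) (hz : z ∈ s) : f y < f z ↔ (ε : ℤ) * ℓ y < (ε : ℤ) * ℓ z := by
  obtain ⟨x, hx, hxe⟩ := domain_mvt (fun x hx ↦ (hf x hx).hasFDerivWithinAt) hs hy hz
  obtain ⟨k, hk, hk'⟩ := h x (hs.segment_subset hy hz hx)
  rw [hk', map_sub] at hxe
  rcases Int.units_eq_one_or ε with rfl | rfl
  · simp only [Units.val_one, Int.cast_one, one_mul] at hk ⊢
    rw [← sub_pos, hxe, mul_pos_iff_of_pos_left hk, sub_pos]
  · simp only [Units.val_neg, Units.val_one, Int.cast_neg, Int.cast_one, neg_mul, one_mul,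
      neg_lt_neg_iff] at hk ⊢
    rw [← sub_pos, hxe, ← neg_mul_neg, mul_pos_iff_of_pos_left hk, neg_sub, sub_pos]

/-- A conformal map of the Minkowski plane permutes the null coordinates locally, up to monotone
changes of these coordinates. -/
theorem exists_signedSwap_of_conformal
    {T : EuclideanSpace ℝ (Fin 2) → EuclideanSpace ℝ (Fin 2)} {Ω : Set (EuclideanSpace ℝ (Fin 2))}
    (hΩ : IsOpen Ω) (hT : ContDiffOn ℝ ∞ T Ω) {κ : EuclideanSpace ℝ (Fin 2) → ℝ}
    (hκ : ∀ a ∈ Ω, 0 < κ a) (hconf : ∀ a ∈ Ω, ∀ v w,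
      minkowskiForm (fderiv ℝ T a v) (fderiv ℝ T a w) = κ a * minkowskiForm v w)
    {a : EuclideanSpace ℝ (Fin 2)} (ha : a ∈ Ω) :
    ∃ g, OrdEq a (nullCoord ∘ T) (signedSwap g ∘ nullCoord) := by
  set eu := nullCoord.symm (1, 0) with heu
  set ev := nullCoord.symm (0, 1) with hev
  have hdec : ∀ w, w = (nullCoord w).1 • eu + (nullCoord w).2 • ev := fun w ↦ by
    apply nullCoord.injective
    rw [map_add, map_smul, map_smul, heu, hev, nullCoord.apply_symm_apply,
      nullCoord.apply_symm_apply]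
    ext <;> simp
  set A : EuclideanSpace ℝ (Fin 2) → ℝ × ℝ := fun b ↦ nullCoord (fderiv ℝ T b eu) with hA
  set D : EuclideanSpace ℝ (Fin 2) → ℝ × ℝ := fun b ↦ nullCoord (fderiv ℝ T b ev) with hD
  have hder : ∀ b w, nullCoord (fderiv ℝ T b w) = (nullCoord w).1 • A b + (nullCoord w).2 • D b := by
    intro b w
    conv_lhs => rw [hdec w, map_add, map_smul, map_smul, map_add, map_smul, map_smul]
  -- The images of the two null directions are null, so each lies on a coordinate axis. Their
  -- pairing is positive, so they lie on different axes and have the same sign.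
  have hnull : ∀ b ∈ Ω, (A b).1 * (A b).2 = 0 ∧ (D b).1 * (D b).2 = 0 ∧
      0 < (A b).1 * (D b).2 + (A b).2 * (D b).1 := by
    intro b hb
    have h1 := hconf b hb eu eu
    have h2 := hconf b hb ev ev
    have h3 := hconf b hb eu ev
    simp only [minkowskiForm_eq_nullCoord] at h1 h2 h3
    simp only [heu, hev, nullCoord.apply_symm_apply] at h1 h2 h3
    simp only [← heu, ← hev] at h1 h2 h3
    refine ⟨?_, ?_, ?_⟩
    · simp only [hA]; linarith
    · simp only [hD]; linarith
    · have := hκ b hb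
      simp only [hA, hD]; linarith
  have hcT : ContinuousOn (fderiv ℝ T) Ω := hT.continuousOn_fderiv_of_isOpen hΩ (by simp)
  have hcT' : ContinuousAt (fderiv ℝ T) a := hcT.continuousAt (hΩ.mem_nhds ha)
  have hcA : ContinuousAt A a :=
    nullCoord.continuous.continuousAt.comp (hcT'.clm_apply continuousAt_const)
  have hcD : ContinuousAt D a :=
    nullCoord.continuous.continuousAt.comp (hcT'.clm_apply continuousAt_const)
  have hTd : ∀ b ∈ Ω, HasFDerivAt T (fderiv ℝ T b) b := fun b hb ↦
    ((hT.contDiffAt (hΩ.mem_nhds hb)).differentiableAt (by simp)).hasFDerivAt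
  set L1 : EuclideanSpace ℝ (Fin 2) →L[ℝ] ℝ :=
    (ContinuousLinearMap.fst ℝ ℝ ℝ).comp (nullCoord : EuclideanSpace ℝ (Fin 2) →L[ℝ] ℝ × ℝ) with hL1
  set L2 : EuclideanSpace ℝ (Fin 2) →L[ℝ] ℝ :=
    (ContinuousLinearMap.snd ℝ ℝ ℝ).comp (nullCoord : EuclideanSpace ℝ (Fin 2) →L[ℝ] ℝ × ℝ) with hL2
  have hf1 : ∀ b ∈ Ω, HasFDerivAt (fun x ↦ (nullCoord (T x)).1) (L1.comp (fderiv ℝ T b)) b :=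
    fun b hb ↦ L1.hasFDerivAt.comp b (hTd b hb)
  have hf2 : ∀ b ∈ Ω, HasFDerivAt (fun x ↦ (nullCoord (T x)).2) (L2.comp (fderiv ℝ T b)) b :=
    fun b hb ↦ L2.hasFDerivAt.comp b (hTd b hb)
  -- it suffices to control the two derivatives on a neighbourhood
  have key : ∀ (ℓ₁ ℓ₂ : EuclideanSpace ℝ (Fin 2) →ₗ[ℝ] ℝ) (g : ℤˣ × ℤˣ),
      (∀ x, signedSwap g (nullCoord x) = ((g.1 : ℤ) * ℓ₁ x, (g.1 : ℤ) * ℓ₂ x)) →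
      (∀ᶠ b in 𝓝 a, (∃ k : ℝ, 0 < g.1 * k ∧ ∀ w, (nullCoord (fderiv ℝ T b w)).1 = k * ℓ₁ w) ∧
        ∃ k : ℝ, 0 < g.1 * k ∧ ∀ w, (nullCoord (fderiv ℝ T b w)).2 = k * ℓ₂ w) →
      ∃ g, OrdEq a (nullCoord ∘ T) (signedSwap g ∘ nullCoord) := by
    intro ℓ₁ ℓ₂ g hg hev
    obtain ⟨δ, hδ, hball⟩ := Metric.eventually_nhds_iff_ball.1 (hev.and (hΩ.mem_nhds ha))
    refine ⟨g, ?_⟩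
    have hmem : Metric.ball a δ ×ˢ Metric.ball a δ ∈ 𝓝 (a, a) :=
      prod_mem_nhds (Metric.ball_mem_nhds a hδ) (Metric.ball_mem_nhds a hδ)
    filter_upwards [hmem] with p hp
    simp only [Function.comp_apply, hg]
    exact ⟨lt_iff_of_hasFDerivAt (convex_ball a δ) (fun x hx ↦ hf1 x (hball x hx).2)
        (fun x hx ↦ (hball x hx).1.1) hp.1 hp.2,
      lt_iff_of_hasFDerivAt (convex_ball a δ) (fun x hx ↦ hf2 x (hball x hx).2)
        (fun x hx ↦ (hball x hx).1.2) hp.1 hp.2⟩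
  have hsign : ∀ {f f' : EuclideanSpace ℝ (Fin 2) → ℝ}, ContinuousAt f a → ContinuousAt f' a →
      0 < f a * f' a → ∃ ε : ℤˣ, ∀ᶠ b in 𝓝 a, 0 < (ε : ℤ) * f b ∧ 0 < (ε : ℤ) * f' b := by
    intro f f' hf hf' h
    rcases mul_pos_iff.1 h with h | h
    · refine ⟨1, ?_⟩
      filter_upwards [hf.eventually (lt_mem_nhds h.1), hf'.eventually (lt_mem_nhds h.2)] with b h h'
      simpa using ⟨h, h'⟩
    · refine ⟨-1, ?_⟩
      filter_upwards [hf.eventually (gt_mem_nhds h.1), hf'.eventually (gt_mem_nhds h.2)] with b h h'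
      simpa using ⟨h, h'⟩
  obtain ⟨n1, n2, n3⟩ := hnull a ha
  -- The null directions are exchanged in this case and preserved in the other. The non-zero
  -- coordinates keep their sign near `a`, which forces the complementary ones to vanish there.
  by_cases hA1 : (A a).1 = 0
  · rw [hA1, zero_mul, zero_add] at n3
    obtain ⟨ε, hε⟩ := hsign hcA.snd hcD.fst n3
    refine key L2 L1 (ε, -1) (fun x ↦ by simp [signedSwap, hL1, hL2]) ?_
    filter_upwards [hε, hΩ.mem_nhds ha] with b hb hbΩ
    obtain ⟨m1, m2, -⟩ := hnull b hbΩ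
    have hA0 : (A b).1 = 0 := (mul_eq_zero.1 m1).resolve_right (by rintro h; simp [h] at hb)
    have hD0 : (D b).2 = 0 := (mul_eq_zero.1 m2).resolve_left (by rintro h; simp [h] at hb)
    refine ⟨⟨(D b).1, hb.2, fun w ↦ ?_⟩, (A b).2, hb.1, fun w ↦ ?_⟩
    · rw [hder]; simp [hA0, hL2, mul_comm]
    · rw [hder]; simp [hD0, hL1, mul_comm]
  · have hA2 := (mul_eq_zero.1 n1).resolve_left hA1
    rw [hA2, zero_mul, add_zero] at n3
    obtain ⟨ε, hε⟩ := hsign hcA.fst hcD.snd n3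
    refine key L1 L2 (ε, 1) (fun x ↦ by simp [signedSwap, hL1, hL2]) ?_
    filter_upwards [hε, hΩ.mem_nhds ha] with b hb hbΩ
    obtain ⟨m1, m2, -⟩ := hnull b hbΩ
    have hA0 : (A b).2 = 0 := (mul_eq_zero.1 m1).resolve_left (by rintro h; simp [h] at hb)
    have hD0 : (D b).1 = 0 := (mul_eq_zero.1 m2).resolve_right (by rintro h; simp [h] at hb)
    refine ⟨⟨(A b).1, hb.1, fun w ↦ ?_⟩, (D b).2, hb.2, fun w ↦ ?_⟩
    · rw [hder]; simp [hD0, hL1, mul_comm]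
    · rw [hder]; simp [hA0, hL2, mul_comm]

/-- A simply connected conformally flat Lorentzian surface is foliated by its null curves. -/
theorem LorentzianMetric.IsConformallyFlat.nonempty_bifoliation {M : Type*} [TopologicalSpace M]
    [ChartedSpace (EuclideanSpace ℝ (Fin 2)) M] [IsManifold (𝓡 2) ∞ M] [SimplyConnectedSpace M]
    [LocallyPathConnectedSpace M] {g : LorentzianMetric 2 M} (hg : g.IsConformallyFlat) :
    Nonempty (Bifoliation M) := by
  choose φ c hmem hφ using hg.exists_chart
  set w : M → M → ℝ × ℝ := fun x y ↦ nullCoord (φ x y) with hw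
  -- The ambiguity of the null coordinates, up to monotone changes, is the finite group of
  -- `signedSwap`; gluing makes the two foliations and their orientations global.
  obtain ⟨h, h1, h2⟩ := exists_primitive_of_germRel (fun x ↦ (φ x).source)
    (fun x ↦ (φ x).open_source) hmem
    (fun i j y g ↦ OrdEq y (w i) (signedSwap g ∘ w j)) (fun i j y g h ↦ h.eventually)
    (fun i j k y g g' h h' ↦ by
      refine h.trans ?_
      have := h'.signedSwap g
      simpa only [Function.comp_def, signedSwap_mul] using this)
    (fun i j y g g' hi hj h h' ↦ by
      refine (h.symm.trans h').eq_of_signedSwap ?_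
      have hy : φ j y ∈ (φ j).target := (φ j).map_source hj
      have hc : Tendsto (fun t : ℝ ↦ (φ j).symm (φ j y + t • nullCoord.symm (1, 0))) (𝓝[>] 0)
          (𝓝 y) := by
        have h3 : ContinuousAt (fun t : ℝ ↦ (φ j).symm (φ j y + t • nullCoord.symm (1, 0))) 0 := by
          refine ContinuousAt.comp (g := (φ j).symm)
            (f := fun t : ℝ ↦ φ j y + t • nullCoord.symm (1, 0)) ?_ (by fun_prop)
          simpa using (φ j).continuousAt_symm hy
        have h4 := h3.tendsto
        simp only [zero_smul, add_zero, (φ j).left_inv hj] at h4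
        exact h4.mono_left nhdsWithin_le_nhds
      refine hc.frequently (Eventually.frequently ?_)
      have h5 : ∀ᶠ t : ℝ in 𝓝[>] 0, φ j y + t • nullCoord.symm (1, 0) ∈ (φ j).target := by
        have h6 : ContinuousAt (fun t : ℝ ↦ φ j y + t • nullCoord.symm (1, 0)) 0 := by fun_prop
        have h7 : (φ j).target ∈ 𝓝 (φ j y + (0 : ℝ) • nullCoord.symm (1, 0)) := by
          simpa using (φ j).open_target.mem_nhds hy
        exact (h6.eventually h7).filter_mono nhdsWithin_le_nhds
      filter_upwards [h5, self_mem_nhdsWithin] with t ht ht0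
      simp only [hw, (φ j).right_inv ht, map_add, map_smul, nullCoord.apply_symm_apply]
      simpa using ht0)
    (fun i j y hi hj ↦ by
      have hsrc : φ j y ∈ ((φ j).symm.trans (φ i)).source := by
        rw [OpenPartialHomeomorph.trans_source]
        exact ⟨(φ j).map_source hj, by simpa [(φ j).left_inv hj] using hi⟩
      obtain ⟨g, hg⟩ := exists_signedSwap_of_conformal ((φ j).symm.trans (φ i)).open_source
        ((hφ i).contDiffOn_transition (hφ j))
        (κ := fun a ↦ c i ((φ j).symm a) / c j ((φ j).symm a))
        (fun a ha ↦ div_pos ((hφ i).pos _ ha.2) ((hφ j).pos _ ((φ j).map_target ha.1)))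
        (fun a ha v w ↦ (hφ i).conformal_transition (hφ j) ha v w) hsrc
      refine ⟨g, ?_⟩
      have hcj := (φ j).continuousAt hj
      have hsj := (φ j).open_source.mem_nhds hj
      filter_upwards [(hcj.prodMap hcj).eventually hg, prod_mem_nhds hsj hsj] with p hp hps
      simpa only [hw, Function.comp_apply, Prod.map_fst, Prod.map_snd, (φ j).left_inv hps.1,
        (φ j).left_inv hps.2] using hp)
  refine ⟨{
    u := fun x y ↦ (signedSwap (h x x)⁻¹ (w x y)).1
    v := fun x y ↦ (signedSwap (h x x)⁻¹ (w x y)).2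
    exists_chart := fun x ↦ ⟨(φ x).trans (nullCoord.toHomeomorph.trans
      (signedSwapHomeomorph (h x x)⁻¹)).toOpenPartialHomeomorph, by simpa using hmem x,
      fun y _ ↦ rfl⟩
    compat := fun x ↦ ?_ }⟩
  filter_upwards [h1 x x (hmem x), (φ x).open_source.mem_nhds (hmem x)] with y hy hys
  have h3 := (h2 x y y hys (hmem y)).signedSwap (h x x)⁻¹
  rw [hy] at h3
  have h4 : OrdEq y (signedSwap (h x x)⁻¹ ∘ w x) (signedSwap (h y y)⁻¹ ∘ w y) := by
    simpa only [Function.comp_def, ← signedSwap_mul, inv_mul_cancel_left] using h3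
  have hc : Tendsto (fun x ↦ (y, x)) (𝓝 y) (𝓝 (y, y)) :=
    (Continuous.prodMk continuous_const continuous_id).tendsto y
  filter_upwards [hc.eventually h4, hc.eventually h4.swap_pairs] with z hz hz'
  exact ⟨⟨hz.1, hz'.1⟩, hz.2, hz'.2⟩

/-! ### The null cone model of Minkowski space -/

section Forms

variable {n : ℕ}

/-- The Minkowski form as a continuous bilinear form. -/
noncomputable def minkowskiBilin (n : ℕ) :
    EuclideanSpace ℝ (Fin n) →L[ℝ] EuclideanSpace ℝ (Fin n) →L[ℝ] ℝ :=
  LinearMap.toContinuousLinearMap (LinearMap.toContinuousLinearMap.toLinearMap ∘ₗ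
    LinearMap.mk₂ ℝ minkowskiForm
      (fun x y z ↦ by simp [minkowskiForm, ← Finset.sum_add_distrib, add_mul, mul_add])
      (fun r x y ↦ by
        simp only [minkowskiForm, PiLp.smul_apply, smul_eq_mul, Finset.mul_sum]
        exact Finset.sum_congr rfl fun i _ ↦ by ring)
      (fun x y z ↦ by simp [minkowskiForm, ← Finset.sum_add_distrib, mul_add])
      (fun r x y ↦ by
        simp only [minkowskiForm, PiLp.smul_apply, smul_eq_mul, Finset.mul_sum]
        exact Finset.sum_congr rfl fun i _ ↦ by ring))

theorem minkowskiBilin_apply (x y : EuclideanSpace ℝ (Fin n)) :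
    minkowskiBilin n x y = minkowskiForm x y := rfl

theorem minkowskiForm_comm (x y : EuclideanSpace ℝ (Fin n)) :
    minkowskiForm x y = minkowskiForm y x :=
  Finset.sum_congr rfl fun i _ ↦ by ring

theorem minkowskiBilin_single (x : EuclideanSpace ℝ (Fin n)) (i : Fin n) :
    minkowskiBilin n x (EuclideanSpace.single i 1) = lorentzSign i * x i := by
  simp [minkowskiBilin_apply, minkowskiForm]

theorem lorentzSign_mul_self (i : Fin n) : lorentzSign i * lorentzSign i = 1 := by
  unfold lorentzSign
  split_ifs <;> norm_num

theorem lorentzSign_ne_zero (i : Fin n) : lorentzSign i ≠ 0 :=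
  left_ne_zero_of_mul_eq_one (lorentzSign_mul_self i)

theorem eq_zero_of_minkowskiBilin {x : EuclideanSpace ℝ (Fin n)}
    (h : ∀ y, minkowskiBilin n x y = 0) : x = 0 := by
  ext i
  have := h (EuclideanSpace.single i 1)
  rw [minkowskiBilin_single] at this
  exact (mul_eq_zero.1 this).resolve_left (lorentzSign_ne_zero i)

/-- The vector space of signature `(2, n)` whose null cone compactifies Minkowski space. -/
abbrev ConeSpace (n : ℕ) : Type := ℝ × EuclideanSpace ℝ (Fin n) × ℝ

/-- The form of signature `(2, n)` on `ConeSpace n`. -/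
noncomputable def coneForm (n : ℕ) : ConeSpace n →L[ℝ] ConeSpace n →L[ℝ] ℝ :=
  LinearMap.toContinuousLinearMap (LinearMap.toContinuousLinearMap.toLinearMap ∘ₗ
    LinearMap.mk₂ ℝ (fun v w ↦ minkowskiBilin n v.2.1 w.2.1 - v.1 * w.2.2 - v.2.2 * w.1)
      (fun x y z ↦ by simp; ring) (fun r x y ↦ by simp; ring)
      (fun x y z ↦ by simp; ring) (fun r x y ↦ by simp; ring))

theorem coneForm_apply (v w : ConeSpace n) :
    coneForm n v w = minkowskiBilin n v.2.1 w.2.1 - v.1 * w.2.2 - v.2.2 * w.1 := rfl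

theorem coneForm_comm (v w : ConeSpace n) : coneForm n v w = coneForm n w v := by
  rw [coneForm_apply, coneForm_apply, minkowskiBilin_apply, minkowskiBilin_apply,
    minkowskiForm_comm]
  ring

theorem eq_zero_of_coneForm {v : ConeSpace n} (h : ∀ w, coneForm n v w = 0) : v = 0 := by
  have h1 := h (1, 0, 0)
  have h2 := h (0, 0, 1)
  have h3 : ∀ y, minkowskiBilin n v.2.1 y = 0 := fun y ↦ by simpa [coneForm_apply] using h (0, y, 0)
  simp [coneForm_apply] at h1 h2
  exact Prod.ext h2 (Prod.ext (eq_zero_of_minkowskiBilin h3) h1)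

/-- The embedding of Minkowski space into the null cone. -/
noncomputable def coneEmb {n : ℕ} (x : EuclideanSpace ℝ (Fin n)) : ConeSpace n :=
  (1, x, minkowskiBilin n x x / 2)

theorem coneForm_coneEmb (x : EuclideanSpace ℝ (Fin n)) : coneForm n (coneEmb x) (coneEmb x) = 0 := by
  simp [coneForm_apply, coneEmb]
  ring

theorem minkowskiBilin_comm (x y : EuclideanSpace ℝ (Fin n)) :
    minkowskiBilin n x y = minkowskiBilin n y x := minkowskiForm_comm x y

theorem hasFDerivAt_coneEmb (x : EuclideanSpace ℝ (Fin n)) :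
    HasFDerivAt coneEmb ((0 : EuclideanSpace ℝ (Fin n) →L[ℝ] ℝ).prod
      ((ContinuousLinearMap.id ℝ _).prod (minkowskiBilin n x))) x := by
  refine (hasFDerivAt_const _ _).prodMk ((hasFDerivAt_id x).prodMk ?_)
  have h := ((minkowskiBilin n).hasFDerivAt (x := x)).clm_apply (hasFDerivAt_id x)
  have h' : HasFDerivAt (fun y ↦ minkowskiBilin n y y / 2) _ x :=
    (h.mul_const (2⁻¹ : ℝ)).congr_of_eventuallyEq (Eventually.of_forall fun y ↦ div_eq_mul_inv _ _)
  refine h'.congr_fderiv ?_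
  ext v
  simp [minkowskiBilin_comm v x]
  ring

theorem contDiff_coneEmb : ContDiff ℝ ∞ (coneEmb (n := n)) := by
  unfold coneEmb
  refine contDiff_const.prodMk (contDiff_id.prodMk ?_)
  exact (((minkowskiBilin n).contDiff.comp contDiff_id).clm_apply contDiff_id).div_const _

/-- The orthogonal of the tangent space of the null cone along the embedding is the null line. -/
theorem eq_smul_coneEmb {w : ConeSpace n} {x : EuclideanSpace ℝ (Fin n)}
    (h0 : coneForm n w (coneEmb x) = 0)
    (h1 : ∀ y, coneForm n w (0, y, minkowskiBilin n x y) = 0) : w = w.1 • coneEmb x := by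
  have h2 : w.2.1 - w.1 • x = 0 := eq_zero_of_minkowskiBilin fun y ↦ by
    have := h1 y
    simp only [coneForm_apply, mul_zero, sub_zero] at this
    simpa using this
  have h3 : w.2.1 = w.1 • x := sub_eq_zero.1 h2
  simp only [coneForm_apply, coneEmb, h3, map_smul, _root_.smul_apply, smul_eq_mul,
    mul_one] at h0
  refine Prod.ext (by simp [coneEmb]) (Prod.ext (by simp [coneEmb, h3]) ?_)
  simp only [coneEmb, smul_eq_mul, Prod.smul_snd]
  linarith

end Forms

/-! ### Partial derivatives -/

section Partial

variable {n : ℕ} {V : Type*} [NormedAddCommGroup V] [NormedSpace ℝ V]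

/-- The `i`-th partial derivative. -/
noncomputable def partialD (i : Fin n) (f : EuclideanSpace ℝ (Fin n) → V) :
    EuclideanSpace ℝ (Fin n) → V :=
  fun x ↦ fderiv ℝ f x (EuclideanSpace.single i 1)

variable {Ω : Set (EuclideanSpace ℝ (Fin n))} {f : EuclideanSpace ℝ (Fin n) → V}

theorem ContDiffOn.partialD (hΩ : IsOpen Ω) (hf : ContDiffOn ℝ ∞ f Ω) (i : Fin n) :
    ContDiffOn ℝ ∞ (partialD i f) Ω :=
  (hf.fderiv_of_isOpen hΩ (by simp)).clm_apply contDiffOn_const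

theorem partialD_comm (hΩ : IsOpen Ω) (hf : ContDiffOn ℝ ∞ f Ω) (i j : Fin n)
    {x : EuclideanSpace ℝ (Fin n)} (hx : x ∈ Ω) :
    partialD i (partialD j f) x = partialD j (partialD i f) x := by
  have h1 : ContDiffAt ℝ ∞ f x := hf.contDiffAt (hΩ.mem_nhds hx)
  have h2 : DifferentiableAt ℝ (fderiv ℝ f) x :=
    ((hf.fderiv_of_isOpen (m := ∞) hΩ (by simp)).contDiffAt (hΩ.mem_nhds hx)).differentiableAt
      (by simp)
  have h3 : ∀ i j, partialD i (partialD j f) x =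
      fderiv ℝ (fderiv ℝ f) x (EuclideanSpace.single i 1) (EuclideanSpace.single j 1) := by
    intro i j
    unfold partialD
    rw [fderiv_clm_apply h2 (differentiableAt_const _)]
    simp
  rw [h3, h3]
  exact (h1.isSymmSndFDerivAt (by simpa using ENat.LEInfty.out)).eq _ _

theorem eq_zero_of_apply_single {L : EuclideanSpace ℝ (Fin n) →L[ℝ] V}
    (h : ∀ i, L (EuclideanSpace.single i 1) = 0) : L = 0 := by
  ext v
  have hv := (EuclideanSpace.basisFun (Fin n) ℝ).sum_repr v
  rw [← hv, map_sum]
  simp [h]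

theorem eq_of_partialD_eq_zero {x₀ : EuclideanSpace ℝ (Fin n)} {r : ℝ}
    (hf : ∀ x ∈ Metric.ball x₀ r, DifferentiableAt ℝ f x)
    (h : ∀ x ∈ Metric.ball x₀ r, ∀ i, partialD i f x = 0) {x : EuclideanSpace ℝ (Fin n)}
    (hx : x ∈ Metric.ball x₀ r) : f x = f x₀ := by
  have hr : 0 < r := Metric.pos_of_mem_ball hx
  refine (convex_ball x₀ r).is_const_of_fderivWithin_eq_zero (𝕜 := ℝ)
    (fun y hy ↦ (hf y hy).differentiableWithinAt) (fun y hy ↦ ?_) hx (Metric.mem_ball_self hr)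
  rw [fderivWithin_of_isOpen Metric.isOpen_ball hy]
  exact eq_zero_of_apply_single (h y hy)

/-- The structure equations of an immersion into the cone all come from differentiating constant
pairings in this way. -/
theorem partialD_bilin_const {W : Type*} [NormedAddCommGroup W] [NormedSpace ℝ W]
    (Q : V →L[ℝ] W →L[ℝ] ℝ) {g : EuclideanSpace ℝ (Fin n) → W} (hΩ : IsOpen Ω)
    (hf : ContDiffOn ℝ ∞ f Ω) (hg : ContDiffOn ℝ ∞ g Ω) {c : ℝ} (h : ∀ x ∈ Ω, Q (f x) (g x) = c)
    (i : Fin n) {x : EuclideanSpace ℝ (Fin n)} (hx : x ∈ Ω) :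
    Q (partialD i f x) (g x) + Q (f x) (partialD i g x) = 0 := by
  have hf' : HasFDerivAt f (fderiv ℝ f x) x :=
    ((hf.contDiffAt (hΩ.mem_nhds hx)).differentiableAt (by simp)).hasFDerivAt
  have hg' : HasFDerivAt g (fderiv ℝ g x) x :=
    ((hg.contDiffAt (hΩ.mem_nhds hx)).differentiableAt (by simp)).hasFDerivAt
  have h1 := (Q.hasFDerivAt.comp x hf').clm_apply hg'
  have h2 : HasFDerivAt (fun y ↦ Q (f y) (g y)) (0 : EuclideanSpace ℝ (Fin n) →L[ℝ] ℝ) x := by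
    refine (hasFDerivAt_const c x).congr_of_eventuallyEq ?_
    filter_upwards [hΩ.mem_nhds hx] with y hy using h y hy
  have h3 := congrArg (fun L ↦ L (EuclideanSpace.single i 1)) (h1.unique h2)
  simp only [Function.comp_apply, _root_.add_apply, ContinuousLinearMap.comp_apply,
    ContinuousLinearMap.flip_apply, _root_.zero_apply] at h3
  rw [add_comm]
  exact h3

end Partial

/-- Two distinct indices leave room for a third one. -/
theorem exists_third_index {n : ℕ} (hn : 3 ≤ n) (i j : Fin n) : ∃ k, k ≠ i ∧ k ≠ j := by
  have h : ({i, j} : Finset (Fin n)).card < (Finset.univ : Finset (Fin n)).card := by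
    rw [Finset.card_univ, Fintype.card_fin]
    exact (Finset.card_le_two).trans_lt hn
  obtain ⟨k, -, hk⟩ := Finset.exists_mem_notMem_of_card_lt_card h
  simp only [Finset.mem_insert, Finset.mem_singleton, not_or] at hk
  exact ⟨k, hk⟩

/-! ### Flat immersions into the null cone -/

section Flat

variable {n : ℕ} {Ω : Set (EuclideanSpace ℝ (Fin n))} {X : EuclideanSpace ℝ (Fin n) → ConeSpace n}

/-- The second derivative of an isometric immersion of flat space into the null cone is the metric
times one vector, which is null and is orthogonal to the first derivatives. -/
theorem partialD_partialD_of_flat (hn : 3 ≤ n) (hΩ : IsOpen Ω) (hX : ContDiffOn ℝ ∞ X Ω)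
    (hnull : ∀ x ∈ Ω, coneForm n (X x) (X x) = 0)
    (hmetric : ∀ x ∈ Ω, ∀ i j, coneForm n (partialD i X x) (partialD j X x) =
      if i = j then lorentzSign i else 0)
    (hperp : ∀ x ∈ Ω, ∀ w, coneForm n w (X x) = 0 → (∀ k, coneForm n w (partialD k X x) = 0) →
      ∃ m : ℝ, w = m • X x) :
    ∃ N : EuclideanSpace ℝ (Fin n) → ConeSpace n, ContDiffOn ℝ ∞ N Ω ∧ ∀ x ∈ Ω,
      (∀ i j, partialD i (partialD j X) x = (if i = j then lorentzSign i else 0) • N x) ∧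
      (∀ k, partialD k N x = 0) ∧ (∀ k, coneForm n (X x) (partialD k X x) = 0) ∧
      coneForm n (X x) (N x) = -1 ∧ (∀ k, coneForm n (partialD k X x) (N x) = 0) ∧
      coneForm n (N x) (N x) = 0 := by
  set Q := coneForm n with hQ
  have hX1 : ∀ i, ContDiffOn ℝ ∞ (partialD i X) Ω := fun i ↦ hX.partialD hΩ i
  have hX2 : ∀ i j, ContDiffOn ℝ ∞ (partialD i (partialD j X)) Ω := fun i j ↦
    (hX1 j).partialD hΩ i
  have c2 : ∀ x ∈ Ω, ∀ i j, partialD i (partialD j X) x = partialD j (partialD i X) x :=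
    fun x hx i j ↦ partialD_comm hΩ hX i j hx
  have e1 : ∀ x ∈ Ω, ∀ k, Q (X x) (partialD k X x) = 0 := fun x hx k ↦ by
    have := partialD_bilin_const Q hΩ hX hX hnull k hx
    rw [coneForm_comm] at this
    linarith
  have e2 : ∀ x ∈ Ω, ∀ i j, Q (partialD i (partialD j X) x) (X x) =
      -(if i = j then lorentzSign i else 0) := fun x hx i j ↦ by
    have := partialD_bilin_const Q hΩ hX (hX1 j) (fun x hx ↦ e1 x hx j) i hx
    rw [hmetric x hx, coneForm_comm (X x)] at this
    linarith
  -- As for the Levi-Civita connection: an expression symmetric in two of its indices and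
  -- antisymmetric in another two vanishes.
  have e3 : ∀ x ∈ Ω, ∀ i j k, Q (partialD i (partialD j X) x) (partialD k X x) = 0 := by
    intro x hx
    have h : ∀ k i j, Q (partialD k (partialD i X) x) (partialD j X x) =
        -Q (partialD k (partialD j X) x) (partialD i X x) := fun k i j ↦ by
      have := partialD_bilin_const Q hΩ (hX1 i) (hX1 j) (fun x hx ↦ hmetric x hx i j) k hx
      rw [coneForm_comm (partialD i X x)] at this
      linarith
    intro i j k
    have h1 := h i j k
    rw [c2 x hx i k, h k i j, c2 x hx k j, h j k i, c2 x hx j i] at h1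
    linarith
  -- The Gauss equation of a flat metric: `e3` is differentiated, and the third derivatives cancel
  -- by symmetry.
  have e4 : ∀ x ∈ Ω, ∀ i j k l, Q (partialD i (partialD j X) x) (partialD k (partialD l X) x) =
      Q (partialD k (partialD j X) x) (partialD i (partialD l X) x) := by
    intro x hx i j k l
    have h1 := partialD_bilin_const Q hΩ (hX2 i j) (hX1 l) (fun x hx ↦ e3 x hx i j l) k hx
    have h2 := partialD_bilin_const Q hΩ (hX2 k j) (hX1 l) (fun x hx ↦ e3 x hx k j l) i hx
    rw [partialD_comm hΩ (hX1 j) k i hx] at h1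
    linarith
  -- By `e2`, `e3` and `hperp` the mixed derivatives are multiples of `X`. The Gauss equation with a
  -- third index `k` turns the pairing of one of them with `∂ₖ∂ₖX` into a multiple of `⟨X, X⟩ = 0`,
  -- while `⟨X, ∂ₖ∂ₖX⟩` is not zero.
  have e5 : ∀ x ∈ Ω, ∀ i j, i ≠ j → partialD i (partialD j X) x = 0 := by
    intro x hx i j hij
    have hm : ∀ i j, i ≠ j → ∃ m : ℝ, partialD i (partialD j X) x = m • X x := fun i j hij ↦
      hperp x hx _ (by rw [e2 x hx, if_neg hij, neg_zero]) fun k ↦ e3 x hx i j k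
    obtain ⟨k, hki, hkj⟩ := exists_third_index hn i j
    obtain ⟨m, hm1⟩ := hm i j hij
    obtain ⟨m', hm2⟩ := hm k j hkj
    obtain ⟨m'', hm3⟩ := hm i k hki.symm
    have h := e4 x hx i j k k
    rw [hm1, hm2, hm3] at h
    have h2 : Q (X x) (partialD k (partialD k X) x) = -lorentzSign k := by
      rw [hQ, coneForm_comm, ← hQ, e2 x hx, if_pos rfl]
    simp only [map_smul, _root_.smul_apply, smul_eq_mul, h2, hnull x hx, mul_zero] at h
    have h3 : m = 0 := by
      have := lorentzSign_ne_zero k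
      simpa [this] using h
    rw [hm1, h3, zero_smul]
  have e6 : ∀ x ∈ Ω, ∀ i k, i ≠ k →
      Q (partialD i (partialD i X) x) (partialD k (partialD k X) x) = 0 := fun x hx i k hik ↦ by
    rw [e4 x hx, e5 x hx k i hik.symm, map_zero, _root_.zero_apply]
  have e7 : ∀ x ∈ Ω, ∀ i j,
      lorentzSign j • partialD i (partialD i X) x = lorentzSign i • partialD j (partialD j X) x := by
    intro x hx i j
    rcases eq_or_ne i j with rfl | hij
    · rfl
    obtain ⟨m, hm⟩ := hperp x hx
      (lorentzSign j • partialD i (partialD i X) x - lorentzSign i • partialD j (partialD j X) x)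
      (by simp only [map_sub, map_smul, _root_.sub_apply, _root_.smul_apply, smul_eq_mul,
            e2 x hx, if_true]; ring)
      (fun k ↦ by simp only [map_sub, map_smul, _root_.sub_apply, _root_.smul_apply, smul_eq_mul,
            e3 x hx]; ring)
    obtain ⟨k, hki, hkj⟩ := exists_third_index hn i j
    have h := congrArg (fun w ↦ Q w (partialD k (partialD k X) x)) hm
    have h2 : Q (X x) (partialD k (partialD k X) x) = -lorentzSign k := by
      rw [hQ, coneForm_comm, ← hQ, e2 x hx, if_pos rfl]
    simp only [map_sub, map_smul, _root_.sub_apply, _root_.smul_apply, smul_eq_mul,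
      e6 x hx i k hki.symm, e6 x hx j k hkj.symm, h2, mul_zero, sub_zero] at h
    have h3 : m = 0 := by
      have := lorentzSign_ne_zero k
      simpa [this] using h.symm
    rw [← sub_eq_zero, hm, h3, zero_smul]
  obtain ⟨o⟩ : Nonempty (Fin n) := ⟨⟨0, by omega⟩⟩
  set N : EuclideanSpace ℝ (Fin n) → ConeSpace n :=
    fun x ↦ lorentzSign o • partialD o (partialD o X) x with hN
  have hNj : ∀ j, ∀ x ∈ Ω, N x = lorentzSign j • partialD j (partialD j X) x := by
    intro j x hx
    have h := congrArg (fun w ↦ (lorentzSign o * lorentzSign j) • w) (e7 x hx o j)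
    simp only [smul_smul] at h
    have hj := lorentzSign_mul_self j
    have ho := lorentzSign_mul_self o
    rw [mul_assoc, hj, mul_one, mul_right_comm, ho, one_mul] at h
    exact h
  have hNs : ContDiffOn ℝ ∞ N Ω := (hX2 o o).const_smul _
  refine ⟨N, hNs, fun x hx ↦ ⟨fun i j ↦ ?_, fun k ↦ ?_, e1 x hx, ?_, fun k ↦ ?_, ?_⟩⟩
  · by_cases hij : i = j
    · subst hij
      rw [if_pos rfl, hNj i x hx, smul_smul, lorentzSign_mul_self, one_smul]
    · rw [if_neg hij, zero_smul, e5 x hx i j hij]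
  -- With `N` written as `± ∂ⱼ∂ⱼX` for some `j ≠ k`, its derivative is `± ∂ⱼ(∂ₖ∂ⱼX)`, and mixed
  -- derivatives vanish.
  · obtain ⟨j, hjk, -⟩ := exists_third_index hn k k
    have h1 : N =ᶠ[𝓝 x] fun y ↦ lorentzSign j • partialD j (partialD j X) y := by
      filter_upwards [hΩ.mem_nhds hx] with y hy using hNj j y hy
    have h2 : partialD k (partialD j X) =ᶠ[𝓝 x] fun _ ↦ 0 := by
      filter_upwards [hΩ.mem_nhds hx] with y hy using e5 y hy k j hjk.symm
    have h3 : DifferentiableAt ℝ (partialD j (partialD j X)) x :=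
      ((hX2 j j).contDiffAt (hΩ.mem_nhds hx)).differentiableAt (by simp)
    have h4 : partialD k N x = lorentzSign j • partialD k (partialD j (partialD j X)) x := by
      unfold partialD at h1 h3 ⊢
      rw [h1.fderiv_eq, fderiv_fun_const_smul h3]
      rfl
    rw [h4, partialD_comm hΩ (hX1 j) k j hx]
    have h5 : partialD j (partialD k (partialD j X)) x = 0 := by
      change fderiv ℝ (partialD k (partialD j X)) x _ = 0
      rw [h2.fderiv_eq]
      simp
    rw [h5, smul_zero]
  · rw [hQ, coneForm_comm, ← hQ, hN]
    simp only [map_smul, _root_.smul_apply, smul_eq_mul, e2 x hx, ↓reduceIte]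
    linarith [lorentzSign_mul_self o]
  · rw [hQ, coneForm_comm, ← hQ, hN]
    simp only [map_smul, _root_.smul_apply, smul_eq_mul, e3 x hx, mul_zero]
  · obtain ⟨j, hj, -⟩ := exists_third_index hn o o
    have : Q (N x) (N x) = Q (lorentzSign o • partialD o (partialD o X) x)
      (lorentzSign j • partialD j (partialD j X) x) := by rw [← hNj j x hx]
    rw [this]
    simp only [map_smul, _root_.smul_apply, smul_eq_mul, e6 x hx o j hj.symm, mul_zero]

/-- Liouville's theorem: an isometric immersion of flat space into the null cone coincides locally
with the standard one, up to a linear isometry. -/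
theorem exists_isometry_of_flat (hn : 3 ≤ n) (hΩ : IsOpen Ω) (hX : ContDiffOn ℝ ∞ X Ω)
    (hnull : ∀ x ∈ Ω, coneForm n (X x) (X x) = 0)
    (hmetric : ∀ x ∈ Ω, ∀ i j, coneForm n (partialD i X x) (partialD j X x) =
      if i = j then lorentzSign i else 0)
    (hperp : ∀ x ∈ Ω, ∀ w, coneForm n w (X x) = 0 → (∀ k, coneForm n w (partialD k X x) = 0) →
      ∃ m : ℝ, w = m • X x) {x₀ : EuclideanSpace ℝ (Fin n)} (hx₀ : x₀ ∈ Ω) :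
    ∃ A : ConeSpace n →ₗ[ℝ] ConeSpace n, (∀ v w, coneForm n (A v) (A w) = coneForm n v w) ∧
      ∀ᶠ x in 𝓝 x₀, X x = A (coneEmb x) := by
  obtain ⟨N, hN, h⟩ := partialD_partialD_of_flat hn hΩ hX hnull hmetric hperp
  obtain ⟨-, -, g1, g2, g3, g4⟩ := h x₀ hx₀
  -- `v.1`, `z v`, `s v` are the coordinates of `v` in the frame `coneEmb x₀`, `(0, eᵢ, ⟨x₀, eᵢ⟩)`,
  -- `(0, 0, 1)`. The map `A` sends this frame to `X`, `∂ᵢX`, `N` at `x₀`, which have the same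
  -- pairings.
  set z : ConeSpace n → EuclideanSpace ℝ (Fin n) := fun v ↦ v.2.1 - v.1 • x₀ with hz
  set s : ConeSpace n → ℝ := fun v ↦ v.2.2 - minkowskiBilin n x₀ v.2.1 +
    v.1 * (minkowskiBilin n x₀ x₀ / 2) with hs
  set A : ConeSpace n →ₗ[ℝ] ConeSpace n :=
    { toFun := fun v ↦ v.1 • X x₀ + ∑ i, z v i • partialD i X x₀ + s v • N x₀
      map_add' := fun v w ↦ by
        have h1 : ∀ i, z (v + w) i = z v i + z w i := fun i ↦ by simp [hz]; ring
        have h2 : s (v + w) = s v + s w := by simp [hs]; ring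
        simp only [h1, h2, add_smul, Finset.sum_add_distrib, Prod.fst_add]
        abel
      map_smul' := fun r v ↦ by
        have h1 : ∀ i, z (r • v) i = r * z v i := fun i ↦ by simp [hz]; ring
        have h2 : s (r • v) = r * s v := by simp [hs]; ring
        simp only [h1, h2, smul_add, Finset.smul_sum, smul_smul, Prod.smul_fst, smul_eq_mul,
          RingHom.id_apply] } with hA
  have hAv : ∀ v, A v = v.1 • X x₀ + ∑ i, z v i • partialD i X x₀ + s v • N x₀ := fun _ ↦ rfl
  refine ⟨A, fun v w ↦ ?_, ?_⟩
  · have g1' : ∀ k, coneForm n (partialD k X x₀) (X x₀) = 0 := fun k ↦ by rw [coneForm_comm, g1]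
    have g2' : coneForm n (N x₀) (X x₀) = -1 := by rw [coneForm_comm, g2]
    have g3' : ∀ k, coneForm n (N x₀) (partialD k X x₀) = 0 := fun k ↦ by rw [coneForm_comm, g3]
    have h1 : coneForm n (A v) (A w) = minkowskiBilin n (z v) (z w) - v.1 * s w - s v * w.1 := by
      rw [hAv, hAv]
      simp only [map_add, map_smul, map_sum, _root_.add_apply, _root_.smul_apply,
        _root_.sum_apply, smul_eq_mul, hnull x₀ hx₀, g1, g1', g2, g2', g3, g3', g4,
        hmetric x₀ hx₀, mul_zero, Finset.sum_const_zero, add_zero, zero_add, mul_ite,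
        Finset.sum_ite_eq', Finset.mem_univ, if_true]
      rw [minkowskiBilin_apply]
      unfold minkowskiForm
      have : ∀ i, lorentzSign i * (z v i * z w i) = z w i * (z v i * lorentzSign i) := fun i ↦ by ring
      simp only [this]
      ring
    rw [h1, coneForm_apply]
    simp only [hz, hs, map_sub, map_smul, _root_.sub_apply, _root_.smul_apply, smul_eq_mul]
    rw [minkowskiBilin_comm v.2.1 x₀]
    ring
  -- On a ball `N` is constant, so `X` and `A ∘ coneEmb` solve the same second order system with the
  -- same value and first derivatives at `x₀`.
  · obtain ⟨r, hr, hball⟩ := Metric.isOpen_iff.1 hΩ x₀ hx₀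
    have hXd : ∀ x ∈ Ω, DifferentiableAt ℝ X x := fun x hx ↦
      (hX.contDiffAt (hΩ.mem_nhds hx)).differentiableAt (by simp)
    have hNc : ∀ x ∈ Metric.ball x₀ r, N x = N x₀ := fun x hx ↦
      eq_of_partialD_eq_zero (fun y hy ↦ (hN.contDiffAt (hΩ.mem_nhds (hball hy))).differentiableAt
        (by simp)) (fun y hy ↦ (h y (hball hy)).2.1) hx
    -- first derivatives are affine
    have hlin : ∀ (j : Fin n) (x : EuclideanSpace ℝ (Fin n)),
        HasFDerivAt (fun y : EuclideanSpace ℝ (Fin n) ↦ (lorentzSign j * (y j - x₀ j)) • N x₀)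
        ((lorentzSign j • (EuclideanSpace.proj j : EuclideanSpace ℝ (Fin n) →L[ℝ] ℝ)).smulRight
          (N x₀)) x := fun j x ↦ by
      refine HasFDerivAt.smul_const ?_ (N x₀)
      exact (((EuclideanSpace.proj j : EuclideanSpace ℝ (Fin n) →L[ℝ] ℝ).hasFDerivAt).sub_const
        _).const_mul _
    have hfirst : ∀ j, ∀ x ∈ Metric.ball x₀ r,
        partialD j X x = partialD j X x₀ + (lorentzSign j * (x j - x₀ j)) • N x₀ := by
      intro j x hx
      have hd : ∀ y ∈ Ω, DifferentiableAt ℝ (partialD j X) y := fun y hy ↦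
        ((hX.partialD hΩ j).contDiffAt (hΩ.mem_nhds hy)).differentiableAt (by simp)
      have := eq_of_partialD_eq_zero (n := n)
        (f := fun y ↦ partialD j X y - (lorentzSign j * (y j - x₀ j)) • N x₀)
        (fun y hy ↦ (hd y (hball hy)).sub (hlin j y).differentiableAt) (fun y hy i ↦ by
          have h1 := ((hd y (hball hy)).hasFDerivAt.sub (hlin j y)).fderiv
          change fderiv ℝ _ y _ = 0
          have h2 := (h y (hball hy)).1 i j
          rw [hNc y hy] at h2
          erw [h1]
          rw [_root_.sub_apply]
          change partialD i (partialD j X) y - _ = 0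
          rw [h2]
          by_cases hij : i = j
          · subst hij; simp
          · simp [hij, Ne.symm hij]) hx
      simp only [sub_self, mul_zero, zero_smul, sub_zero] at this
      rw [← this]
      abel
    have hAe : ∀ x, A (coneEmb x) = X x₀ + ∑ i, (x i - x₀ i) • partialD i X x₀ +
        (minkowskiBilin n (x - x₀) (x - x₀) / 2) • N x₀ := fun x ↦ by
      rw [hAv]
      have h2 : s (coneEmb x) = minkowskiBilin n (x - x₀) (x - x₀) / 2 := by
        simp only [hs, coneEmb, map_sub, _root_.sub_apply]
        rw [minkowskiBilin_comm x x₀]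
        ring
      rw [h2]
      simp [hz, coneEmb]
    have hAd : ∀ x, HasFDerivAt (fun y ↦ A (coneEmb y))
        (A.toContinuousLinearMap.comp ((0 : EuclideanSpace ℝ (Fin n) →L[ℝ] ℝ).prod
          ((ContinuousLinearMap.id ℝ _).prod (minkowskiBilin n x)))) x := fun x ↦
      A.toContinuousLinearMap.hasFDerivAt.comp x (hasFDerivAt_coneEmb x)
    filter_upwards [Metric.ball_mem_nhds x₀ hr] with x hx
    have := eq_of_partialD_eq_zero (n := n) (f := fun y ↦ X y - A (coneEmb y))
      (fun y hy ↦ (hXd y (hball hy)).sub (hAd y).differentiableAt) (fun y hy j ↦ by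
        have h1 := ((hXd y (hball hy)).hasFDerivAt.sub (hAd y)).fderiv
        change fderiv ℝ _ y _ = 0
        erw [h1]
        rw [_root_.sub_apply]
        change partialD j X y - A (0, EuclideanSpace.single j 1, minkowskiBilin n y
          (EuclideanSpace.single j 1)) = 0
        rw [hfirst j y hy, hAv]
        have h2 : s (0, EuclideanSpace.single j 1, minkowskiBilin n y (EuclideanSpace.single j 1)) =
            lorentzSign j * (y j - x₀ j) := by
          simp only [hs, minkowskiBilin_single]
          ring
        rw [h2]
        simp [hz]) hx
    rw [sub_eq_iff_eq_add] at this
    rw [this, hAe x₀]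
    simp

end Flat

/-! ### Liouville's theorem for conformal maps -/

section Liouville

variable {n : ℕ}

/-- The rescaled image of a conformal map in the null cone differs locally from the standard
embedding by a linear isometry. -/
theorem exists_isometry_of_conformal (hn : 3 ≤ n) {Ω : Set (EuclideanSpace ℝ (Fin n))}
    (hΩ : IsOpen Ω) {T : EuclideanSpace ℝ (Fin n) → EuclideanSpace ℝ (Fin n)}
    (hT : ContDiffOn ℝ ∞ T Ω) {κ : EuclideanSpace ℝ (Fin n) → ℝ} (hκ : ContDiffOn ℝ ∞ κ Ω)
    (hpos : ∀ a ∈ Ω, 0 < κ a)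
    (hconf : ∀ a ∈ Ω, ∀ v w, minkowskiForm (fderiv ℝ T a v) (fderiv ℝ T a w) =
      κ a * minkowskiForm v w) {x₀ : EuclideanSpace ℝ (Fin n)} (hx₀ : x₀ ∈ Ω) :
    ∃ A : ConeSpace n →ₗ[ℝ] ConeSpace n, (∀ v w, coneForm n (A v) (A w) = coneForm n v w) ∧
      ∀ᶠ x in 𝓝 x₀, (√(κ x))⁻¹ • coneEmb (T x) = A (coneEmb x) := by
  -- The factor `κ^(-1/2)` makes the metric induced by `X` flat. Derivatives of `s` do not
  -- contribute, because `coneEmb` is null and orthogonal to its own derivatives.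
  set s : EuclideanSpace ℝ (Fin n) → ℝ := fun x ↦ (√(κ x))⁻¹ with hs
  have hsp : ∀ a ∈ Ω, 0 < s a := fun a ha ↦ inv_pos.2 (Real.sqrt_pos.2 (hpos a ha))
  have hsc : ContDiffOn ℝ ∞ s Ω :=
    (hκ.sqrt fun a ha ↦ (hpos a ha).ne').inv fun a ha ↦ (Real.sqrt_pos.2 (hpos a ha)).ne'
  have hsκ : ∀ a ∈ Ω, s a * s a * κ a = 1 := fun a ha ↦ by
    have h1 := Real.mul_self_sqrt (hpos a ha).le
    have h2 := (Real.sqrt_pos.2 (hpos a ha)).ne'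
    simp only [hs]
    field_simp
    rw [pow_two, h1]
  set X : EuclideanSpace ℝ (Fin n) → ConeSpace n := fun x ↦ s x • coneEmb (T x) with hX
  have hXc : ContDiffOn ℝ ∞ X Ω := hsc.smul (contDiff_coneEmb.comp_contDiffOn hT)
  set P : EuclideanSpace ℝ (Fin n) → EuclideanSpace ℝ (Fin n) → ConeSpace n :=
    fun x v ↦ (0, fderiv ℝ T x v, minkowskiBilin n (T x) (fderiv ℝ T x v)) with hP
  have hXd : ∀ x ∈ Ω, ∀ i, partialD i X x =
      s x • P x (EuclideanSpace.single i 1) + partialD i s x • coneEmb (T x) := by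
    intro x hx i
    have h1 := ((hT.contDiffAt (hΩ.mem_nhds hx)).differentiableAt (by simp)).hasFDerivAt
    have h2 := ((hsc.contDiffAt (hΩ.mem_nhds hx)).differentiableAt (by simp)).hasFDerivAt
    have h3 := h2.smul ((hasFDerivAt_coneEmb (T x)).comp x h1)
    have h4 : fderiv ℝ X x = _ := h3.fderiv
    unfold partialD
    rw [h4]
    rfl
  have q0 : ∀ x, coneForm n (coneEmb (T x)) (coneEmb (T x)) = 0 := fun x ↦ coneForm_coneEmb _
  have q1 : ∀ x v, coneForm n (P x v) (coneEmb (T x)) = 0 := fun x v ↦ by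
    simp only [hP, coneForm_apply, coneEmb]
    rw [minkowskiBilin_comm]
    ring
  have q1' : ∀ x v, coneForm n (coneEmb (T x)) (P x v) = 0 := fun x v ↦ by
    rw [coneForm_comm, q1]
  have q2 : ∀ x ∈ Ω, ∀ v w, coneForm n (P x v) (P x w) = κ x * minkowskiForm v w :=
    fun x hx v w ↦ by
      simp only [hP, coneForm_apply, zero_mul, mul_zero, sub_zero]
      exact hconf x hx v w
  refine exists_isometry_of_flat hn hΩ hXc (fun x hx ↦ ?_) (fun x hx i j ↦ ?_)
    (fun x hx w h0 h1 ↦ ?_) hx₀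
  · simp only [hX, map_smul, _root_.smul_apply, q0, smul_zero]
  · rw [hXd x hx, hXd x hx]
    simp only [map_add, map_smul, _root_.add_apply, _root_.smul_apply, q0, q1, q1', q2 x hx,
      smul_eq_mul, mul_zero, add_zero]
    have h2 : minkowskiForm (EuclideanSpace.single i (1 : ℝ)) (EuclideanSpace.single j 1) =
        if i = j then lorentzSign i else 0 := by
      rw [← minkowskiBilin_apply, minkowskiBilin_single]
      by_cases hij : i = j
      · subst hij; simp
      · simp [hij, Ne.symm hij]
    rw [h2, ← mul_assoc, ← mul_assoc, hsκ x hx, one_mul]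
  · have hs0 := (hsp x hx).ne'
    have h2 : coneForm n w (coneEmb (T x)) = 0 := by
      simp only [hX, map_smul, smul_eq_mul] at h0
      exact (mul_eq_zero.1 h0).resolve_left hs0
    have h3 : ∀ k, coneForm n w (P x (EuclideanSpace.single k 1)) = 0 := fun k ↦ by
      have := h1 k
      rw [hXd x hx] at this
      simp only [map_add, map_smul, h2, smul_eq_mul, mul_zero, add_zero] at this
      exact (mul_eq_zero.1 this).resolve_left hs0
    set L : EuclideanSpace ℝ (Fin n) →L[ℝ] ℝ := (coneForm n w).comp
      ((0 : EuclideanSpace ℝ (Fin n) →L[ℝ] ℝ).prod ((fderiv ℝ T x).prod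
        ((minkowskiBilin n (T x)).comp (fderiv ℝ T x)))) with hL
    have h4 : L = 0 := eq_zero_of_apply_single h3
    -- Conformality makes the derivative of `T` bijective, so `w` is orthogonal to the whole tangent
    -- space along `coneEmb` at `T x`.
    have hinj : Function.Injective (fderiv ℝ T x).toLinearMap := by
      rw [injective_iff_map_eq_zero]
      intro v hv
      have hv : fderiv ℝ T x v = 0 := hv
      refine eq_zero_of_minkowskiBilin fun y ↦ ?_
      have h5 := hconf x hx v y
      rw [hv, ← minkowskiBilin_apply, map_zero, _root_.zero_apply] at h5
      exact (mul_eq_zero.1 h5.symm).resolve_left (hpos x hx).ne'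
    have hsurj := LinearMap.injective_iff_surjective.1 hinj
    have h6 : w = w.1 • coneEmb (T x) := eq_smul_coneEmb h2 fun y ↦ by
      obtain ⟨v, rfl⟩ := hsurj y
      exact congrArg (fun f ↦ f v) h4
    refine ⟨w.1 * (s x)⁻¹, ?_⟩
    simp only [hX]
    rw [smul_smul, inv_mul_cancel_right₀ hs0, ← h6]

/-- A linear map on the cone space is determined by its values on an open piece of the embedded
Minkowski space. -/
theorem eq_zero_of_coneEmb_eq_zero (hn : 0 < n) {V : Type*} [NormedAddCommGroup V]
    [NormedSpace ℝ V] {f : ConeSpace n →L[ℝ] V} {x₀ : EuclideanSpace ℝ (Fin n)}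
    (h : ∀ᶠ x in 𝓝 x₀, f (coneEmb x) = 0) : f = 0 := by
  -- `coneEmb` together with its first and second derivatives spans the cone space, so it suffices
  -- to differentiate the equation twice.
  have h1 : ∀ᶠ x in 𝓝 x₀, ∀ y, f (0, y, minkowskiBilin n x y) = 0 := by
    filter_upwards [h.eventually_nhds] with x hx y
    have h2 := (f.hasFDerivAt.comp x (hasFDerivAt_coneEmb x)).unique
      ((hasFDerivAt_const (0 : V) x).congr_of_eventuallyEq hx)
    exact congrArg (fun L ↦ L y) h2
  have h2 : ∀ y z, f (0, 0, minkowskiBilin n z y) = 0 := fun y z ↦ by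
    have h3 : HasFDerivAt (fun x ↦ f (0, y, minkowskiBilin n x y)) (f.comp
        ((0 : EuclideanSpace ℝ (Fin n) →L[ℝ] ℝ).prod
        ((0 : EuclideanSpace ℝ (Fin n) →L[ℝ] EuclideanSpace ℝ (Fin n)).prod
          ((minkowskiBilin n).flip y)))) x₀ :=
      f.hasFDerivAt.comp x₀ ((hasFDerivAt_const _ _).prodMk ((hasFDerivAt_const _ _).prodMk
        ((minkowskiBilin n).flip y).hasFDerivAt))
    have h4 := h3.unique ((hasFDerivAt_const (0 : V) x₀).congr_of_eventuallyEq
      (h1.mono fun x hx ↦ hx y))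
    exact congrArg (fun L ↦ L z) h4
  have h3 : ∀ c : ℝ, f (0, 0, c) = 0 := fun c ↦ by
    have h4 := h2 (EuclideanSpace.single ⟨0, hn⟩ 1)
      ((lorentzSign (⟨0, hn⟩ : Fin n) * c) • EuclideanSpace.single ⟨0, hn⟩ 1)
    rw [minkowskiBilin_single] at h4
    have h5 := lorentzSign_mul_self (⟨0, hn⟩ : Fin n)
    simp only [PiLp.smul_apply, PiLp.single_apply, smul_eq_mul, ↓reduceIte, mul_one] at h4
    rwa [← mul_assoc, h5, one_mul] at h4
  have h4 : ∀ y, f (0, y, 0) = 0 := fun y ↦ by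
    have h5 : ((0, y, 0) : ConeSpace n) =
        (0, y, minkowskiBilin n x₀ y) - (0, 0, minkowskiBilin n x₀ y) := by simp
    rw [h5, map_sub, h1.self_of_nhds, h3, sub_zero]
  ext v
  · have h5 : ((1, 0, 0) : ConeSpace n) =
        coneEmb x₀ - (0, x₀, 0) - (0, 0, minkowskiBilin n x₀ x₀ / 2) := by simp [coneEmb]
    change f (1, 0, 0) = 0
    rw [h5, map_sub, map_sub, h.self_of_nhds, h4, h3, sub_zero, sub_zero]
  · exact h4 _
  · exact h3 _

/-- The linear isometries of the cone space. -/
def coneIsometry (n : ℕ) : Subgroup (ConeSpace n ≃ₗ[ℝ] ConeSpace n) where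
  carrier := {A | ∀ v w, coneForm n (A v) (A w) = coneForm n v w}
  mul_mem' := fun {A B} hA hB v w ↦ (hA (B v) (B w)).trans (hB v w)
  one_mem' := fun _ _ ↦ rfl
  inv_mem' := fun {A} hA v w ↦ by
    rw [← hA, ← LinearEquiv.mul_apply, ← LinearEquiv.mul_apply, mul_inv_cancel]
    rfl

theorem exists_coneIsometry {A : ConeSpace n →ₗ[ℝ] ConeSpace n}
    (h : ∀ v w, coneForm n (A v) (A w) = coneForm n v w) :
    ∃ B : coneIsometry n, ∀ v, B.1 v = A v := by
  have hinj : Function.Injective A := by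
    rw [injective_iff_map_eq_zero]
    intro v hv
    refine eq_zero_of_coneForm fun w ↦ ?_
    rw [← h, hv, map_zero, _root_.zero_apply]
  exact ⟨⟨LinearEquiv.ofInjectiveEndo A hinj, h⟩, fun v ↦ rfl⟩

end Liouville

/-! ### The global map to the null cone and its maximal argument -/

section Developing

variable {n : ℕ} {M : Type*} [TopologicalSpace M]

/-- The two timelike coordinates of a vector of the cone space. -/
noncomputable def timelikePart (hn : 0 < n) (v : ConeSpace n) : ℂ :=
  ⟨v.2.1 ⟨0, hn⟩, (v.1 + v.2.2) / √2⟩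

theorem continuous_timelikePart (hn : 0 < n) : Continuous (timelikePart hn) := by
  have h : timelikePart hn = fun v ↦ Complex.equivRealProdCLM.symm
      (v.2.1 ⟨0, hn⟩, (v.1 + v.2.2) / √2) := by
    ext v
    rw [Complex.equivRealProdCLM_symm_apply]
    exact Complex.ext (by simp [timelikePart]) (by simp [timelikePart])
  rw [h]
  fun_prop

theorem minkowskiForm_self_eq (hn : 0 < n) (x : EuclideanSpace ℝ (Fin n)) :
    minkowskiForm x x = ∑ i, x i ^ 2 - 2 * x ⟨0, hn⟩ ^ 2 := by
  have h : ∀ i : Fin n, lorentzSign i * (x i * x i) =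
      x i ^ 2 - if i = ⟨0, hn⟩ then 2 * x i ^ 2 else 0 := fun i ↦ by
    have : (i : ℕ) = 0 ↔ i = ⟨0, hn⟩ := by rw [Fin.ext_iff]
    unfold lorentzSign
    simp only [this]
    split_ifs <;> ring
  unfold minkowskiForm
  simp only [h, Finset.sum_sub_distrib, Finset.sum_ite_eq', Finset.mem_univ, if_true]

/-- The form is positive definite on the vectors whose timelike part vanishes. -/
theorem timelikePart_ne_zero (hn : 0 < n) {v : ConeSpace n} (hv : coneForm n v v = 0)
    (h0 : v ≠ 0) : timelikePart hn v ≠ 0 := by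
  intro h
  refine h0 ?_
  have h1 : v.2.1 ⟨0, hn⟩ = 0 := congrArg Complex.re h
  have h2 : (v.1 + v.2.2) / √2 = 0 := congrArg Complex.im h
  have h3 : v.2.2 = -v.1 := by
    have := (div_eq_zero_iff.1 h2).resolve_right (by positivity)
    linarith
  rw [coneForm_apply, minkowskiBilin_apply, minkowskiForm_self_eq hn, h1, h3] at hv
  have h4 : 0 ≤ ∑ i, v.2.1 i ^ 2 := Finset.sum_nonneg fun i _ ↦ sq_nonneg _
  have h5 : v.1 = 0 := by nlinarith [sq_nonneg v.1]
  have h6 : ∑ i, v.2.1 i ^ 2 = 0 := by nlinarith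
  have h7 : v.2.1 = 0 := by
    ext i
    have := (Finset.sum_eq_zero_iff_of_nonneg fun i _ ↦ sq_nonneg (v.2.1 i)).1 h6 i
      (Finset.mem_univ i)
    exact pow_eq_zero_iff two_ne_zero |>.1 this
  exact Prod.ext h5 (Prod.ext h7 (by rw [h3, h5]; simp))

/-- The timelike vector that is orthogonal to the vectors whose timelike part has argument `θ`. -/
noncomputable def timelikeVector (hn : 0 < n) (θ : ℝ) : ConeSpace n :=
  (Real.cos θ / √2, EuclideanSpace.single ⟨0, hn⟩ (-Real.sin θ), Real.cos θ / √2)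

theorem coneForm_timelikeVector (hn : 0 < n) (θ : ℝ) (v : ConeSpace n) :
    coneForm n (timelikeVector hn θ) v =
      (timelikePart hn v).re * Real.sin θ - (timelikePart hn v).im * Real.cos θ := by
  have h : EuclideanSpace.single (⟨0, hn⟩ : Fin n) (-Real.sin θ) =
      (-Real.sin θ) • EuclideanSpace.single ⟨0, hn⟩ (1 : ℝ) := by
    ext i
    simp [neg_ite]
  rw [coneForm_apply, minkowskiBilin_comm]
  simp only [timelikeVector, timelikePart, h, map_smul, minkowskiBilin_single, smul_eq_mul]
  simp [lorentzSign]
  ring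

theorem coneForm_timelikeVector_self (hn : 0 < n) (θ : ℝ) :
    coneForm n (timelikeVector hn θ) (timelikeVector hn θ) = -1 := by
  rw [coneForm_timelikeVector]
  have h : √2 * √2 = (2 : ℝ) := Real.mul_self_sqrt (by norm_num)
  have h1 : (Real.cos θ / √2 + Real.cos θ / √2) / √2 = Real.cos θ := by
    field_simp
    rw [pow_two, h]
    ring
  simp only [timelikePart, timelikeVector, h1, PiLp.single_apply, if_true]
  nlinarith [Real.sin_sq_add_cos_sq θ]

/-- On a compact simply connected space, a continuous map into the null cone that avoids the
origin stays locally on one side of the orthogonal hyperplane of some timelike vector. -/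
theorem exists_timelike_support [CompactSpace M] [SimplyConnectedSpace M]
    [LocallyPathConnectedSpace M] (hn : 0 < n) {D : M → ConeSpace n} (hD : Continuous D)
    (hnull : ∀ x, coneForm n (D x) (D x) = 0) (hne : ∀ x, D x ≠ 0) :
    ∃ (w : ConeSpace n) (x₀ : M), coneForm n w w = -1 ∧ coneForm n w (D x₀) = 0 ∧
      ∀ᶠ x in 𝓝 x₀, 0 ≤ coneForm n w (D x) := by
  have hz : ∀ x, timelikePart hn (D x) ≠ 0 := fun x ↦ timelikePart_ne_zero hn (hnull x) (hne x)
  obtain ⟨a⟩ : Nonempty M := inferInstance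
  -- Lifting through the covering `exp` gives a logarithm of the timelike part, whose imaginary part
  -- is a real-valued argument and attains its maximum.
  obtain ⟨F, ⟨-, hF⟩, -⟩ := Complex.isCoveringMapOn_exp.existsUnique_continuousMap_lifts
    (⟨fun x ↦ timelikePart hn (D x), (continuous_timelikePart hn).comp hD⟩ : C(M, ℂ))
    (a₀ := a) (e₀ := Complex.log (timelikePart hn (D a))) (Complex.exp_log (hz a)) hz
  have hF' : ∀ x, timelikePart hn (D x) = Complex.exp (F x) := fun x ↦ (congrFun hF x).symm
  have hc : Continuous fun x ↦ (F x).im := Complex.continuous_im.comp F.continuous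
  obtain ⟨x₀, -, hmax⟩ := isCompact_univ.exists_isMaxOn univ_nonempty hc.continuousOn
  have key : ∀ x, coneForm n (timelikeVector hn (F x₀).im) (D x) =
      Real.exp (F x).re * Real.sin ((F x₀).im - (F x).im) := fun x ↦ by
    rw [coneForm_timelikeVector, hF', Complex.exp_re, Complex.exp_im, Real.sin_sub]
    ring
  refine ⟨timelikeVector hn (F x₀).im, x₀, coneForm_timelikeVector_self hn _, ?_, ?_⟩
  · rw [key, sub_self, Real.sin_zero, mul_zero]
  · have h1 : ∀ᶠ x in 𝓝 x₀, (F x₀).im - Real.pi < (F x).im :=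
      hc.continuousAt.eventually (lt_mem_nhds (by linarith [Real.pi_pos]))
    filter_upwards [h1] with x hx
    rw [key]
    have h2 : (F x).im ≤ (F x₀).im := hmax (mem_univ x)
    exact mul_nonneg (Real.exp_pos _).le
      (Real.sin_nonneg_of_nonneg_of_le_pi (by linarith) (by linarith))

/-- A local minimum along the embedded Minkowski space of a linear functional that vanishes there
represents a null vector. -/
theorem coneForm_self_eq_zero_of_isLocalMin {w : ConeSpace n} {y₀ : EuclideanSpace ℝ (Fin n)}
    (h0 : coneForm n w (coneEmb y₀) = 0) (h : ∀ᶠ y in 𝓝 y₀, 0 ≤ coneForm n w (coneEmb y)) :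
    coneForm n w w = 0 := by
  have hmin : IsLocalMin (fun y ↦ coneForm n w (coneEmb y)) y₀ := by
    filter_upwards [h] with y hy
    rw [h0]
    exact hy
  have h1 := hmin.hasFDerivAt_eq_zero
    ((coneForm n w).hasFDerivAt.comp y₀ (hasFDerivAt_coneEmb y₀))
  have h2 := eq_smul_coneEmb h0 fun y ↦ congrArg (fun L ↦ L y) h1
  rw [h2, map_smul, map_smul, _root_.smul_apply, coneForm_coneEmb, smul_zero, smul_zero]

variable [ChartedSpace (EuclideanSpace ℝ (Fin n)) M] [IsManifold (𝓡 n) ∞ M]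

namespace LorentzianMetric.IsConformalChart

variable {g : LorentzianMetric n M} {φ ψ : OpenPartialHomeomorph M (EuclideanSpace ℝ (Fin n))}
  {c d : M → ℝ}

/-- The isometric lifts of two conformal charts to the null cone differ locally by a linear
isometry. -/
theorem exists_coneIsometry (hn : 3 ≤ n) (hφ : g.IsConformalChart φ c)
    (hψ : g.IsConformalChart ψ d) {y : M} (hy : y ∈ φ.source) (hy' : y ∈ ψ.source) :
    ∃ A : coneIsometry n, ∀ᶠ x in 𝓝 y,
      (√(c x))⁻¹ • coneEmb (φ x) = A.1 ((√(d x))⁻¹ • coneEmb (ψ x)) := by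
  set Ω := (ψ.symm.trans φ).source with hΩ
  have hΩo : IsOpen Ω := (ψ.symm.trans φ).open_source
  have hm : ∀ x ∈ φ.source, x ∈ ψ.source → ψ x ∈ Ω := fun x hx hx' ↦
    ⟨ψ.map_source hx', by simpa [ψ.left_inv hx'] using hx⟩
  have h1 : ∀ a ∈ Ω, ψ.symm a ∈ φ.source := fun a ha ↦ ha.2
  have h2 : ∀ a ∈ Ω, ψ.symm a ∈ ψ.source := fun a ha ↦ ψ.map_target ha.1
  have hs : ContMDiffOn (𝓡 n) (𝓡 n) ∞ ψ.symm Ω := hψ.contMDiffOn_symm.mono fun a ha ↦ ha.1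
  have hc : ContDiffOn ℝ ∞ (c ∘ ψ.symm) Ω :=
    contMDiffOn_iff_contDiffOn.1 (hφ.contMDiffOn_factor.comp hs h1)
  have hd : ContDiffOn ℝ ∞ (d ∘ ψ.symm) Ω :=
    contMDiffOn_iff_contDiffOn.1 (hψ.contMDiffOn_factor.comp hs h2)
  obtain ⟨A, hA, hA'⟩ := exists_isometry_of_conformal hn hΩo (hφ.contDiffOn_transition hψ)
    (κ := fun a ↦ c (ψ.symm a) / d (ψ.symm a))
    (hc.div hd fun a ha ↦ (hψ.pos _ (h2 a ha)).ne')
    (fun a ha ↦ div_pos (hφ.pos _ (h1 a ha)) (hψ.pos _ (h2 a ha)))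
    (fun a ha ↦ hφ.conformal_transition hψ ha) (hm y hy hy')
  obtain ⟨B, hB⟩ := _root_.exists_coneIsometry hA
  refine ⟨B, ?_⟩
  filter_upwards [(ψ.continuousAt hy').eventually hA', φ.open_source.mem_nhds hy,
    ψ.open_source.mem_nhds hy'] with x hx hxφ hxψ
  simp only [Function.comp_apply, ψ.left_inv hxψ] at hx
  have hcp := Real.sqrt_pos.2 (hφ.pos x hxφ)
  have hdp := Real.sqrt_pos.2 (hψ.pos x hxψ)
  rw [hB, map_smul, ← hx, smul_smul, Real.sqrt_div (hφ.pos x hxφ).le]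
  congr 1
  field_simp

end LorentzianMetric.IsConformalChart

/-- A compact simply connected manifold of dimension at least three carries no conformally flat
Lorentzian metric. -/
theorem LorentzianMetric.IsConformallyFlat.false_of_three_le [CompactSpace M]
    [SimplyConnectedSpace M] [LocallyPathConnectedSpace M] (hn : 3 ≤ n)
    {g : LorentzianMetric n M} (h : g.IsConformallyFlat) : False := by
  choose φ c hmem hφ using h.exists_chart
  set d : M → M → ConeSpace n := fun p x ↦ (√(c p x))⁻¹ • coneEmb (φ p x) with hd
  have hpos : ∀ p, ∀ x ∈ (φ p).source, 0 < (√(c p x))⁻¹ := fun p x hx ↦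
    inv_pos.2 (Real.sqrt_pos.2 ((hφ p).pos x hx))
  obtain ⟨h, h1, h2⟩ := exists_primitive_of_germRel (fun p ↦ (φ p).source)
    (fun p ↦ (φ p).open_source) hmem
    (fun i j y (A : coneIsometry n) ↦ ∀ᶠ x in 𝓝 y, d i x = A.1 (d j x))
    (fun i j y A hA ↦ hA.eventually_nhds)
    (fun i j k y A B hA hB ↦ by
      filter_upwards [hA, hB] with x hx hx'
      rw [hx, hx']
      rfl)
    (fun i j y A B hi hj hA hB ↦ by
      have h3 : ∀ᶠ a in 𝓝 (φ j y), (A.1.toLinearMap - B.1.toLinearMap).toContinuousLinearMap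
          (coneEmb a) = 0 := by
        have hy' : φ j y ∈ (φ j).target := (φ j).map_source hj
        have hcont : Tendsto (φ j).symm (𝓝 (φ j y)) (𝓝 y) := by
          have := (φ j).continuousAt_symm hy'
          rwa [ContinuousAt, (φ j).left_inv hj] at this
        filter_upwards [hcont.eventually (hA.and (hB.and ((φ j).open_source.mem_nhds hj))),
          (φ j).open_target.mem_nhds hy'] with a ⟨ha1, ha2, ha3⟩ ha4
        have h4 := ha1.symm.trans ha2
        simp only [hd, (φ j).right_inv ha4, map_smul] at h4
        have h5 := smul_right_injective _ (hpos j _ ha3).ne' h4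
        change A.1 (coneEmb a) - B.1 (coneEmb a) = 0
        rw [h5, sub_self]
      have h4 := eq_zero_of_coneEmb_eq_zero (by omega) h3
      refine Subtype.ext (LinearEquiv.ext fun v ↦ ?_)
      exact sub_eq_zero.1 (congrArg (fun f ↦ f v) h4))
    (fun i j y hi hj ↦ (hφ i).exists_coneIsometry hn (hφ j) hi hj)
  -- On the domain of the chart at `p`, the vector `(h p x)⁻¹ (d p x)` does not depend on `p`, so
  -- `D` is globally defined and locally is one chart lift moved by a fixed isometry.
  set D : M → ConeSpace n := fun x ↦ (h x x)⁻¹.1 (d x x) with hD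
  have hDp : ∀ p, ∀ x ∈ (φ p).source, D x = (h p x)⁻¹.1 (d p x) := fun p x hx ↦ by
    have h3 := (h2 p x x hx (hmem x)).self_of_nhds
    rw [h3]
    change (h x x)⁻¹.1 (d x x) = ((h p x)⁻¹ * (h p x * (h x x)⁻¹)).1 (d x x)
    rw [inv_mul_cancel_left]
  have hloc : ∀ p, ∀ᶠ x in 𝓝 p, D x = (h p p)⁻¹.1 (d p x) := fun p ↦ by
    filter_upwards [h1 p p (hmem p), (φ p).open_source.mem_nhds (hmem p)] with x hx hx'
    rw [hDp p x hx', hx]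
  have hDc : Continuous D := continuous_iff_continuousAt.2 fun p ↦ by
    refine ContinuousAt.congr ?_ ((hloc p).mono fun x hx ↦ hx.symm)
    have hcc : ContinuousAt (c p) p :=
      ((hφ p).contMDiffOn_factor.contMDiffAt ((φ p).open_source.mem_nhds (hmem p))).continuousAt
    refine ((h p p)⁻¹.1.toLinearMap.toContinuousLinearMap.continuous.continuousAt).comp ?_
    refine (hcc.sqrt.inv₀ (Real.sqrt_pos.2 ((hφ p).pos p (hmem p))).ne').smul ?_
    exact contDiff_coneEmb.continuous.continuousAt.comp ((φ p).continuousAt (hmem p))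
  obtain ⟨w, x₀, hw, hw0, hws⟩ := exists_timelike_support (by omega) hDc
    (fun x ↦ by
      rw [hD]
      refine ((h x x)⁻¹.2 _ _).trans ?_
      simp only [hd, map_smul, _root_.smul_apply, coneForm_coneEmb, smul_zero])
    (fun x hx ↦ by
      have h3 : d x x = 0 := (map_eq_zero_iff _ (h x x)⁻¹.1.injective).1 hx
      have h4 := (smul_eq_zero.1 h3).resolve_left (hpos x x (hmem x)).ne'
      exact one_ne_zero (congrArg Prod.fst h4))
  -- Applying `B` moves the pairing with `w` to the chart at `x₀`: up to a positive factor it is the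
  -- pairing of `B w` with `coneEmb`. The local minimum makes `B w` null, although its square is
  -- that of `w`, namely -1.
  set B := h x₀ x₀ with hB
  have hform : ∀ᶠ x in 𝓝 x₀, coneForm n w (D x) =
      (√(c x₀ x))⁻¹ * coneForm n (B.1 w) (coneEmb (φ x₀ x)) := by
    filter_upwards [hloc x₀] with x hx
    rw [hx, ← B.2]
    change coneForm n (B.1 w) ((B * B⁻¹).1 (d x₀ x)) = _
    rw [mul_inv_cancel]
    change coneForm n (B.1 w) (d x₀ x) = _
    simp only [hd, map_smul, smul_eq_mul]
  have hx₀ := hmem x₀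
  have hy₀ : φ x₀ x₀ ∈ (φ x₀).target := (φ x₀).map_source hx₀
  have hcont : Tendsto (φ x₀).symm (𝓝 (φ x₀ x₀)) (𝓝 x₀) := by
    have := (φ x₀).continuousAt_symm hy₀
    rwa [ContinuousAt, (φ x₀).left_inv hx₀] at this
  have h5 : coneForm n (B.1 w) (B.1 w) = 0 := by
    refine coneForm_self_eq_zero_of_isLocalMin (y₀ := φ x₀ x₀) ?_ ?_
    · have h6 := hform.self_of_nhds
      rw [hw0] at h6
      exact (mul_eq_zero.1 h6.symm).resolve_left (hpos x₀ x₀ hx₀).ne'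
    · filter_upwards [hcont.eventually (hform.and (hws.and ((φ x₀).open_source.mem_nhds hx₀))),
        (φ x₀).open_target.mem_nhds hy₀] with a ⟨ha1, ha2, ha3⟩ ha4
      rw [ha1, (φ x₀).right_inv ha4] at ha2
      exact (mul_nonneg_iff_of_pos_left (hpos x₀ _ ha3)).1 ha2
  rw [B.2, hw] at h5
  norm_num at h5

end Developing

end LorentzConformal

/-- A closed, simply connected Lorentzian manifold is not conformally flat. -/
theorem propositionB (n : ℕ) (hn : 2 ≤ n) {M : Type*} [TopologicalSpace M] [T2Space M]
    [ChartedSpace (EuclideanSpace ℝ (Fin n)) M] [IsManifold (𝓡 n) ∞ M]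
    [CompactSpace M] [SimplyConnectedSpace M] (g : LorentzianMetric n M) :
    ¬ g.IsConformallyFlat := by
  intro h
  have : LocallyPathConnectedSpace M :=
    ChartedSpace.locallyPathConnectedSpace (EuclideanSpace ℝ (Fin n)) M
  obtain rfl | hn := hn.eq_or_lt
  · obtain ⟨B⟩ := h.nonempty_bifoliation
    exact B.false_of_simplyConnected
  · exact h.false_of_three_le hn
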